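/- Let $1<\alpha\le 2$, $T\ge 1$, $N\ge 0$. Write $z^{<\beta>}=|z|^{\beta-1}\overline z$ for $z\in\mathbb C$ and apply this power coordinatewise to vectors. For jointly symmetric $\alpha$-stable (S$\alpha$S) complex random variables $X,Y$ let $[X,Y]_\alpha=\int (x_1+ix_2)(y_1+iy_2)^{<\alpha-1>}\,d\Gamma(x_1,x_2,y_1,y_2)$ be the covariation, where $\Gamma$ is a symmetric finite measure on the unit sphere of $\mathbb R^4$ that represents the characteristic function of $(\operatorname{Re}X,\operatorname{Im}X,\operatorname{Re}Y,\operatorname{Im}Y)$ in the form $\exp(-\int|\langle t,x\rangle|^\alpha d\Gamma(x))$, and let $\|X\|_\alpha=[X,X]_\alpha^{1/\alpha}$. Let $\{\xi(n)\}_{n\in\mathbb Z}$ be a periodically harmonizable S$\alpha$S sequence with period $T$: it is S$\alpha$S, and the blocked sequence $\vec\xi(n)=\{\xi(nT+k)\}_{k=0}^{T-1}$ is harmonizable, $\vec\xi(n)=\int_{-\pi}^{\pi}e^{in\theta}\,d\vec Z(\theta)$, where $\vec Z$ is a $T$-dimensional S$\alpha$S process with independent increments on $[-\pi,\pi]$ with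 a finite matrix-valued spectral measure $\mu$, that is, $$[\vec a^{\top}(\vec Z(t)-\vec Z(s)),\ \vec b^{\top}(\vec Z(t)-\vec Z(s))]_\alpha=\vec a^{\top}\mu((s,t])\,\vec b^{<\alpha-1>}\qquad(\vec a,\vec b\in\mathbb C^T,\ -\pi\le s\le t\le\pi),$$ and $[\xi(nT+k),\xi(mT+l)]_\alpha=\int_{-\pi}^{\pi} e^{i(n-m)\theta}\,d\mu_{kl}(\theta)$. Suppose that $\mu$ is absolutely continuous with density $f(\theta)$, that $f(\theta)$ is positive definite for almost every $\theta$, and that $\int_{-\pi}^{\pi}\operatorname{Tr}[f(\theta)^{-1/(\alpha-1)}]\,d\theta<\infty$. Let $L^\alpha(f)$ be the space of measurable $h:(-\pi,\pi]\to\mathbb C^T$ with $\int h^\top f h^{<\alpha-1>}d\theta<\infty$ (the $\alpha$-th power of the norm), and let $\int h^\top d\vec Z$ be the limit in probability of the integrals of step functions that converge to $h$ in $L^\alpha(f)$. Let $\vec a(j)=\{a_k(j)\}_{k=0}^{T-1}\in\mathbb C^T$, $j=0,\dots,N$, and $$A_N\vec\xi=\sum_{j=0}^N\sum_{k=0}^{T-1}a_k(j)\,\xi(jT+k),\qquad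 A_N(e^{i\theta})=\sum_{j=0}^N\vec a(j)e^{ij\theta}.$$ Let $H^N(\xi)$ be the $\|\cdot\|_\alpha$-closed linear span of the observed values $\xi(m)$, $m\in\mathbb Z\setminus\{0,\dots,T(N+1)-1\}$. An optimal linear estimate of $A_N\vec\xi$ is an element of $H^N(\xi)$ at minimal $\|\cdot\|_\alpha$-distance from $A_N\vec\xi$. For $\vec c(0),\dots,\vec c(N)\in\mathbb C^T$ put $$C_N(e^{i\theta})=\sum_{j=0}^N\vec c(j)e^{-ij\theta},\qquad h(\theta)=A_N(e^{i\theta})-\left(f^{-1}(\theta)C_N(e^{i\theta})\right)^{<\frac1{\alpha-1}>}.$$ Then the system $$\int_{-\pi}^{\pi}e^{-i\theta k}\left[A_N(e^{i\theta})-\left(f^{-1}(\theta)C_N(e^{i\theta})\right)^{<\frac1{\alpha-1}>}\right]d\theta=0,\qquad k=0,\dots,N,$$ has exactly one solution $\vec c(0),\dots,\vec c(N)$. For this solution $h$ lies in the closed subspace of $L^\alpha(f)$ generated by the functions $e^{ij\theta}\delta_k$, $j\in\mathbb Z\setminus\{0,\dots,N\}$, where $\delta_k$ are the coordinate vectors of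 $\mathbb C^T$. The optimal linear estimate of $A_N\vec\xi$ exists, is almost surely unique, and equals $$\hat A_N\vec\xi=\int_{-\pi}^{\pi}h(\theta)^{\top}\,d\vec Z(\theta),$$ and its error is $$\|A_N\vec\xi-\hat A_N\vec\xi\|_\alpha^\alpha=\int_{-\pi}^{\pi}\left[\left(f^{-1}C_N\right)^{<\frac1{\alpha-1}>}\right]^{\top}f(\theta)\left[\left(f^{-1}C_N\right)^{<\frac1{\alpha-1}>}\right]^{<\alpha-1>}d\theta,$$ which for $T=1$ is $\int_{-\pi}^{\pi}\left|\left(f^{-1}C_N\right)^{<\frac1{\alpha-1}>}\right|^{\alpha}f(\theta)\,d\theta$. -/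

import Mathlib

open MeasureTheory ProbabilityTheory Filter Topology
open scoped Matrix ENNReal ComplexOrder

noncomputable section

namespace StableInterp

variable {Ω : Type*} [MeasurableSpace Ω]

/-! ### Symmetric stable random variables, covariation -/

/-- The signed conjugate power `z^{<β>} = |z|^{β-1} * conj z`. -/
def spow (z : ℂ) (β : ℝ) : ℂ := ((‖z‖ ^ (β - 1) : ℝ) : ℂ) * (starRingEnd ℂ) z

/-- Coordinatewise signed conjugate power of a complex vector. -/
def vpow {ι : Type*} (v : ι → ℂ) (β : ℝ) : ι → ℂ := fun k => spow (v k) β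

/-- `Γ` is a spectral measure of the real random vector `X`: a finite symmetric measure carried by
the Euclidean unit sphere with
`E exp(i ∑ t_k X_k) = exp(-∫ |∑ t_k x_k|^α dΓ(x))` for all real `t`. -/
structure IsSpectralMeasure {ι : Type*} [Fintype ι] (α : ℝ) (P : Measure Ω) (X : ι → Ω → ℝ)
    (Γ : Measure (EuclideanSpace ℝ ι)) : Prop where
  finite : IsFiniteMeasure Γ
  sphere : Γ (Metric.sphere (0 : EuclideanSpace ℝ ι) 1)ᶜ = 0
  symm : Γ.map (fun x => -x) = Γ
  charFun : ∀ t : ι → ℝ,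
    ∫ ω, Complex.exp (Complex.I * ((∑ k, t k * X k ω : ℝ) : ℂ)) ∂P
      = Complex.exp (-((∫ x, |∑ k, t k * x k| ^ α ∂Γ : ℝ) : ℂ))

/-- The real random variables `X k` are jointly symmetric `α`-stable. -/
def JointlySaS {ι : Type*} [Fintype ι] (α : ℝ) (P : Measure Ω) (X : ι → Ω → ℝ) : Prop :=
  (∀ k, AEMeasurable (X k) P) ∧ ∃ Γ, IsSpectralMeasure α P X Γ

/-- The complex random variables `X k` are jointly symmetric `α`-stable: their real and imaginary
parts are. -/
def CJointlySaS {ι : Type*} [Fintype ι] (α : ℝ) (P : Measure Ω) (X : ι → Ω → ℂ) : Prop :=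
  JointlySaS α P (Sum.elim (fun k ω => (X k ω).re) (fun k ω => (X k ω).im))

/-- A complex symmetric `α`-stable random variable. -/
def IsSaS (α : ℝ) (P : Measure Ω) (X : Ω → ℂ) : Prop :=
  CJointlySaS α P (fun _ : Unit => X)

/-- The real vector `(Re X, Im X, Re Y, Im Y)`. -/
def realQuad (X Y : Ω → ℂ) : Fin 4 → Ω → ℝ :=
  ![fun ω => (X ω).re, fun ω => (X ω).im, fun ω => (Y ω).re, fun ω => (Y ω).im]

open Classical in
/-- The covariation `[X, Y]_α = ∫ (x₁ + i x₂) (y₁ + i y₂)^{<α-1>} dΓ(x₁, x₂, y₁, y₂)`, where `Γ` is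
a spectral measure of `(Re X, Im X, Re Y, Im Y)`. (For `1 < α ≤ 2` the value is determined by the
joint law of `X` and `Y`; in particular for `α = 2`, where `Γ` itself is not.) -/
def covariation (α : ℝ) (P : Measure Ω) (X Y : Ω → ℂ) : ℂ :=
  if h : JointlySaS α P (realQuad X Y) then
    ∫ x, (⟨x 0, x 1⟩ : ℂ) * spow ⟨x 2, x 3⟩ (α - 1) ∂(Classical.choose h.2)
  else 0

/-- `‖X‖_α = [X, X]_α^{1/α}`. -/
def saNorm (α : ℝ) (P : Measure Ω) (X : Ω → ℂ) : ℝ :=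
  (covariation α P X X).re ^ (1 / α)

/-- A complex-valued family (sequence or process) is symmetric `α`-stable: its finite subfamilies
are jointly symmetric `α`-stable. -/
def IsSaSFamily {I : Type*} (α : ℝ) (P : Measure Ω) (X : I → Ω → ℂ) : Prop :=
  ∀ s : Finset I, CJointlySaS α P (fun i : s => X i)

/-! ### Processes with independent increments and their spectral densities -/

/-- The vector process `Z` on `[-π, π]` has independent increments. -/
def IndepIncrements {T : ℕ} (P : Measure Ω) (Z : ℝ → Ω → Fin T → ℂ) : Prop :=
  ∀ (n : ℕ) (t : Fin (n + 1) → ℝ), Monotone t → (∀ i, t i ∈ Set.Icc (-Real.pi) Real.pi) →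
    iIndepFun (fun (i : Fin n) ω => Z (t i.succ) ω - Z (t i.castSucc) ω) P

/-- `Z` is a `T`-dimensional symmetric `α`-stable process on `[-π, π]` with independent increments,
whose matrix-valued spectral measure is finite and absolutely continuous with density `f`, i.e.
`[aᵀ (Z(t) - Z(s)), bᵀ (Z(t) - Z(s))]_α = aᵀ (∫_s^t f) b^{<α-1>}`. -/
structure HasSpectralDensity {T : ℕ} (α : ℝ) (P : Measure Ω) (Z : ℝ → Ω → Fin T → ℂ)
    (f : ℝ → Matrix (Fin T) (Fin T) ℂ) : Prop where
  stable : IsSaSFamily α P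
    (fun (p : Set.Icc (-Real.pi) Real.pi × Fin T) ω => Z p.1 ω p.2)
  indep : IndepIncrements P Z
  integrable : ∀ k l, IntegrableOn (fun θ => f θ k l) (Set.Ioc (-Real.pi) Real.pi)
  spectral : ∀ s t : ℝ, -Real.pi ≤ s → s ≤ t → t ≤ Real.pi → ∀ a b : Fin T → ℂ,
    covariation α P (fun ω => a ⬝ᵥ (Z t ω - Z s ω)) (fun ω => b ⬝ᵥ (Z t ω - Z s ω))
      = a ⬝ᵥ ((Matrix.of fun k l => ∫ θ in Set.Ioc s t, f θ k l) *ᵥ vpow b (α - 1))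

/-! ### The space `L^α(f)` and stochastic integrals -/

/-- The integral `∫ hᵀ f h^{<α-1>} dθ` over `(-π, π]`, the `α`-th power of the norm in `L^α(f)`. -/
def lalpha {T : ℕ} (α : ℝ) (f : ℝ → Matrix (Fin T) (Fin T) ℂ) (h : ℝ → Fin T → ℂ) : ℝ≥0∞ :=
  ∫⁻ θ in Set.Ioc (-Real.pi) Real.pi,
    ENNReal.ofReal (h θ ⬝ᵥ (f θ *ᵥ vpow (h θ) (α - 1))).re

/-- `h` belongs to `L^α(f)`. -/
def MemLalpha {T : ℕ} (α : ℝ) (f : ℝ → Matrix (Fin T) (Fin T) ℂ) (h : ℝ → Fin T → ℂ) : Prop :=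
  AEStronglyMeasurable h (volume.restrict (Set.Ioc (-Real.pi) Real.pi)) ∧ lalpha α f h < ∞

/-- A vector-valued step function: the value `v i` on `(t_i, t_{i+1}] ⊆ (-π, π]`. -/
structure StepFun (T : ℕ) where
  n : ℕ
  t : Fin (n + 1) → ℝ
  mono : Monotone t
  mem : ∀ i, t i ∈ Set.Icc (-Real.pi) Real.pi
  v : Fin n → Fin T → ℂ

/-- The step function as a function. -/
def StepFun.toFun {T : ℕ} (φ : StepFun T) (θ : ℝ) : Fin T → ℂ :=
  ∑ i : Fin φ.n, (Set.Ioc (φ.t i.castSucc) (φ.t i.succ)).indicator (fun _ => φ.v i) θ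

/-- `∫ φᵀ dZ = ∑ v_iᵀ (Z(t_{i+1}) - Z(t_i))` for a step function. -/
def StepFun.integral {T : ℕ} (φ : StepFun T) (Z : ℝ → Ω → Fin T → ℂ) (ω : Ω) : ℂ :=
  ∑ i : Fin φ.n, φ.v i ⬝ᵥ (Z (φ.t i.succ) ω - Z (φ.t i.castSucc) ω)

/-- `X` is (a version of) the stochastic integral `∫ hᵀ dZ`, `h ∈ L^α(f)`: the limit in probability
of the integrals of step functions that converge to `h` in `L^α(f)`. -/
def IsStochIntegral {T : ℕ} (α : ℝ) (P : Measure Ω) (Z : ℝ → Ω → Fin T → ℂ)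
    (f : ℝ → Matrix (Fin T) (Fin T) ℂ) (h : ℝ → Fin T → ℂ) (X : Ω → ℂ) : Prop :=
  MemLalpha α f h ∧ ∃ φ : ℕ → StepFun T,
    Tendsto (fun m => lalpha α f (fun θ => h θ - (φ m).toFun θ)) atTop (𝓝 0) ∧
    TendstoInMeasure P (fun m ω => (φ m).integral Z ω) atTop X

/-! ### Harmonizable and periodically harmonizable sequences -/

/-- The character `e^{i n θ}`. -/
def ex (n : ℤ) (θ : ℝ) : ℂ := Complex.exp (Complex.I * (n : ℂ) * (θ : ℂ))

/-- `X` is a `T`-dimensional harmonizable symmetric `α`-stable sequence represented by the process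
`Z`, with absolutely continuous spectral measure of density `f`. -/
structure IsHarmonizable {T : ℕ} (α : ℝ) (P : Measure Ω) (X : ℤ → Fin T → Ω → ℂ)
    (Z : ℝ → Ω → Fin T → ℂ) (f : ℝ → Matrix (Fin T) (Fin T) ℂ) : Prop where
  stable : IsSaSFamily α P (fun p : ℤ × Fin T => X p.1 p.2)
  process : HasSpectralDensity α P Z f
  repr : ∀ n k, IsStochIntegral α P Z f (fun θ => Pi.single k (ex n θ)) (X n k)
  cov : ∀ n m k l, covariation α P (X n k) (X m l)
    = ∫ θ in Set.Ioc (-Real.pi) Real.pi, ex (n - m) θ * f θ k l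

/-- The blocked sequence `{ξ(nT + k)}`, `k = 0, …, T-1`. -/
def block (T : ℕ) (ξ : ℤ → Ω → ℂ) (n : ℤ) (k : Fin T) : Ω → ℂ := ξ (n * T + (k : ℕ))

/-- `ξ` is a periodically harmonizable symmetric `α`-stable sequence with period `T`: the blocked
sequence is harmonizable (here represented by `Z`, with spectral density `f`). -/
def IsPeriodicallyHarmonizable (α : ℝ) (T : ℕ) (P : Measure Ω) (ξ : ℤ → Ω → ℂ)
    (Z : ℝ → Ω → Fin T → ℂ) (f : ℝ → Matrix (Fin T) (Fin T) ℂ) : Prop :=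
  IsSaSFamily α P ξ ∧ IsHarmonizable α P (block T ξ) Z f

/-- The minimality condition `∫ Tr [f(θ)^{-1/(α-1)}] dθ < ∞`; the power is that of a positive
definite matrix. -/
def Minimality {T : ℕ} (α : ℝ) (f : ℝ → Matrix (Fin T) (Fin T) ℂ) : Prop :=
  (∀ᵐ θ ∂(volume.restrict (Set.Ioc (-Real.pi) Real.pi)), (f θ).PosDef) ∧
  IntegrableOn (fun θ => (cfc (fun x : ℝ => x ^ (-1 / (α - 1))) (f θ)).trace)
    (Set.Ioc (-Real.pi) Real.pi)

/-! ### The interpolation problem -/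

/-- The functional `∑_{j=0}^N ∑_{k=0}^{T-1} a_k(j) ξ(jT + k)`. -/
def functional {T N : ℕ} (a : Fin (N + 1) → Fin T → ℂ) (ξ : ℤ → Ω → ℂ) (ω : Ω) : ℂ :=
  ∑ j : Fin (N + 1), ∑ k : Fin T, a j k * ξ (((j : ℕ) : ℤ) * T + (k : ℕ)) ω

/-- `H^N(ξ)`: the closure in `‖·‖_α` of the linear span of `ξ(m)`,
`m ∈ ℤ \ {0, …, T(N+1) - 1}`. -/
def observed (α : ℝ) (T N : ℕ) (P : Measure Ω) (ξ : ℤ → Ω → ℂ) : Set (Ω → ℂ) :=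
  {η | ∀ ε > 0, ∃ ζ ∈ Submodule.span ℂ (ξ '' (Set.Ico 0 ((T : ℤ) * (N + 1)))ᶜ),
    IsSaS α P (η - ζ) ∧ saNorm α P (η - ζ) < ε}

/-- `Y` is an optimal linear estimate of `A` from the observations: an element of `H^N(ξ)` at
minimal `‖·‖_α`-distance from `A`. -/
def IsOptimal (α : ℝ) (T N : ℕ) (P : Measure Ω) (ξ : ℤ → Ω → ℂ) (A Y : Ω → ℂ) : Prop :=
  Y ∈ observed α T N P ξ ∧
    ∀ η ∈ observed α T N P ξ, saNorm α P (A - Y) ≤ saNorm α P (A - η)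

/-- `A_N(e^{iθ}) = ∑_{j=0}^N a(j) e^{ijθ}`. -/
def polyA {T N : ℕ} (a : Fin (N + 1) → Fin T → ℂ) (θ : ℝ) : Fin T → ℂ :=
  ∑ j : Fin (N + 1), ex ((j : ℕ) : ℤ) θ • a j

/-- `C_N(e^{iθ}) = ∑_{j=0}^N c(j) e^{-ijθ}`. -/
def polyC {T N : ℕ} (c : Fin (N + 1) → Fin T → ℂ) (θ : ℝ) : Fin T → ℂ :=
  ∑ j : Fin (N + 1), ex (-((j : ℕ) : ℤ)) θ • c j

/-- `(f^{-1}(θ) C_N(e^{iθ}))^{<1/(α-1)>}`. -/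
def errChar {T N : ℕ} (α : ℝ) (f : ℝ → Matrix (Fin T) (Fin T) ℂ)
    (c : Fin (N + 1) → Fin T → ℂ) (θ : ℝ) : Fin T → ℂ :=
  vpow ((f θ)⁻¹ *ᵥ polyC c θ) (1 / (α - 1))

/-- The function `h = A_N(e^{iθ}) - (f^{-1}(θ) C_N(e^{iθ}))^{<1/(α-1)>}`. -/
def specChar {T N : ℕ} (α : ℝ) (f : ℝ → Matrix (Fin T) (Fin T) ℂ)
    (a c : Fin (N + 1) → Fin T → ℂ) (θ : ℝ) : Fin T → ℂ :=
  polyA a θ - errChar α f c θ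

/-- The system `∫ e^{-iθk} h(θ) dθ = 0`, `k = 0, …, N`, in the unknowns `c(0), …, c(N)`. -/
def SolvesSystem {T N : ℕ} (α : ℝ) (f : ℝ → Matrix (Fin T) (Fin T) ℂ)
    (a c : Fin (N + 1) → Fin T → ℂ) : Prop :=
  ∀ (k : Fin (N + 1)) (l : Fin T),
    IntegrableOn (fun θ => ex (-((k : ℕ) : ℤ)) θ * specChar α f a c θ l)
      (Set.Ioc (-Real.pi) Real.pi) ∧
    ∫ θ in Set.Ioc (-Real.pi) Real.pi, ex (-((k : ℕ) : ℤ)) θ * specChar α f a c θ l = 0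

/-- `L_N^α(f)`: the closed subspace of `L^α(f)` generated by the functions `e^{ijθ} δ_k`,
`j ∈ ℤ \ {0, …, N}`. -/
def MemLN {T : ℕ} (α : ℝ) (N : ℕ) (f : ℝ → Matrix (Fin T) (Fin T) ℂ)
    (h : ℝ → Fin T → ℂ) : Prop :=
  MemLalpha α f h ∧ ∀ ε : ℝ≥0∞, 0 < ε →
    ∃ p ∈ Submodule.span ℂ {q : ℝ → Fin T → ℂ | ∃ j : ℤ, ∃ k : Fin T,
        j ∉ Set.Ico 0 ((N : ℤ) + 1) ∧ q = fun θ => Pi.single k (ex j θ)},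
      lalpha α f (h - p) < ε

end StableInterp

end

/-!
Almost everywhere the density `f` gives an `ℓ^α` norm in suitable linear coordinates: for `α = 2`
because `f = Bᴴ B`, and for `α < 2` because `f` is diagonal. Indeed, if `F` is the spectral mass of
an interval, then `v ↦ Re (vᵀ F v^{<α-1>})` is the scale of a stable vector and hence convex, which
near the coordinate axes is incompatible with a nonzero off-diagonal entry of `F`.

The stochastic integral is therefore an isometry of the uniformly convex space `L^α(f)` into the
stable variables, and the optimal estimate is the integral of the best approximation of `A_N` by
functions whose frequencies avoid `{0, …, N}`. The error `e` of that approximation satisfies the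
first-order condition that the Fourier coefficients of `f e^{<α-1>}` vanish at these frequencies,
so `f e^{<α-1>}` is a trigonometric polynomial `C_N`. Two solutions of the system agree because
`v ↦ f v^{<α-1>}` is strictly monotone.
-/

noncomputable section

namespace StableInterp

section Convexity

variable {E : Type*} [NormedAddCommGroup E] {p : ℝ}

lemma norm_le_one_of_rpow_add_eq_one (hp : 0 < p) {x y : E} (h : ‖x‖ ^ p + ‖y‖ ^ p = 1) :
    ‖x‖ ≤ 1 := by
  rw [← Real.rpow_le_rpow_iff (norm_nonneg x) zero_le_one hp, Real.one_rpow]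
  linarith [Real.rpow_nonneg (norm_nonneg y) p]

variable [NormedSpace ℝ E]

/-- The defect of midpoint convexity of `‖·‖ ^ p`. -/
def convexityGap (p : ℝ) (x y : E) : ℝ :=
  (‖x‖ ^ p + ‖y‖ ^ p) / 2 - ‖(1 / 2 : ℝ) • (x + y)‖ ^ p

lemma continuous_convexityGap (hp : 0 ≤ p) :
    Continuous fun q : E × E => convexityGap p q.1 q.2 := by
  have hrpow (g : E × E → E) (hg : Continuous g) : Continuous fun q => ‖g q‖ ^ p :=
    hg.norm.rpow_const fun _ => Or.inr hp
  unfold convexityGap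
  exact (((hrpow _ continuous_fst).add (hrpow _ continuous_snd)).div_const 2).sub
    (hrpow _ ((continuous_fst.add continuous_snd).const_smul _))

lemma norm_smul_rpow {r : ℝ} (hr : 0 ≤ r) (x : E) : ‖r • x‖ ^ p = r ^ p * ‖x‖ ^ p := by
  rw [norm_smul, Real.norm_of_nonneg hr, Real.mul_rpow hr (norm_nonneg x)]

lemma convexityGap_smul {r : ℝ} (hr : 0 ≤ r) (x y : E) :
    convexityGap p (r • x) (r • y) = r ^ p * convexityGap p x y := by
  rw [convexityGap, ← smul_add, smul_comm, norm_smul_rpow hr, norm_smul_rpow hr, norm_smul_rpow hr,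
    convexityGap]
  ring

variable [StrictConvexSpace ℝ E]

lemma strictConvexOn_norm_rpow (hp : 1 < p) :
    StrictConvexOn ℝ Set.univ fun x : E => ‖x‖ ^ p := by
  refine ⟨convex_univ, fun x _ y _ hxy s t hs ht hst => ?_⟩
  have hp0 : 0 < p := one_pos.trans hp
  simp only [smul_eq_mul]
  rcases eq_or_ne ‖x‖ ‖y‖ with h | h
  · rw [← h, ← add_mul, hst, one_mul]
    exact Real.rpow_lt_rpow (norm_nonneg _)
      (norm_combo_lt_of_ne le_rfl h.ge hxy hs ht hst) hp0
  · have hle : ‖s • x + t • y‖ ≤ s * ‖x‖ + t * ‖y‖ := by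
      simpa only [norm_smul, Real.norm_of_nonneg hs.le, Real.norm_of_nonneg ht.le]
        using norm_add_le (s • x) (t • y)
    exact (Real.rpow_le_rpow (norm_nonneg _) hle hp0.le).trans_lt
      ((strictConvexOn_rpow hp).2 (norm_nonneg x) (norm_nonneg y) h hs ht hst)

lemma convexityGap_pos (hp : 1 < p) {x y : E} (hxy : x ≠ y) : 0 < convexityGap p x y := by
  have h := (strictConvexOn_norm_rpow hp).2 (Set.mem_univ x) (Set.mem_univ y) hxy
    one_half_pos one_half_pos (add_halves 1)
  simp only [smul_eq_mul, ← smul_add] at h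
  rw [convexityGap]
  linarith

lemma convexityGap_nonneg (hp : 1 < p) (x y : E) : 0 ≤ convexityGap p x y := by
  rcases eq_or_ne x y with rfl | hxy
  · rw [convexityGap, ← two_smul ℝ x, smul_smul, one_div, inv_mul_cancel₀ two_ne_zero, one_smul,
      add_self_div_two, sub_self]
  · exact (convexityGap_pos hp hxy).le

variable [ProperSpace E]

-- On the compact set of normalized pairs at distance at least `δ` the gap is positive, so the
-- quotient of the two sides is bounded there.
lemma exists_norm_sub_rpow_le_of_normalized (hp : 1 < p) {δ : ℝ} (hδ : 0 < δ) :
    ∃ K : ℝ, 0 ≤ K ∧ ∀ x y : E, ‖x‖ ^ p + ‖y‖ ^ p = 1 →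
      ‖x - y‖ ^ p ≤ K * convexityGap p x y + δ := by
  have hp0 : 0 < p := one_pos.trans hp
  have hrpow (g : E × E → E) (hg : Continuous g) : Continuous fun q => ‖g q‖ ^ p :=
    hg.norm.rpow_const fun _ => Or.inr hp0.le
  have hdist : Continuous fun q : E × E => ‖q.1 - q.2‖ ^ p :=
    hrpow _ (continuous_fst.sub continuous_snd)
  set S : Set (E × E) := {q | ‖q.1‖ ^ p + ‖q.2‖ ^ p = 1 ∧ δ ≤ ‖q.1 - q.2‖ ^ p}
  have hS : IsCompact S := by
    refine Metric.isCompact_of_isClosed_isBounded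
      ((isClosed_eq ((hrpow _ continuous_fst).add (hrpow _ continuous_snd)) continuous_const).inter
        (isClosed_le continuous_const hdist))
      ((Metric.isBounded_closedBall (x := (0 : E × E)) (r := 1)).subset fun q hq => ?_)
    rw [mem_closedBall_zero_iff, Prod.norm_def, max_le_iff]
    exact ⟨norm_le_one_of_rpow_add_eq_one hp0 hq.1,
      norm_le_one_of_rpow_add_eq_one hp0 ((add_comm _ _).trans hq.1)⟩
  have hgap (q : E × E) (hq : q ∈ S) : 0 < convexityGap p q.1 q.2 := by
    refine convexityGap_pos hp fun h => ?_
    have hle := hq.2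
    rw [h, sub_self, norm_zero, Real.zero_rpow hp0.ne'] at hle
    exact hδ.not_ge hle
  obtain ⟨K, hK⟩ := hS.exists_bound_of_continuousOn
    (hdist.continuousOn.div (continuous_convexityGap hp0.le).continuousOn
      fun q hq => (hgap q hq).ne')
  refine ⟨max K 0, le_max_right _ _, fun x y hxy => ?_⟩
  have hg := mul_nonneg (le_max_right K 0) (convexityGap_nonneg hp x y)
  rcases le_total (‖x - y‖ ^ p) δ with h | h
  · linarith
  · have hquot : ‖x - y‖ ^ p / convexityGap p x y ≤ max K 0 :=
      ((Real.le_norm_self _).trans (hK (x, y) ⟨hxy, h⟩)).trans (le_max_left K 0)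
    rw [div_le_iff₀ (hgap (x, y) ⟨hxy, h⟩)] at hquot
    linarith

lemma exists_norm_sub_rpow_le (hp : 1 < p) {δ : ℝ} (hδ : 0 < δ) :
    ∃ K : ℝ, 0 ≤ K ∧ ∀ x y : E,
      ‖x - y‖ ^ p ≤ K * convexityGap p x y + δ * (‖x‖ ^ p + ‖y‖ ^ p) := by
  have hp0 : 0 < p := one_pos.trans hp
  obtain ⟨K, hK, h⟩ := exists_norm_sub_rpow_le_of_normalized (E := E) hp hδ
  refine ⟨K, hK, fun x y => ?_⟩
  set r := ‖x‖ ^ p + ‖y‖ ^ p with hr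
  have hr0 : 0 ≤ r := by positivity
  rcases hr0.eq_or_lt with h0 | hpos
  · obtain ⟨hx, hy⟩ := (add_eq_zero_iff_of_nonneg (by positivity) (by positivity)).mp
      (hr.symm.trans h0.symm)
    rw [Real.rpow_eq_zero (norm_nonneg _) hp0.ne', norm_eq_zero] at hx hy
    simp [convexityGap, hx, hy, hp0.ne', ← h0]
  · set s := r ^ (-1 / p)
    have hs0 : 0 ≤ s := by positivity
    have hs : s ^ p = r⁻¹ := by
      rw [← Real.rpow_mul hr0, div_mul_cancel₀ _ hp0.ne', Real.rpow_neg_one]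
    have hscaled := h (s • x) (s • y) (by
      rw [norm_smul_rpow hs0, norm_smul_rpow hs0, ← mul_add, ← hr, hs, inv_mul_cancel₀ hpos.ne'])
    rw [← smul_sub, norm_smul_rpow hs0, convexityGap_smul hs0, hs] at hscaled
    have := mul_le_mul_of_nonneg_left hscaled hr0
    field_simp at this
    linarith

end Convexity

section SignedPower

lemma norm_spow {β : ℝ} (hβ : 0 < β) (z : ℂ) : ‖spow z β‖ = ‖z‖ ^ β := by
  rw [spow, norm_mul, RCLike.norm_conj, Complex.norm_real, Real.norm_of_nonneg (by positivity),
    ← Real.rpow_add_one' (norm_nonneg z) (by linarith), sub_add_cancel]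

lemma spow_zero {β : ℝ} : spow 0 β = 0 := by simp [spow]

lemma mul_spow_self {α : ℝ} (hα : 1 < α) (z : ℂ) :
    z * spow z (α - 1) = ((‖z‖ ^ α : ℝ) : ℂ) := by
  rw [spow, mul_left_comm, Complex.mul_conj, Complex.normSq_eq_norm_sq, ← Complex.ofReal_mul,
    ← Real.rpow_natCast, ← Real.rpow_add' (norm_nonneg z) (by push_cast; linarith)]
  congr 2
  push_cast
  ring

lemma spow_spow {β γ : ℝ} (hβ : 0 < β) (h : β * γ = 1) (z : ℂ) : spow (spow z β) γ = z := by
  rcases eq_or_ne z 0 with rfl | hz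
  · simp [spow_zero]
  · have hz' : 0 < ‖z‖ := norm_pos_iff.mpr hz
    rw [spow, norm_spow hβ, spow, map_mul, Complex.conj_ofReal, Complex.conj_conj, ← mul_assoc,
      ← Complex.ofReal_mul, ← Real.rpow_mul hz'.le, ← Real.rpow_add hz',
      show β * (γ - 1) + (β - 1) = 0 by linarith, Real.rpow_zero, Complex.ofReal_one, one_mul]

lemma spow_real_mul {β r : ℝ} (hβ : 0 < β) (hr : 0 ≤ r) (z : ℂ) :
    spow (r * z) β = ((r ^ β : ℝ) : ℂ) * spow z β := by
  rw [spow, norm_mul, Complex.norm_real, Real.norm_of_nonneg hr, Real.mul_rpow hr (norm_nonneg z),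
    map_mul, Complex.conj_ofReal, spow, ← sub_add_cancel β 1,
    Real.rpow_add_one' hr (by linarith), add_sub_cancel_right]
  push_cast
  ring

lemma continuous_spow {β : ℝ} (hβ : 0 < β) : Continuous (fun z => spow z β) := by
  refine continuous_iff_continuousAt.mpr fun z => ?_
  rcases eq_or_ne z 0 with rfl | hz
  · have hpow : Continuous fun z : ℂ => ‖z‖ ^ β := continuous_norm.rpow_const fun _ => Or.inr hβ.le
    rw [ContinuousAt, spow_zero, tendsto_zero_iff_norm_tendsto_zero]
    simp_rw [norm_spow hβ]
    simpa [Real.zero_rpow hβ.ne'] using hpow.tendsto 0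
  · exact (Complex.continuous_ofReal.continuousAt.comp
      (continuous_norm.continuousAt.rpow_const (Or.inl (norm_ne_zero_iff.mpr hz)))).mul
      Complex.continuous_conj.continuousAt

lemma continuous_vpow {ι : Type*} {β : ℝ} (hβ : 0 < β) :
    Continuous (fun v : ι → ℂ => vpow v β) :=
  continuous_pi fun k => (continuous_spow hβ).comp (continuous_apply k)

lemma vpow_vpow {ι : Type*} {β γ : ℝ} (hβ : 0 < β) (h : β * γ = 1) (v : ι → ℂ) :
    vpow (vpow v β) γ = v := funext fun _ => spow_spow hβ h _

variable {α : ℝ}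

lemma norm_mul_spow_le (hα : 1 < α) (u v : ℂ) :
    α * ‖u * spow v (α - 1)‖ ≤ ‖u‖ ^ α + (α - 1) * ‖v‖ ^ α := by
  have hα' : α - 1 ≠ 0 := by linarith
  have young := Real.young_inequality_of_nonneg (norm_nonneg u)
    (Real.rpow_nonneg (norm_nonneg v) (α - 1)) (Real.HolderConjugate.conjExponent hα)
  rw [Real.conjExponent, ← Real.rpow_mul (norm_nonneg v), mul_div_cancel₀ _ hα'] at young
  rw [norm_mul, norm_spow (by linarith)]
  calc α * (‖u‖ * ‖v‖ ^ (α - 1))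
    _ ≤ α * (‖u‖ ^ α / α + ‖v‖ ^ α / (α / (α - 1))) :=
      mul_le_mul_of_nonneg_left young (by linarith)
    _ = ‖u‖ ^ α + (α - 1) * ‖v‖ ^ α := by field_simp

lemma mul_re_mul_spow_le (hα : 1 < α) (u v : ℂ) :
    α * (u * spow v (α - 1)).re ≤ ‖u‖ ^ α + (α - 1) * ‖v‖ ^ α :=
  (mul_le_mul_of_nonneg_left (Complex.re_le_norm _) (by linarith)).trans (norm_mul_spow_le hα u v)

-- At the midpoint of `u` and `v` the equality would violate strict convexity of `|·|^α`.
lemma eq_of_mul_re_mul_spow_eq (hα : 1 < α) {u v : ℂ}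
    (h : α * (u * spow v (α - 1)).re = ‖u‖ ^ α + (α - 1) * ‖v‖ ^ α) : u = v := by
  by_contra huv
  have hgap := convexityGap_pos hα huv
  have hmid := mul_re_mul_spow_le hα ((1 / 2 : ℝ) • (u + v)) v
  rw [Complex.real_smul, mul_assoc, Complex.re_ofReal_mul, add_mul, mul_spow_self hα,
    Complex.add_re, Complex.ofReal_re, ← Complex.real_smul] at hmid
  rw [convexityGap] at hgap
  linarith

end SignedPower

section AlphaForm

variable {ι κ : Type*} [Fintype ι] [Fintype κ] {α : ℝ} {F : Matrix ι ι ℂ}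

/-- The covariation form `(u, v) ↦ uᵀ F v^{<α-1>}` of a matrix `F`. -/
def form (α : ℝ) (F : Matrix ι ι ℂ) (u v : ι → ℂ) : ℂ :=
  u ⬝ᵥ (F *ᵥ vpow v (α - 1))

/-- The `α`-th power `Re (vᵀ F v^{<α-1>})` of the norm that `F` induces on vectors. -/
def modular (α : ℝ) (F : Matrix ι ι ℂ) (v : ι → ℂ) : ℝ := (form α F v v).re

/-- In the coordinates `W v` the covariation form of `F` is that of the identity matrix. -/
def IsAlphaFactor (α : ℝ) (F : Matrix ι ι ℂ) (W : Matrix κ ι ℂ) : Prop :=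
  ∀ v, F *ᵥ vpow v (α - 1) = Wᵀ *ᵥ vpow (W *ᵥ v) (α - 1)

lemma form_add_left (F : Matrix ι ι ℂ) (u v w : ι → ℂ) :
    form α F (u + v) w = form α F u w + form α F v w := by simp only [form, add_dotProduct]

lemma form_smul_left (F : Matrix ι ι ℂ) (c : ℂ) (u w : ι → ℂ) :
    form α F (c • u) w = c * form α F u w := by rw [form, smul_dotProduct, smul_eq_mul, form]

lemma re_form_sub_sub (F : Matrix ι ι ℂ) (u v : ι → ℂ) :
    (form α F (u - v) u - form α F (u - v) v).re
      = modular α F u + modular α F v - ((form α F v u).re + (form α F u v).re) := by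
  have hu := congrArg Complex.re (form_add_left (α := α) F (u - v) v u)
  have hv := congrArg Complex.re (form_add_left (α := α) F (u - v) v v)
  rw [sub_add_cancel, Complex.add_re] at hu hv
  rw [Complex.sub_re, modular, modular]
  linear_combination hv - hu

lemma continuous_form (hα : 1 < α) (F : Matrix ι ι ℂ) (u : ι → ℂ) :
    Continuous fun v => form α F u v :=
  continuous_const.dotProduct
    (continuous_const.matrix_mulVec (continuous_vpow (by linarith)))

lemma continuous_modular (hα : 1 < α) (F : Matrix ι ι ℂ) : Continuous (modular α F) :=
  Complex.continuous_re.comp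
    (continuous_id.dotProduct (continuous_const.matrix_mulVec (continuous_vpow (by linarith))))

lemma modular_eq_of_subsingleton [Subsingleton ι] (hα : 1 < α) (F : Matrix ι ι ℂ) (v : ι → ℂ)
    (k : ι) : modular α F v = ‖v k‖ ^ α * (F k k).re := by
  rw [modular, form, dotProduct, Fintype.sum_subsingleton _ k, Matrix.mulVec, dotProduct,
    Fintype.sum_subsingleton _ k, vpow, mul_left_comm, mul_spow_self hα, mul_comm,
    Complex.re_ofReal_mul]

namespace IsAlphaFactor

variable {W : Matrix κ ι ℂ}

lemma form_eq_sum (hW : IsAlphaFactor α F W) (u v : ι → ℂ) :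
    form α F u v = ∑ k, (W *ᵥ u) k * spow ((W *ᵥ v) k) (α - 1) := by
  rw [form, hW, Matrix.dotProduct_mulVec, Matrix.vecMul_transpose]
  rfl

lemma form_self_eq_sum (hW : IsAlphaFactor α F W) (hα : 1 < α) (v : ι → ℂ) :
    form α F v v = ((∑ k, ‖(W *ᵥ v) k‖ ^ α : ℝ) : ℂ) := by
  rw [hW.form_eq_sum, Complex.ofReal_sum]
  exact Finset.sum_congr rfl fun k _ => mul_spow_self hα _

lemma modular_eq_sum (hW : IsAlphaFactor α F W) (hα : 1 < α) (v : ι → ℂ) :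
    modular α F v = ∑ k, ‖(W *ᵥ v) k‖ ^ α := by
  rw [modular, hW.form_self_eq_sum hα, Complex.ofReal_re]

lemma norm_apply_le [DecidableEq ι] (hW : IsAlphaFactor α F W) (hα : 1 < α) {V : Matrix ι κ ℂ}
    (hVW : V * W = 1) (v : ι → ℂ) (l : ι) :
    ‖v l‖ ≤ (∑ k, ‖V l k‖ ^ (α / (α - 1))) + modular α F v := by
  have hpq : (α / (α - 1)).HolderConjugate α := (Real.HolderConjugate.conjExponent hα).symm
  have hv : v l = ∑ k, V l k * (W *ᵥ v) k := by
    conv_lhs => rw [← Matrix.one_mulVec v, ← hVW, ← Matrix.mulVec_mulVec]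
    rfl
  rw [hv, hW.modular_eq_sum hα, ← Finset.sum_add_distrib]
  refine norm_sum_le_of_le _ fun k _ => ?_
  rw [norm_mul]
  exact (Real.young_inequality_of_nonneg (norm_nonneg _) (norm_nonneg _) hpq).trans
    (add_le_add (div_le_self (by positivity) hpq.lt.le) (div_le_self (by positivity) hα.le))

end IsAlphaFactor

variable [DecidableEq ι]

/-- The real number `Tr F^{-1/(α-1)}`. -/
def traceInv (α : ℝ) (F : Matrix ι ι ℂ) : ℝ :=
  (cfc (fun x : ℝ => x ^ (-1 / (α - 1))) F).trace.re

/-- The covariation form of `F` is that of the identity in coordinates `W v` whose inverse `V` is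
controlled by `Tr F^{-1/(α-1)}`. -/
def IsAlphaForm (α : ℝ) (F : Matrix ι ι ℂ) : Prop :=
  ∃ W V : Matrix ι ι ℂ, V * W = 1 ∧ IsAlphaFactor α F W ∧
    ∑ l, ∑ k, ‖V l k‖ ^ (α / (α - 1)) ≤ traceInv α F

namespace IsAlphaForm

lemma form_self (hF : IsAlphaForm α F) (hα : 1 < α) (v : ι → ℂ) :
    form α F v v = (modular α F v : ℂ) := by
  obtain ⟨W, V, -, hW, -⟩ := hF
  rw [hW.form_self_eq_sum hα, hW.modular_eq_sum hα]

lemma modular_nonneg (hF : IsAlphaForm α F) (hα : 1 < α) (v : ι → ℂ) : 0 ≤ modular α F v := by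
  obtain ⟨W, V, -, hW, -⟩ := hF
  rw [hW.modular_eq_sum hα]
  positivity

lemma traceInv_nonneg (hF : IsAlphaForm α F) : 0 ≤ traceInv α F := by
  obtain ⟨W, V, -, -, htr⟩ := hF
  exact le_trans (by positivity) htr

lemma modular_smul (hF : IsAlphaForm α F) (hα : 1 < α) (c : ℂ) (v : ι → ℂ) :
    modular α F (c • v) = ‖c‖ ^ α * modular α F v := by
  obtain ⟨W, V, -, hW, -⟩ := hF
  rw [hW.modular_eq_sum hα, hW.modular_eq_sum hα, Finset.mul_sum]
  refine Finset.sum_congr rfl fun k _ => ?_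
  rw [Matrix.mulVec_smul, Pi.smul_apply, smul_eq_mul, norm_mul,
    Real.mul_rpow (norm_nonneg _) (norm_nonneg _)]

lemma modular_add_rpow_le (hF : IsAlphaForm α F) (hα : 1 < α) (u v : ι → ℂ) :
    modular α F (u + v) ^ (1 / α) ≤ modular α F u ^ (1 / α) + modular α F v ^ (1 / α) := by
  obtain ⟨W, V, -, hW, -⟩ := hF
  rw [hW.modular_eq_sum hα, hW.modular_eq_sum hα, hW.modular_eq_sum hα, Matrix.mulVec_add]
  calc (∑ k, ‖(W *ᵥ u + W *ᵥ v) k‖ ^ α) ^ (1 / α)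
    _ ≤ (∑ k, (‖(W *ᵥ u) k‖ + ‖(W *ᵥ v) k‖) ^ α) ^ (1 / α) := by
      gcongr
      exact norm_add_le _ _
    _ ≤ (∑ k, ‖(W *ᵥ u) k‖ ^ α) ^ (1 / α) + (∑ k, ‖(W *ᵥ v) k‖ ^ α) ^ (1 / α) :=
      Real.Lp_add_le_of_nonneg _ hα.le (fun _ _ => norm_nonneg _) fun _ _ => norm_nonneg _

lemma mul_norm_form_le (hF : IsAlphaForm α F) (hα : 1 < α) (u v : ι → ℂ) :
    α * ‖form α F u v‖ ≤ modular α F u + (α - 1) * modular α F v := by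
  obtain ⟨W, V, -, hW, -⟩ := hF
  rw [hW.modular_eq_sum hα, hW.modular_eq_sum hα, hW.form_eq_sum, Finset.mul_sum,
    ← Finset.sum_add_distrib]
  refine (mul_le_mul_of_nonneg_left (norm_sum_le _ _) (by linarith)).trans ?_
  rw [Finset.mul_sum]
  exact Finset.sum_le_sum fun k _ => norm_mul_spow_le hα _ _

lemma norm_form_le (hF : IsAlphaForm α F) (hα : 1 < α) (u v : ι → ℂ) :
    ‖form α F u v‖ ≤ modular α F u + modular α F v := by
  nlinarith [hF.mul_norm_form_le hα u v, hF.modular_nonneg hα u, hF.modular_nonneg hα v]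

lemma mul_re_form_le (hF : IsAlphaForm α F) (hα : 1 < α) (u v : ι → ℂ) :
    α * (form α F u v).re ≤ modular α F u + (α - 1) * modular α F v :=
  (mul_le_mul_of_nonneg_left (Complex.re_le_norm _) (by linarith)).trans
    (hF.mul_norm_form_le hα u v)

lemma eq_of_mul_re_form_eq (hF : IsAlphaForm α F) (hα : 1 < α) {u v : ι → ℂ}
    (huv : α * (form α F u v).re = modular α F u + (α - 1) * modular α F v) : u = v := by
  obtain ⟨W, V, hVW, hW, -⟩ := hF
  rw [hW.modular_eq_sum hα, hW.modular_eq_sum hα, hW.form_eq_sum, Complex.re_sum, Finset.mul_sum,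
    Finset.mul_sum, ← Finset.sum_add_distrib, Finset.sum_eq_sum_iff_of_le
      fun k _ => mul_re_mul_spow_le hα ((W *ᵥ u) k) ((W *ᵥ v) k)] at huv
  have hWuv : W *ᵥ u = W *ᵥ v := funext fun k => eq_of_mul_re_mul_spow_eq hα (huv k (by simp))
  simpa only [Matrix.mulVec_mulVec, hVW, Matrix.one_mulVec] using congrArg (V *ᵥ ·) hWuv

lemma norm_apply_le (hF : IsAlphaForm α F) (hα : 1 < α) (v : ι → ℂ) (l : ι) :
    ‖v l‖ ≤ traceInv α F + modular α F v := by
  obtain ⟨W, V, hVW, hW, htr⟩ := hF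
  have hrow : ∑ k, ‖V l k‖ ^ (α / (α - 1)) ≤ ∑ l, ∑ k, ‖V l k‖ ^ (α / (α - 1)) :=
    Finset.single_le_sum (f := fun l => ∑ k, ‖V l k‖ ^ (α / (α - 1)))
      (fun l _ => by positivity) (Finset.mem_univ l)
  linarith [hW.norm_apply_le hα hVW v l]

lemma norm_apply_le_of_pos (hF : IsAlphaForm α F) (hα : 1 < α) {ε : ℝ} (hε : 0 < ε) (v : ι → ℂ)
    (l : ι) : ‖v l‖ ≤ ε * traceInv α F + ε ^ (1 - α) * modular α F v := by
  have h := mul_le_mul_of_nonneg_left (hF.norm_apply_le hα (((ε⁻¹ : ℝ) : ℂ) • v) l) hε.le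
  rwa [hF.modular_smul hα, Pi.smul_apply, norm_smul, Complex.norm_real,
    Real.norm_of_nonneg (by positivity), mul_inv_cancel_left₀ hε.ne', mul_add, ← mul_assoc ε,
    Real.inv_rpow hε.le, ← div_eq_mul_inv ε, ← Real.rpow_one_sub' hε.le (by linarith)] at h

end IsAlphaForm

lemma exists_modular_sub_le (hα : 1 < α) {δ : ℝ} (hδ : 0 < δ) :
    ∃ K : ℝ, 0 ≤ K ∧ ∀ F : Matrix ι ι ℂ, IsAlphaForm α F → ∀ u v : ι → ℂ,
      modular α F (u - v) + K * modular α F ((1 / 2 : ℂ) • (u + v)) ≤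
        (K / 2 + δ) * (modular α F u + modular α F v) := by
  obtain ⟨K, hK, h⟩ := exists_norm_sub_rpow_le (E := ℂ) hα hδ
  refine ⟨K, hK, fun F hF u v => ?_⟩
  obtain ⟨W, V, -, hW, -⟩ := hF
  simp only [hW.modular_eq_sum hα, Finset.mul_sum, ← Finset.sum_add_distrib]
  refine Finset.sum_le_sum fun k _ => ?_
  have hk := h ((W *ᵥ u) k) ((W *ᵥ v) k)
  rw [convexityGap, Complex.real_smul, Complex.ofReal_div, Complex.ofReal_one,
    Complex.ofReal_ofNat] at hk
  rw [Matrix.mulVec_sub, Matrix.mulVec_smul, Matrix.mulVec_add, Pi.sub_apply, Pi.smul_apply,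
    Pi.add_apply, smul_eq_mul]
  linarith

end AlphaForm

section PosDef

lemma vpow_one {ι : Type*} (v : ι → ℂ) : vpow v 1 = star v := by
  ext k
  simp [vpow, spow]

variable {ι : Type*}

lemma exists_eq_diagonal_of_posDef [DecidableEq ι] {F : Matrix ι ι ℂ} (hF : F.PosDef)
    (hdiag : ∀ k l, k ≠ l → F k l = 0) :
    ∃ d : ι → ℝ, (∀ k, 0 < d k) ∧ F = Matrix.diagonal fun k => (d k : ℂ) := by
  have hpos (k : ι) := Complex.lt_def.mp (hF.diag_pos (i := k))
  refine ⟨fun k => (F k k).re, fun k => (hpos k).1, ?_⟩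
  ext k l
  rcases eq_or_ne k l with rfl | h
  · rw [Matrix.diagonal_apply_eq]
    exact Complex.ext rfl (hpos k).2.symm
  · rw [Matrix.diagonal_apply_ne _ h, hdiag k l h]

variable [Fintype ι]

lemma isAlphaFactor_two (B : Matrix ι ι ℂ) : IsAlphaFactor 2 (Bᴴ * B) (B.map star) := by
  intro v
  have hstar : star (B.map star *ᵥ v) = B *ᵥ star v := by
    ext i
    simp [Matrix.mulVec, dotProduct]
  rw [show (2 : ℝ) - 1 = 1 by norm_num, vpow_one, vpow_one, hstar, ← Matrix.mulVec_mulVec]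
  rfl

lemma re_trace_mul_conjTranspose (B : Matrix ι ι ℂ) :
    (B * Bᴴ).trace.re = ∑ l, ∑ k, ‖B l k‖ ^ 2 := by
  simp only [Matrix.trace, Matrix.diag_apply, Matrix.mul_apply, Matrix.conjTranspose_apply,
    Complex.re_sum, Complex.star_def, Complex.mul_conj, Complex.ofReal_re,
    Complex.normSq_eq_norm_sq]

variable [DecidableEq ι] {F : Matrix ι ι ℂ}

lemma trace_cfc_eq_sum_roots (hF : F.IsHermitian) (g : ℝ → ℝ) :
    (cfc g F).trace = (F.charpoly.roots.map fun z => (g z.re : ℂ)).sum := by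
  rw [hF.cfc_eq, Matrix.IsHermitian.cfc, Unitary.conjStarAlgAut_apply, Matrix.trace_mul_cycle,
    Unitary.coe_star_mul_self, one_mul, Matrix.trace_diagonal, hF.roots_charpoly_eq_eigenvalues,
    Multiset.map_map]
  rfl

lemma traceInv_two (hF : F.PosDef) : traceInv 2 F = F⁻¹.trace.re := by
  have hinv := cfc_inv_id (R := ℝ) hF.isUnit.unit hF.isHermitian.isSelfAdjoint
  rw [IsUnit.unit_spec, Matrix.coe_units_inv, IsUnit.unit_spec] at hinv
  have hpow : (fun x : ℝ => x ^ (-1 / ((2 : ℝ) - 1))) = fun x => x⁻¹ := by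
    norm_num [Real.rpow_neg_one]
  rw [traceInv, hpow, hinv]

lemma traceInv_diagonal (α : ℝ) (d : ι → ℝ) :
    traceInv α (Matrix.diagonal fun k => (d k : ℂ)) = ∑ k, d k ^ (-1 / (α - 1)) := by
  have hH : (Matrix.diagonal fun k => (d k : ℂ)).IsHermitian :=
    Matrix.isHermitian_diagonal_of_self_adjoint _ (funext fun k => Complex.conj_ofReal (d k))
  have hroots : (Matrix.diagonal fun k => (d k : ℂ)).charpoly.roots
      = Finset.univ.val.map fun k => (d k : ℂ) := by
    rw [Matrix.charpoly_diagonal, Finset.prod_eq_multiset_prod,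
      ← Polynomial.roots_multiset_prod_X_sub_C (Finset.univ.val.map fun k => (d k : ℂ)),
      Multiset.map_map]
    rfl
  rw [traceInv, trace_cfc_eq_sum_roots hH, hroots, Multiset.map_map, ← Complex.coe_reAddGroupHom,
    map_multiset_sum, Multiset.map_map]
  rfl

lemma isAlphaForm_two (hF : F.PosDef) : IsAlphaForm 2 F := by
  obtain ⟨B, rfl⟩ : ∃ B : Matrix ι ι ℂ, F = Bᴴ * B := by
    open scoped MatrixOrder Matrix.Norms.L2Operator in
    exact CStarAlgebra.nonneg_iff_eq_star_mul_self.mp hF.posSemidef.nonneg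
  have hdet : IsUnit B.det := by
    have hunit := (Matrix.isUnit_iff_isUnit_det _).mp hF.isUnit
    rw [Matrix.det_mul] at hunit
    exact isUnit_of_mul_isUnit_right hunit
  refine ⟨B.map star, B⁻¹.map star, ?_, isAlphaFactor_two B, ?_⟩
  · have hconj := congrArg (fun M => M.map (starRingEnd ℂ)) (Matrix.nonsing_inv_mul B hdet)
    simp only [Matrix.map_mul] at hconj
    simpa using hconj
  · rw [traceInv_two hF, Matrix.mul_inv_rev, ← Matrix.conjTranspose_nonsing_inv,
      re_trace_mul_conjTranspose]
    norm_num

lemma isAlphaFactor_diagonal {α : ℝ} (hα : 1 < α) {d : ι → ℝ} (hd : ∀ k, 0 ≤ d k) :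
    IsAlphaFactor α (Matrix.diagonal fun k => (d k : ℂ))
      (Matrix.diagonal fun k => ((d k ^ (1 / α) : ℝ) : ℂ)) := by
  intro v
  ext k
  have hexp : 1 / α + 1 / α * (α - 1) = 1 := by
    field_simp
    ring
  rw [Matrix.diagonal_transpose, Matrix.mulVec_diagonal, Matrix.mulVec_diagonal, vpow, vpow,
    Matrix.mulVec_diagonal, spow_real_mul (by linarith) (Real.rpow_nonneg (hd k) _), ← mul_assoc,
    ← Complex.ofReal_mul, ← Real.rpow_mul (hd k),
    ← Real.rpow_add' (hd k) (by rw [hexp]; exact one_ne_zero), hexp,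
    Real.rpow_one]

lemma isAlphaForm_of_diagonal {α : ℝ} (hα : 1 < α) (hF : F.PosDef)
    (hdiag : ∀ k l, k ≠ l → F k l = 0) : IsAlphaForm α F := by
  obtain ⟨d, hd, rfl⟩ := exists_eq_diagonal_of_posDef hF hdiag
  refine ⟨_, Matrix.diagonal fun k => ((d k ^ (-(1 / α)) : ℝ) : ℂ), ?_,
    isAlphaFactor_diagonal hα fun k => (hd k).le, ?_⟩
  · rw [Matrix.diagonal_mul_diagonal, ← Matrix.diagonal_one]
    congr! 2 with k
    rw [← Complex.ofReal_mul, ← Real.rpow_add (hd k), neg_add_cancel, Real.rpow_zero,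
      Complex.ofReal_one]
  · rw [traceInv_diagonal]
    refine le_of_eq (Finset.sum_congr rfl fun l _ => ?_)
    have hα' : α - 1 ≠ 0 := by linarith
    rw [Finset.sum_eq_single_of_mem l (Finset.mem_univ l)]
    · rw [Matrix.diagonal_apply_eq, Complex.norm_real,
        Real.norm_of_nonneg (Real.rpow_nonneg (hd l).le _), ← Real.rpow_mul (hd l).le]
      congr 1
      field_simp
    · intro k _ hk
      rw [Matrix.diagonal_apply_ne _ hk.symm, norm_zero,
        Real.zero_rpow (div_pos (by linarith) (by linarith)).ne']

end PosDef

open scoped RealInnerProductSpace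

section SphereMeasure

variable {S E : Type*} [MeasurableSpace S] [NormedAddCommGroup E] [NormedSpace ℝ E]
  [MeasurableSpace E] {α : ℝ} {Γ : Measure S} {g : S → E}

/-- The image of `Γ` under the projection of `g` to the unit sphere, weighted by `‖g‖ ^ α` so that
the integrals of `α`-homogeneous functions are preserved. -/
def sphereMeasure (α : ℝ) (Γ : Measure S) (g : S → E) : Measure (Metric.sphere (0 : E) 1) :=
  ((Γ.withDensity fun s => ENNReal.ofReal (‖g s‖ ^ α)).map fun s => ‖g s‖⁻¹ • g s).comap
    Subtype.val

variable [BorelSpace E]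

lemma isFiniteMeasure_sphereMeasure (hint : Integrable (fun s => ‖g s‖ ^ α) Γ) :
    IsFiniteMeasure (sphereMeasure α Γ g) := by
  have := isFiniteMeasure_withDensity hint.lintegral_lt_top.ne
  refine ⟨?_⟩
  rw [sphereMeasure, comap_subtype_coe_apply Metric.isClosed_sphere.measurableSet]
  exact measure_lt_top _ _

variable [SecondCountableTopology E]

lemma ae_mem_sphere_of_weighted (hα : 0 < α) (hg : Measurable g) :
    ∀ᵐ x ∂(Γ.withDensity fun s => ENNReal.ofReal (‖g s‖ ^ α)).map fun s => ‖g s‖⁻¹ • g s,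
      x ∈ Metric.sphere (0 : E) 1 := by
  have hproj : Measurable fun s => ‖g s‖⁻¹ • g s := hg.norm.inv.smul hg
  have hsphere : MeasurableSet {x : E | x ∈ Metric.sphere (0 : E) 1} :=
    Metric.isClosed_sphere.measurableSet
  rw [ae_map_iff hproj.aemeasurable hsphere,
    ae_withDensity_iff (hg.norm.pow_const α).ennreal_ofReal]
  refine Eventually.of_forall fun s hs => ?_
  have hgs : ‖g s‖ ≠ 0 := by
    contrapose! hs
    rw [hs, Real.zero_rpow hα.ne', ENNReal.ofReal_zero]
  rw [mem_sphere_zero_iff_norm, norm_smul, norm_inv, norm_norm, inv_mul_cancel₀ hgs]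

lemma integral_sphereMeasure (hα : 0 < α) (hg : Measurable g) {F : E → ℝ} (hF : Measurable F)
    (hhom : ∀ (r : ℝ) x, 0 ≤ r → F (r • x) = r ^ α * F x) :
    ∫ x : Metric.sphere (0 : E) 1, F x ∂sphereMeasure α Γ g = ∫ s, F (g s) ∂Γ := by
  have hproj : Measurable fun s => ‖g s‖⁻¹ • g s := hg.norm.inv.smul hg
  have hw : Measurable fun s => (‖g s‖ ^ α).toNNReal := (hg.norm.pow_const α).real_toNNReal
  rw [sphereMeasure, integral_subtype_comap Metric.isClosed_sphere.measurableSet F,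
    Measure.restrict_eq_self_of_ae_mem (ae_mem_sphere_of_weighted hα hg),
    integral_map hproj.aemeasurable hF.aestronglyMeasurable]
  refine (integral_withDensity_eq_integral_smul hw _).trans (integral_congr_ae ?_)
  refine Eventually.of_forall fun s => ?_
  simp only [hhom _ _ (inv_nonneg.mpr (norm_nonneg (g s))), NNReal.smul_def, smul_eq_mul]
  rw [Real.coe_toNNReal _ (by positivity)]
  rcases eq_or_ne (g s) 0 with hs | hs
  · have hF0 := hhom 0 0 le_rfl
    rw [Real.zero_rpow hα.ne', smul_zero, zero_mul] at hF0
    rw [hs, hF0, mul_zero, mul_zero]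
  · have hpos : 0 < ‖g s‖ := norm_pos_iff.mpr hs
    rw [← mul_assoc, ← Real.mul_rpow hpos.le (by positivity), mul_inv_cancel₀ hpos.ne',
      Real.one_rpow, one_mul]

end SphereMeasure

section AbsInner

variable {E : Type*} [NormedAddCommGroup E] [InnerProductSpace ℝ E] {α : ℝ}

lemma continuous_abs_inner_rpow (hα : 0 < α) : Continuous fun p : E × E => |⟪p.1, p.2⟫| ^ α :=
  (continuous_inner (𝕜 := ℝ)).abs.rpow_const fun _ => Or.inr hα.le

lemma abs_inner_rpow_le (hα : 0 < α) (x : Metric.sphere (0 : E) 1) (t : E) :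
    |⟪(x : E), t⟫| ^ α ≤ ‖t‖ ^ α := by
  refine Real.rpow_le_rpow (abs_nonneg _) ((abs_real_inner_le_norm _ _).trans_eq ?_) hα.le
  rw [norm_eq_of_mem_sphere, one_mul]

lemma abs_inner_smul_rpow (t : E) {r : ℝ} (hr : 0 ≤ r) (x : E) :
    |⟪r • x, t⟫| ^ α = r ^ α * |⟪x, t⟫| ^ α := by
  rw [real_inner_smul_left, abs_mul, abs_of_nonneg hr, Real.mul_rpow hr (abs_nonneg _)]

lemma integrable_abs_inner_rpow [MeasurableSpace E] [OpensMeasurableSpace E]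
    (hα : 0 < α) (Γ : Measure (Metric.sphere (0 : E) 1)) [IsFiniteMeasure Γ] (t : E) :
    Integrable (fun x : Metric.sphere (0 : E) 1 => |⟪(x : E), t⟫| ^ α) Γ := by
  have hc : Continuous fun x : Metric.sphere (0 : E) 1 => |⟪(x : E), t⟫| ^ α :=
    (continuous_abs_inner_rpow hα).comp (continuous_subtype_val.prodMk continuous_const)
  refine Integrable.of_bound (C := ‖t‖ ^ α) hc.aestronglyMeasurable
    (Eventually.of_forall fun x => ?_)
  rw [Real.norm_of_nonneg (by positivity)]
  exact abs_inner_rpow_le hα x t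

end AbsInner

section CosineTransform

variable {α : ℝ}

/-- The integral of `|cos| ^ α` over a period: the mass that the `α`-cosine transform of a unit
point mass on the circle carries. -/
def cosConst (α : ℝ) : ℝ := ∫ φ in (0 : ℝ)..(2 * Real.pi), |Real.cos φ| ^ α

lemma cosConst_pos (hα : 0 < α) : 0 < cosConst α := by
  have hc : Continuous fun φ => |Real.cos φ| ^ α :=
    Real.continuous_cos.abs.rpow_const fun _ => Or.inr hα.le
  refine intervalIntegral.integral_pos (by positivity) hc.continuousOn (fun x _ => by positivity)
    ⟨0, ⟨le_rfl, by positivity⟩, by simp⟩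

lemma inner_exp_exp (ψ φ : ℝ) :
    ⟪Complex.exp (ψ * Complex.I), Complex.exp (φ * Complex.I)⟫ = Real.cos (φ - ψ) := by
  rw [Complex.inner, ← Complex.exp_conj, ← Complex.exp_add, map_mul, Complex.conj_ofReal,
    Complex.conj_I, show (φ : ℂ) * Complex.I + ψ * -Complex.I = ((φ - ψ : ℝ) : ℂ) * Complex.I by
      push_cast; ring, Complex.exp_ofReal_mul_I_re]

lemma integral_abs_inner_circle (z : Metric.sphere (0 : ℂ) 1) :
    ∫ φ in (0 : ℝ)..(2 * Real.pi), |⟪(z : ℂ), Complex.exp (φ * Complex.I)⟫| ^ α = cosConst α := by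
  obtain ⟨ψ, hψ⟩ : ∃ ψ : ℝ, Complex.exp (ψ * Complex.I) = z := by
    refine ⟨(z : ℂ).arg, ?_⟩
    simpa only [norm_eq_of_mem_sphere z, Complex.ofReal_one, one_mul]
      using Complex.norm_mul_exp_arg_mul_I (z : ℂ)
  simp_rw [← hψ, inner_exp_exp]
  have hper : Function.Periodic (fun φ => |Real.cos φ| ^ α) (2 * Real.pi) := fun x => by
    simp only [Real.cos_add_two_pi]
  rw [intervalIntegral.integral_comp_sub_right (fun φ => |Real.cos φ| ^ α), cosConst,
    sub_eq_neg_add, sub_eq_neg_add, add_zero, hper.intervalIntegral_add_eq _ 0, zero_add]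

lemma integral_cosine_transform (hα : 0 < α) (Γ : Measure (Metric.sphere (0 : ℂ) 1))
    [IsFiniteMeasure Γ] :
    ∫ φ in (0 : ℝ)..(2 * Real.pi), (∫ z : Metric.sphere (0 : ℂ) 1,
      |⟪(z : ℂ), Complex.exp (φ * Complex.I)⟫| ^ α ∂Γ) = cosConst α * Γ.real Set.univ := by
  rw [intervalIntegral.integral_of_le (by positivity), integral_integral_swap]
  · simp_rw [← intervalIntegral.integral_of_le (by positivity : (0 : ℝ) ≤ 2 * Real.pi),
      integral_abs_inner_circle]
    rw [integral_const, smul_eq_mul, mul_comm]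
  · have hc : Continuous fun p : ℝ × Metric.sphere (0 : ℂ) 1 =>
        |⟪(p.2 : ℂ), Complex.exp (p.1 * Complex.I)⟫| ^ α :=
      (continuous_abs_inner_rpow hα).comp ((continuous_subtype_val.comp continuous_snd).prodMk
        (by fun_prop))
    refine Integrable.of_bound (C := 1) hc.aestronglyMeasurable (Eventually.of_forall fun p => ?_)
    rw [Function.uncurry, Real.norm_of_nonneg (by positivity)]
    refine (abs_inner_rpow_le hα p.2 _).trans_eq ?_
    rw [Complex.norm_exp_ofReal_mul_I, Real.one_rpow]

end CosineTransform

section HasScale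

variable {Ω : Type*} [MeasurableSpace Ω] {α : ℝ} {P : Measure Ω} {X Y : Ω → ℂ} {M M' : ℝ}

/-- `X` is complex symmetric `α`-stable and its spectral measure on the unit circle has total mass
`M`, which is `‖X‖_α ^ α`. The measure on the circle need not be symmetric: only the integrals of
even functions matter. -/
structure HasScale (α : ℝ) (P : Measure Ω) (X : Ω → ℂ) (M : ℝ) : Prop where
  aemeasurable : AEMeasurable X P
  exists_measure : ∃ Γ : Measure (Metric.sphere (0 : ℂ) 1), IsFiniteMeasure Γ ∧
    Γ.real Set.univ = M ∧
    ∀ t : ℂ, charFun (P.map X) t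
      = Complex.exp (-((∫ z : Metric.sphere (0 : ℂ) 1, |⟪(z : ℂ), t⟫| ^ α ∂Γ : ℝ) : ℂ))

namespace HasScale

lemma of_measure (hα : 0 < α) (hX : AEMeasurable X P) {S : Type*} [MeasurableSpace S]
    {Γ : Measure S} {g : S → ℂ} (hg : Measurable g) (hint : Integrable (fun s => ‖g s‖ ^ α) Γ)
    (h : ∀ t : ℂ, charFun (P.map X) t = Complex.exp (-((∫ s, |⟪g s, t⟫| ^ α ∂Γ : ℝ) : ℂ))) :
    HasScale α P X (∫ s, ‖g s‖ ^ α ∂Γ) := by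
  refine ⟨hX, sphereMeasure α Γ g, isFiniteMeasure_sphereMeasure hint, ?_, fun t => ?_⟩
  · rw [← integral_sphereMeasure hα hg (measurable_norm.pow_const α)
      fun r x hr => norm_smul_rpow hr x]
    simp only [norm_eq_of_mem_sphere, Real.one_rpow, integral_const, smul_eq_mul, mul_one]
  · rw [h, ← integral_sphereMeasure hα hg (F := fun x => |⟪x, t⟫| ^ α)
      ((continuous_abs_inner_rpow hα).comp (Continuous.prodMk_left t)).measurable
      fun r x hr => abs_inner_smul_rpow t hr x]

lemma nonneg (h : HasScale α P X M) : 0 ≤ M := by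
  obtain ⟨Γ, _, rfl, -⟩ := h.exists_measure
  exact measureReal_nonneg

lemma unique (h : HasScale α P X M) (hα : 0 < α) (h' : HasScale α P X M') : M = M' := by
  obtain ⟨Γ, _, rfl, hΓ⟩ := h.exists_measure
  obtain ⟨Γ', _, rfl, hΓ'⟩ := h'.exists_measure
  have htransform (t : ℂ) : ∫ z : Metric.sphere (0 : ℂ) 1, |⟪(z : ℂ), t⟫| ^ α ∂Γ
      = ∫ z : Metric.sphere (0 : ℂ) 1, |⟪(z : ℂ), t⟫| ^ α ∂Γ' := by
    have hexp := (hΓ t).symm.trans (hΓ' t)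
    rw [← Complex.ofReal_neg, ← Complex.ofReal_neg, ← Complex.ofReal_exp,
      ← Complex.ofReal_exp] at hexp
    exact neg_injective (Real.exp_injective (Complex.ofReal_injective hexp))
  refine mul_left_cancel₀ (cosConst_pos hα).ne' ?_
  simp_rw [← integral_cosine_transform hα, htransform]

lemma congr (h : HasScale α P X M) (hXY : X =ᵐ[P] Y) : HasScale α P Y M := by
  obtain ⟨Γ, hfin, hM, hΓ⟩ := h.exists_measure
  exact ⟨h.aemeasurable.congr hXY, Γ, hfin, hM, by rwa [← Measure.map_congr hXY]⟩

lemma sum {ι : Type*} [Fintype ι] (hα : 0 < α) {X : ι → Ω → ℂ} {M : ι → ℝ}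
    (h : ∀ i, HasScale α P (X i) (M i)) (hind : iIndepFun X P) :
    HasScale α P (fun ω => ∑ i, X i ω) (∑ i, M i) := by
  choose Γ hfin hM hΓ using fun i => (h i).exists_measure
  refine ⟨Finset.aemeasurable_fun_sum _ fun i _ => (h i).aemeasurable,
    ∑ i, Γ i, inferInstance, ?_, fun t => ?_⟩
  · rw [Measure.real, Measure.finsetSum_apply, ENNReal.toReal_sum (fun i _ => measure_ne_top _ _)]
    exact Finset.sum_congr rfl fun i _ => hM i
  · rw [hind.charFun_map_fun_sum_eq_prod fun i => (h i).aemeasurable, Finset.prod_apply,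
      integral_finsetSum_measure fun i _ => integrable_abs_inner_rpow hα (Γ i) t]
    simp_rw [hΓ, ← Complex.exp_sum, Complex.ofReal_sum, Finset.sum_neg_distrib]

end HasScale

end HasScale

section Symmetrization

variable {E : Type*} [MeasurableSpace E] [InvolutiveNeg E] [MeasurableNeg E] {μ : Measure E}

/-- The average of a measure and its reflection in the origin. -/
def symmetrization (μ : Measure E) : Measure E := (2⁻¹ : NNReal) • (μ + μ.map fun x => -x)

instance [IsFiniteMeasure μ] : IsFiniteMeasure (symmetrization μ) := by
  unfold symmetrization
  infer_instance

lemma map_neg_symmetrization : (symmetrization μ).map (fun x => -x) = symmetrization μ := by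
  have hneg : Measurable fun x : E => -x := measurable_neg
  have hid : (fun x : E => -x) ∘ (fun x => -x) = id := funext neg_neg
  rw [symmetrization, Measure.map_smul, Measure.map_add _ _ hneg, Measure.map_map hneg hneg, hid,
    Measure.map_id, add_comm]

lemma symmetrization_eq_zero {s : Set E} (hs : MeasurableSet s)
    (hneg : (fun x => -x) ⁻¹' s = s) (h0 : μ s = 0) : symmetrization μ s = 0 := by
  rw [symmetrization, Measure.smul_apply, Measure.add_apply, Measure.map_apply measurable_neg hs,
    hneg, h0, add_zero, smul_zero]

lemma integral_symmetrization {F : E → ℝ} (hF : Integrable F μ) (heven : ∀ x, F (-x) = F x) :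
    ∫ x, F x ∂symmetrization μ = ∫ x, F x ∂μ := by
  have hcomp : F ∘ MeasurableEquiv.neg E = F := funext heven
  have hmap : Integrable F (μ.map (MeasurableEquiv.neg E)) := by
    rwa [integrable_map_equiv, hcomp]
  have hint : ∫ x, F x ∂μ.map (MeasurableEquiv.neg E) = ∫ x, F x ∂μ := by
    rw [integral_map_equiv]
    exact integral_congr_ae (Eventually.of_forall heven)
  change ∫ x, F x ∂((2⁻¹ : NNReal) • (μ + μ.map (MeasurableEquiv.neg E))) = _
  rw [integral_smul_nnreal_measure, integral_add_measure hF hmap, hint, NNReal.smul_def,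
    smul_eq_mul, NNReal.coe_inv, NNReal.coe_ofNat]
  ring

end Symmetrization

section Covariation

variable {Ω : Type*} [MeasurableSpace Ω] {α : ℝ} {P : Measure Ω} {X : Ω → ℂ} {M : ℝ}
  {ι : Type*} [Fintype ι]

lemma charFun_map_eq_integral (hX : AEMeasurable X P) (t : ℂ) :
    charFun (P.map X) t = ∫ ω, Complex.exp (⟪X ω, t⟫ * Complex.I) ∂P := by
  rw [charFun_apply, integral_map hX]
  fun_prop

namespace IsSpectralMeasure

variable {X : ι → Ω → ℝ} {Γ : Measure (EuclideanSpace ℝ ι)}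

lemma integrable (hΓ : IsSpectralMeasure α P X Γ) {F : EuclideanSpace ℝ ι → ℝ}
    (hF : Continuous F) : Integrable F Γ := by
  have := hΓ.finite
  rw [← Measure.restrict_eq_self_of_ae_mem (mem_ae_iff.mpr hΓ.sphere)]
  exact hF.continuousOn.integrableOn_compact (isCompact_sphere _ _)

lemma hasScale (hα : 0 < α) (hX : ∀ k, AEMeasurable (X k) P) (hΓ : IsSpectralMeasure α P X Γ)
    (c : ι → ℂ) :
    HasScale α P (fun ω => ∑ k, (X k ω : ℂ) * c k) (∫ x, ‖∑ k, (x k : ℂ) * c k‖ ^ α ∂Γ) := by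
  have hY : AEMeasurable (fun ω => ∑ k, (X k ω : ℂ) * c k) P :=
    Finset.aemeasurable_fun_sum _ fun k _ =>
      (Complex.measurable_ofReal.comp_aemeasurable (hX k)).mul_const _
  have hinner (y : ι → ℝ) (t : ℂ) : ⟪∑ k, (y k : ℂ) * c k, t⟫ = ∑ k, ⟪c k, t⟫ * y k := by
    rw [sum_inner]
    refine Finset.sum_congr rfl fun k _ => ?_
    rw [← Complex.real_smul, real_inner_smul_left, mul_comm]
  have hg : Continuous fun x : EuclideanSpace ℝ ι => ∑ k, (x k : ℂ) * c k := by fun_prop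
  refine HasScale.of_measure hα hY hg.measurable
    (hΓ.integrable (hg.norm.rpow_const fun _ => Or.inr hα.le)) fun t => ?_
  rw [charFun_map_eq_integral hY]
  simp_rw [hinner]
  rw [← hΓ.charFun]
  simp_rw [mul_comm Complex.I]

lemma ae_sum_eq_zero [IsProbabilityMeasure P] (hα : 0 < α) (hΓ : IsSpectralMeasure α P X Γ)
    (t : ι → ℝ) (ht : ∀ ω, ∑ k, t k * X k ω = 0) : ∀ᵐ x ∂Γ, ∑ k, t k * x k = 0 := by
  have hexp := hΓ.charFun t
  simp only [ht, Complex.ofReal_zero, mul_zero, Complex.exp_zero, integral_const, probReal_univ,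
    one_smul, ← Complex.ofReal_neg, ← Complex.ofReal_exp] at hexp
  have hzero : ∫ x, |∑ k, t k * x k| ^ α ∂Γ = 0 := by
    rwa [← Complex.ofReal_one, Complex.ofReal_inj, eq_comm, Real.exp_eq_one_iff,
      neg_eq_zero] at hexp
  have hc : Continuous fun x : EuclideanSpace ℝ ι => |∑ k, t k * x k| ^ α :=
    Continuous.rpow_const (by fun_prop) fun _ => Or.inr hα.le
  rw [integral_eq_zero_iff_of_nonneg (fun x => by positivity) (hΓ.integrable hc)] at hzero
  filter_upwards [hzero] with x hx
  exact abs_eq_zero.mp ((Real.rpow_eq_zero (abs_nonneg _) hα.ne').mp hx)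

end IsSpectralMeasure

namespace HasScale

lemma exists_isSpectralMeasure (hα : 0 < α) (h : HasScale α P X M) (c : ι → ℂ) :
    ∃ Γ, IsSpectralMeasure α P (fun k ω => ⟪X ω, c k⟫) Γ := by
  obtain ⟨Γ, _, -, hΓ⟩ := h.exists_measure
  let g : Metric.sphere (0 : ℂ) 1 → EuclideanSpace ℝ ι := fun z =>
    WithLp.toLp 2 fun k => ⟪(z : ℂ), c k⟫
  have hg : Continuous g := (PiLp.continuous_toLp 2 _).comp
    (continuous_pi fun k => continuous_subtype_val.inner continuous_const)
  have hgα : Continuous fun z => ‖g z‖ ^ α := hg.norm.rpow_const fun _ => Or.inr hα.le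
  have := isFiniteMeasure_sphereMeasure
    (hgα.integrable_of_hasCompactSupport (HasCompactSupport.of_compactSpace _) (μ := Γ))
  refine ⟨symmetrization ((sphereMeasure α Γ g).map Subtype.val), inferInstance, ?_,
    map_neg_symmetrization, fun t => ?_⟩
  · refine symmetrization_eq_zero Metric.isClosed_sphere.measurableSet.compl ?_ ?_
    · ext x
      simp
    · rw [Measure.map_apply measurable_subtype_coe Metric.isClosed_sphere.measurableSet.compl]
      simp
  · have hF : Continuous fun x : EuclideanSpace ℝ ι => |∑ k, t k * x k| ^ α :=
      Continuous.rpow_const (by fun_prop) fun _ => Or.inr hα.le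
    have hhom (r : ℝ) (x : EuclideanSpace ℝ ι) (hr : 0 ≤ r) :
        |∑ k, t k * (r • x) k| ^ α = r ^ α * |∑ k, t k * x k| ^ α := by
      simp_rw [PiLp.smul_apply, smul_eq_mul, mul_left_comm _ r, ← Finset.mul_sum]
      rw [abs_mul, abs_of_nonneg hr, Real.mul_rpow hr (abs_nonneg _)]
    have hinner (z : ℂ) : ⟪z, ∑ k, t k • c k⟫ = ∑ k, t k * ⟪z, c k⟫ := by
      simp only [inner_sum, real_inner_smul_right]
    have hint : Integrable (fun x : EuclideanSpace ℝ ι => |∑ k, t k * x k| ^ α)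
        ((sphereMeasure α Γ g).map Subtype.val) := by
      rw [integrable_map_measure hF.aestronglyMeasurable measurable_subtype_coe.aemeasurable]
      exact (hF.comp continuous_subtype_val).integrable_of_hasCompactSupport
        (HasCompactSupport.of_compactSpace _)
    rw [integral_symmetrization hint fun x => by simp,
      integral_map measurable_subtype_coe.aemeasurable hF.aestronglyMeasurable,
      integral_sphereMeasure hα hg.measurable hF.measurable hhom]
    simp_rw [mul_comm Complex.I, g, ← hinner]
    rw [← hΓ, charFun_map_eq_integral h.aemeasurable]

lemma jointlySaS_inner (hα : 0 < α) (h : HasScale α P X M) (c : ι → ℂ) :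
    JointlySaS α P fun k ω => ⟪X ω, c k⟫ :=
  ⟨fun _ => h.aemeasurable.inner_const, h.exists_isSpectralMeasure hα c⟩

lemma isSaS (hα : 0 < α) (h : HasScale α P X M) : IsSaS α P X := by
  rw [IsSaS, CJointlySaS]
  convert h.jointlySaS_inner hα
    (Sum.elim (fun _ => 1) (fun _ => Complex.I) : Unit ⊕ Unit → ℂ) using 1
  ext (k | k) ω <;> simp [Complex.inner]

lemma jointlySaS_realQuad (hα : 0 < α) (h : HasScale α P X M) :
    JointlySaS α P (realQuad X X) := by
  convert h.jointlySaS_inner hα ![1, Complex.I, 1, Complex.I] using 1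
  ext k ω
  fin_cases k <;> simp [Complex.inner, realQuad]

lemma covariation_self (hα : 1 < α) [IsProbabilityMeasure P] (h : HasScale α P X M) :
    covariation α P X X = M := by
  have hα0 : 0 < α := by linarith
  have hJ := h.jointlySaS_realQuad hα0
  rw [covariation, dif_pos hJ]
  generalize_proofs hex
  have hΓ := Classical.choose_spec hex
  have hX : (fun ω => ∑ k, (realQuad X X k ω : ℂ) * ![1, Complex.I, 0, 0] k) = X := by
    ext ω
    simp [Fin.sum_univ_four, realQuad, Complex.re_add_im]
  have hM := hΓ.hasScale hα0 hJ.1 ![1, Complex.I, 0, 0]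
  rw [hX] at hM
  have hre := hΓ.ae_sum_eq_zero hα0 ![1, 0, -1, 0] fun ω => by simp [Fin.sum_univ_four, realQuad]
  have him := hΓ.ae_sum_eq_zero hα0 ![0, 1, 0, -1] fun ω => by simp [Fin.sum_univ_four, realQuad]
  rw [h.unique hα0 hM, ← integral_complex_ofReal]
  refine integral_congr_ae ?_
  filter_upwards [hre, him] with x hre hm
  simp only [Fin.sum_univ_four, Matrix.cons_val] at hre hm
  rw [show x 2 = x 0 by linarith, show x 3 = x 1 by linarith, mul_spow_self hα]
  congr 3
  simp [Fin.sum_univ_four, Complex.ext_iff]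

lemma saNorm_eq (hα : 1 < α) [IsProbabilityMeasure P] (h : HasScale α P X M) :
    saNorm α P X = M ^ (1 / α) := by
  rw [saNorm, h.covariation_self hα, Complex.ofReal_re]

lemma saNorm_rpow (hα : 1 < α) [IsProbabilityMeasure P] (h : HasScale α P X M) :
    saNorm α P X ^ α = M := by
  rw [h.saNorm_eq hα, ← Real.rpow_mul h.nonneg, one_div_mul_cancel (by linarith), Real.rpow_one]

end HasScale

lemma IsSaS.exists_hasScale (hα : 0 < α) (h : IsSaS α P X) : ∃ M, HasScale α P X M := by
  obtain ⟨hm, Γ, hΓ⟩ := h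
  refine ⟨_, (hΓ.hasScale hα hm (Sum.elim (fun _ => 1) (fun _ => Complex.I))).congr ?_⟩
  exact Eventually.of_forall fun ω => by simp [Complex.re_add_im]

end Covariation

section CharFun

lemma norm_one_sub_charFun_le {E : Type*} [NormedAddCommGroup E] [InnerProductSpace ℝ E]
    [MeasurableSpace E] [BorelSpace E] (μ : Measure E) [IsProbabilityMeasure μ] {δ : ℝ}
    (hδ : 0 ≤ δ) (t : E) : ‖1 - charFun μ t‖ ≤ δ * ‖t‖ + 2 * μ.real {x | δ ≤ ‖x‖} := by
  have hc : Continuous fun x : E => Complex.exp (⟪x, t⟫ * Complex.I) := by fun_prop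
  have hint : Integrable (fun x : E => Complex.exp (⟪x, t⟫ * Complex.I)) μ :=
    Integrable.of_bound hc.aestronglyMeasurable 1
      (Eventually.of_forall fun x => (Complex.norm_exp_ofReal_mul_I _).le)
  have hset : MeasurableSet {x : E | δ ≤ ‖x‖} := measurableSet_le measurable_const measurable_norm
  have hind : Integrable ({x : E | δ ≤ ‖x‖}.indicator fun _ => (2 : ℝ)) μ :=
    (integrable_const 2).indicator hset
  have hpoint (x : E) : ‖1 - Complex.exp (⟪x, t⟫ * Complex.I)‖
      ≤ δ * ‖t‖ + {x : E | δ ≤ ‖x‖}.indicator (fun _ => 2) x := by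
    by_cases hx : δ ≤ ‖x‖
    · have hle := norm_sub_le (1 : ℂ) (Complex.exp (⟪x, t⟫ * Complex.I))
      rw [Complex.norm_exp_ofReal_mul_I, norm_one] at hle
      rw [Set.indicator_of_mem (show x ∈ {x : E | δ ≤ ‖x‖} from hx)]
      nlinarith [mul_nonneg hδ (norm_nonneg t)]
    · rw [Set.indicator_of_notMem (by exact hx), add_zero, norm_sub_rev, mul_comm]
      refine Real.norm_exp_I_mul_ofReal_sub_one_le.trans ((abs_real_inner_le_norm x t).trans ?_)
      gcongr
      exact (not_le.mp hx).le
  have heq : 1 - charFun μ t = ∫ x, (1 - Complex.exp (⟪x, t⟫ * Complex.I)) ∂μ := by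
    rw [integral_sub (integrable_const _) hint, integral_const, probReal_univ, one_smul,
      charFun_apply]
  calc ‖1 - charFun μ t‖
      ≤ ∫ x, (δ * ‖t‖ + {x : E | δ ≤ ‖x‖}.indicator (fun _ => 2) x) ∂μ := by
        rw [heq]
        exact norm_integral_le_of_norm_le ((integrable_const _).add hind)
          (Eventually.of_forall hpoint)
    _ = δ * ‖t‖ + 2 * μ.real {x | δ ≤ ‖x‖} := by
        rw [integral_add (integrable_const _) hind, integral_const, probReal_univ, one_smul,
          integral_indicator_const _ hset, smul_eq_mul, mul_comm (μ.real _)]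

lemma norm_one_sub_exp_neg {x : ℝ} (hx : 0 ≤ x) :
    ‖1 - Complex.exp (-(x : ℂ))‖ = 1 - Real.exp (-x) := by
  rw [← Complex.ofReal_neg, ← Complex.ofReal_exp, ← Complex.ofReal_one, ← Complex.ofReal_sub,
    Complex.norm_real, Real.norm_of_nonneg (by simpa using hx)]

end CharFun

section ConvergenceInMeasure

variable {Ω : Type*} [MeasurableSpace Ω] {α : ℝ} {P : Measure Ω} {X : Ω → ℂ} {M : ℝ}

namespace HasScale

lemma charFun_eq_exp (hα : 0 < α) (h : HasScale α P X M) :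
    ∃ N : ℂ → ℝ, (∀ t, charFun (P.map X) t = Complex.exp (-(N t : ℂ))) ∧
      (∀ t, 0 ≤ N t) ∧ (∀ t, N t ≤ ‖t‖ ^ α * M) ∧
      ∫ φ in (0 : ℝ)..(2 * Real.pi), N (Complex.exp (φ * Complex.I)) = cosConst α * M := by
  obtain ⟨Γ, _, rfl, hΓ⟩ := h.exists_measure
  refine ⟨_, hΓ, fun t => integral_nonneg fun z => by positivity, fun t => ?_,
    integral_cosine_transform hα Γ⟩
  refine (integral_mono (integrable_abs_inner_rpow hα Γ t) (integrable_const (‖t‖ ^ α)) fun z =>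
    abs_inner_rpow_le hα z t).trans_eq ?_
  rw [integral_const, smul_eq_mul, mul_comm]

variable [IsProbabilityMeasure P]

lemma measureReal_abs_inner_gt_le (hα : 0 < α) (h : HasScale α P X M) {a : ℂ} (ha : ‖a‖ = 1)
    {r : ℝ} (hr : 0 < r) : (P.map X).real {x | r < |⟪a, x⟫|} ≤ 2 * (2 / r) ^ α * M := by
  obtain ⟨N, hN, hN0, hNle, -⟩ := h.charFun_eq_exp hα
  have : IsProbabilityMeasure (P.map X) := Measure.isProbabilityMeasure_map h.aemeasurable
  have hr' : 0 < 2 * r⁻¹ := by positivity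
  have hbound : ‖∫ t in -2 * r⁻¹..2 * r⁻¹, 1 - charFun (P.map X) (t • a)‖
      ≤ (2 * r⁻¹) ^ α * M * |2 * r⁻¹ - -2 * r⁻¹| := by
    refine intervalIntegral.norm_integral_le_of_norm_le_const fun t ht => ?_
    rw [Set.uIoc_of_le (by linarith), neg_mul] at ht
    have hexp := Real.add_one_le_exp (-N (t • a))
    calc ‖1 - charFun (P.map X) (t • a)‖
        = 1 - Real.exp (-N (t • a)) := by rw [hN, norm_one_sub_exp_neg (hN0 _)]
      _ ≤ N (t • a) := by linarith
      _ ≤ |t| ^ α * M := by simpa only [norm_smul, ha, mul_one, Real.norm_eq_abs] using hNle (t • a)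
      _ ≤ (2 * r⁻¹) ^ α * M := by
        gcongr
        exacts [h.nonneg, abs_le.mpr ⟨ht.1.le, ht.2⟩]
  refine (measureReal_abs_inner_gt_le_integral_charFun hr).trans
    ((mul_le_mul_of_nonneg_left hbound (by positivity)).trans_eq ?_)
  rw [neg_mul, sub_neg_eq_add, abs_of_pos (by positivity), div_eq_mul_inv]
  field_simp
  ring

lemma measureReal_norm_ge_le (hα : 0 < α) (h : HasScale α P X M) {ε : ℝ} (hε : 0 < ε) :
    P.real {ω | ε ≤ ‖X ω‖} ≤ 4 * (8 / ε) ^ α * M := by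
  have hset (a : ℂ) : MeasurableSet {x : ℂ | ε / 4 < |⟪a, x⟫|} :=
    measurableSet_lt measurable_const (by fun_prop)
  have hsub : {ω | ε ≤ ‖X ω‖}
      ⊆ X ⁻¹' ({x | ε / 4 < |⟪(1 : ℂ), x⟫|} ∪ {x | ε / 4 < |⟪Complex.I, x⟫|}) := by
    intro ω hω
    have hone : ⟪(1 : ℂ), X ω⟫ = (X ω).re := by simp [Complex.inner]
    have hI : ⟪Complex.I, X ω⟫ = (X ω).im := by simp [Complex.inner]
    by_contra hc
    simp only [Set.mem_preimage, Set.mem_union, Set.mem_ofPred_eq, hone, hI, not_or, not_lt] at hc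
    have hre := Complex.norm_le_abs_re_add_abs_im (X ω)
    rw [Set.mem_ofPred_eq] at hω
    linarith
  have h1 := h.measureReal_abs_inner_gt_le hα (norm_one (α := ℂ)) (show 0 < ε / 4 by positivity)
  have hI := h.measureReal_abs_inner_gt_le hα Complex.norm_I (show 0 < ε / 4 by positivity)
  calc P.real {ω | ε ≤ ‖X ω‖}
      ≤ (P.map X).real ({x | ε / 4 < |⟪(1 : ℂ), x⟫|} ∪ {x | ε / 4 < |⟪Complex.I, x⟫|}) := by
        rw [map_measureReal_apply_of_aemeasurable h.aemeasurable ((hset _).union (hset _))]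
        exact measureReal_mono hsub
    _ ≤ 2 * (2 / (ε / 4)) ^ α * M + 2 * (2 / (ε / 4)) ^ α * M :=
        (measureReal_union_le _ _).trans (add_le_add h1 hI)
    _ = 4 * (8 / ε) ^ α * M := by
        rw [show 2 / (ε / 4) = 8 / ε by field_simp; norm_num]
        ring

lemma cosConst_mul_le (hα : 0 < α) (h : HasScale α P X M) {δ : ℝ} (hδ0 : 0 ≤ δ) (hδ : δ < 1 / 6)
    (hX : P.real {ω | δ ≤ ‖X ω‖} ≤ δ) : cosConst α * M ≤ 12 * Real.pi * δ := by
  obtain ⟨N, hN, hN0, -, hNint⟩ := h.charFun_eq_exp hα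
  have : IsProbabilityMeasure (P.map X) := Measure.isProbabilityMeasure_map h.aemeasurable
  have hNle (t : ℂ) (ht : ‖t‖ = 1) : N t ≤ 6 * δ := by
    have hchar := norm_one_sub_charFun_le (P.map X) hδ0 t
    rw [map_measureReal_apply_of_aemeasurable h.aemeasurable
      (measurableSet_le measurable_const measurable_norm), hN, norm_one_sub_exp_neg (hN0 t), ht,
      mul_one, Set.preimage_ofPred_eq] at hchar
    have hexp : (N t + 1) * Real.exp (-N t) ≤ 1 := by
      rw [Real.exp_neg, ← div_eq_mul_inv, div_le_one (Real.exp_pos _)]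
      exact Real.add_one_le_exp _
    have hprod : (N t + 1) * (1 - 3 * δ) ≤ 1 :=
      (mul_le_mul_of_nonneg_left (by linarith) (by linarith [hN0 t])).trans hexp
    by_contra! hlt
    nlinarith
  have hbound : ‖∫ φ in (0 : ℝ)..(2 * Real.pi), N (Complex.exp (φ * Complex.I))‖
      ≤ 6 * δ * |2 * Real.pi - 0| :=
    intervalIntegral.norm_integral_le_of_norm_le_const fun φ _ => by
      rw [Real.norm_of_nonneg (hN0 _)]
      exact hNle _ (Complex.norm_exp_ofReal_mul_I φ)
  rw [hNint, sub_zero, abs_of_pos Real.two_pi_pos] at hbound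
  linarith [le_abs_self (cosConst α * M), Real.norm_eq_abs (cosConst α * M)]

lemma tendstoInMeasure_zero_iff {κ : Type*} {l : Filter κ} {X : κ → Ω → ℂ} {M : κ → ℝ}
    (hα : 0 < α) (h : ∀ i, HasScale α P (X i) (M i)) :
    TendstoInMeasure P X l 0 ↔ Tendsto M l (𝓝 0) := by
  simp only [tendstoInMeasure_iff_measureReal_norm, Pi.zero_apply, sub_zero]
  refine ⟨fun hX => ?_, fun hM ε hε => ?_⟩
  · refine tendsto_order.mpr ⟨fun a ha => Eventually.of_forall fun i => ha.trans_le (h i).nonneg,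
      fun a ha => ?_⟩
    have hK := cosConst_pos hα
    obtain ⟨δ, hδ0, hδ⟩ := exists_between (show 0 < min (1 / 6) (cosConst α * a / (12 * Real.pi))
      by positivity)
    obtain ⟨hδ6, hδa⟩ := lt_min_iff.mp hδ
    rw [lt_div_iff₀' (by positivity)] at hδa
    filter_upwards [(hX δ hδ0).eventually_le_const hδ0] with i hi
    exact lt_of_mul_lt_mul_left (((h i).cosConst_mul_le hα hδ0.le hδ6 hi).trans_lt hδa) hK.le
  · refine squeeze_zero (fun i => measureReal_nonneg)
      (fun i => (h i).measureReal_norm_ge_le hα hε) ?_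
    simpa only [mul_zero] using hM.const_mul (4 * (8 / ε) ^ α)

lemma ae_eq_zero (hα : 0 < α) (h : HasScale α P X 0) : X =ᵐ[P] 0 := by
  obtain ⟨N, hN, hN0, hNle, -⟩ := h.charFun_eq_exp hα
  have : IsProbabilityMeasure (P.map X) := Measure.isProbabilityMeasure_map h.aemeasurable
  have hdirac : P.map X = Measure.dirac 0 := by
    refine Measure.ext_of_charFun (funext fun t => ?_)
    rw [hN, le_antisymm (by simpa only [mul_zero] using hNle t) (hN0 t), charFun_dirac]
    simp only [Complex.ofReal_zero, neg_zero, Complex.exp_zero, inner_zero_left, zero_mul]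
  have hzero : ∀ᵐ x ∂P.map X, x = 0 := by
    rw [hdirac, ae_dirac_eq]
    rfl
  exact ae_of_ae_map h.aemeasurable hzero

end HasScale

variable [IsProbabilityMeasure P]

lemma exists_subseq_tendsto_charFun_map {X : ℕ → Ω → ℂ} {Y : Ω → ℂ}
    (hX : ∀ n, AEMeasurable (X n) P) (h : TendstoInMeasure P X atTop Y) :
    ∃ ns : ℕ → ℕ, StrictMono ns ∧
      ∀ t, Tendsto (fun k => charFun (P.map (X (ns k))) t) atTop (𝓝 (charFun (P.map Y) t)) := by
  obtain ⟨ns, hns, hae⟩ := h.exists_seq_tendsto_ae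
  refine ⟨ns, hns, fun t => ?_⟩
  simp_rw [charFun_map_eq_integral (hX _), charFun_map_eq_integral (h.aemeasurable hX)]
  refine tendsto_integral_of_dominated_convergence (fun _ => 1) (fun k => ?_)
    (integrable_const _) (fun k => Eventually.of_forall fun ω => ?_) ?_
  · have := hX (ns k)
    exact AEMeasurable.aestronglyMeasurable (by fun_prop)
  · rw [Complex.norm_exp_ofReal_mul_I]
  · filter_upwards [hae] with ω hω
    have hc : Continuous fun x : ℂ => Complex.exp (⟪x, t⟫ * Complex.I) := by fun_prop
    exact (hc.tendsto _).comp hω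

lemma exists_probabilityMeasure_integral_eq {S : Type*} [MeasurableSpace S] [Nonempty S]
    (Γ : Measure S) [IsFiniteMeasure Γ] :
    ∃ π : ProbabilityMeasure S,
      ∀ F : S → ℝ, ∫ s, F s ∂Γ = Γ.real Set.univ * ∫ s, F s ∂(π : Measure S) := by
  rcases eq_or_ne Γ 0 with rfl | hne
  · refine ⟨⟨Measure.dirac (Classical.arbitrary S), inferInstance⟩, fun F => ?_⟩
    rw [integral_zero_measure, measureReal_zero_apply, zero_mul]
  · have : NeZero Γ := ⟨hne⟩
    refine ⟨⟨(Γ Set.univ)⁻¹ • Γ, inferInstance⟩, fun F => ?_⟩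
    have hpos : Γ.real Set.univ ≠ 0 := (measureReal_univ_pos).ne'
    rw [ProbabilityMeasure.coe_mk, integral_smul_measure, ENNReal.toReal_inv, smul_eq_mul,
      ← measureReal_def, mul_inv_cancel_left₀ hpos]

/- The spectral measures have bounded mass on a compact circle, so a limit point of them represents
the limit law. -/
lemma HasScale.of_tendstoInMeasure {X : ℕ → Ω → ℂ} {Y : Ω → ℂ} {M : ℕ → ℝ} {m : ℝ} (hα : 0 < α)
    (h : ∀ n, HasScale α P (X n) (M n)) (hM : Tendsto M atTop (𝓝 m))
    (hX : TendstoInMeasure P X atTop Y) : HasScale α P Y m := by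
  have hXm (n : ℕ) : AEMeasurable (X n) P := (h n).aemeasurable
  obtain ⟨ns, hns, hchar⟩ := exists_subseq_tendsto_charFun_map hXm hX
  choose Γ hfin hMΓ hΓ using fun n => (h n).exists_measure
  have : Nonempty (Metric.sphere (0 : ℂ) 1) := ⟨⟨1, by simp⟩⟩
  choose π hπ using fun n => exists_probabilityMeasure_integral_eq (Γ n)
  set U : Ultrafilter ℕ := Ultrafilter.of atTop
  have hU : (U : Filter ℕ) ≤ atTop := Ultrafilter.of_le _
  obtain ⟨π₀, -, hπ₀⟩ := isCompact_univ.ultrafilter_le_nhds (U.map fun k => π (ns k))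
    (by rw [principal_univ]; exact le_top)
  have hconv := ProbabilityMeasure.tendsto_iff_forall_integral_tendsto.mp
    (show Tendsto (fun k => π (ns k)) U (𝓝 π₀) from hπ₀)
  have hMU : Tendsto (fun k => M (ns k)) U (𝓝 m) := (hM.comp hns.tendsto_atTop).mono_left hU
  have hm : 0 ≤ m := ge_of_tendsto' hM fun n => (h n).nonneg
  refine ⟨hX.aemeasurable hXm, m.toNNReal • (π₀ : Measure _), inferInstance, ?_, fun t => ?_⟩
  · rw [measureReal_nnreal_smul_apply, probReal_univ, mul_one, Real.coe_toNNReal _ hm]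
  · have hc : Continuous fun z : Metric.sphere (0 : ℂ) 1 => |⟪(z : ℂ), t⟫| ^ α :=
      (continuous_abs_inner_rpow hα).comp (continuous_subtype_val.prodMk continuous_const)
    have hlim : Tendsto (fun k => charFun (P.map (X (ns k))) t) U (𝓝 (Complex.exp
        (-((m * ∫ z, |⟪(z : ℂ), t⟫| ^ α ∂(π₀ : Measure (Metric.sphere (0 : ℂ) 1)) : ℝ) : ℂ)))) := by
      simp_rw [hΓ, hπ, hMΓ]
      exact (Complex.continuous_exp.tendsto _).comp ((Complex.continuous_ofReal.tendsto _).comp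
        (hMU.mul (hconv (BoundedContinuousFunction.mkOfCompact ⟨_, hc⟩)))).neg
    rw [tendsto_nhds_unique ((hchar t).mono_left hU) hlim, integral_smul_nnreal_measure,
      NNReal.smul_def, Real.coe_toNNReal _ hm, smul_eq_mul]

end ConvergenceInMeasure

section CauchyInMeasure

variable {Ω : Type*} [MeasurableSpace Ω] {P : Measure Ω} [IsFiniteMeasure P]
  {E : Type*} [NormedAddCommGroup E] {X : ℕ → Ω → E}

lemma exists_subseq_measureReal_norm_sub_le
    (hC : TendstoInMeasure P (fun i : ℕ × ℕ => X i.1 - X i.2) atTop 0) :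
    ∃ ns : ℕ → ℕ, StrictMono ns ∧ ∀ k,
      P.real {ω | (1 / 2 : ℝ) ^ k ≤ ‖X (ns (k + 1)) ω - X (ns k) ω‖} ≤ (1 / 2 : ℝ) ^ k := by
  rw [tendstoInMeasure_iff_measureReal_norm] at hC
  obtain ⟨ns, hns, hle⟩ := extraction_forall_of_eventually' (P := fun k n => ∀ m ≥ n,
      P.real {ω | (1 / 2 : ℝ) ^ k ≤ ‖X m ω - X n ω‖} ≤ (1 / 2 : ℝ) ^ k) fun k => by
    have hpos : (0 : ℝ) < (1 / 2) ^ k := by positivity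
    obtain ⟨⟨m₀, n₀⟩, hmn⟩ := eventually_atTop.mp ((hC _ hpos).eventually_le_const hpos)
    refine ⟨max m₀ n₀, fun n hn m hm => ?_⟩
    simpa only [Pi.sub_apply, Pi.zero_apply, sub_zero] using
      hmn (m, n) ⟨(le_max_left _ _).trans (hn.trans hm), (le_max_right _ _).trans hn⟩
  exact ⟨ns, hns, fun k => hle k _ (hns (Nat.lt_succ_self k)).le⟩

lemma exists_subseq_tendstoInMeasure [CompleteSpace E] (hX : ∀ n, AEStronglyMeasurable (X n) P)
    (hC : TendstoInMeasure P (fun i : ℕ × ℕ => X i.1 - X i.2) atTop 0) :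
    ∃ (ns : ℕ → ℕ) (Y : Ω → E), StrictMono ns ∧ TendstoInMeasure P (fun k => X (ns k)) atTop Y := by
  obtain ⟨ns, hns, hP⟩ := exists_subseq_measureReal_norm_sub_le hC
  have hsum : ∑' k, P {ω | (1 / 2 : ℝ) ^ k ≤ ‖X (ns (k + 1)) ω - X (ns k) ω‖} ≠ ∞ := by
    refine ne_top_of_le_ne_top ?_ (ENNReal.tsum_le_tsum fun k =>
      (ofReal_measureReal (μ := P)).symm.trans_le (ENNReal.ofReal_le_ofReal (hP k)))
    rw [← ENNReal.ofReal_tsum_of_nonneg (fun k => by positivity) summable_geometric_two]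
    exact ENNReal.ofReal_ne_top
  have hlim : ∀ᵐ ω ∂P, ∃ y, Tendsto (fun k => X (ns k) ω) atTop (𝓝 y) := by
    filter_upwards [ae_eventually_notMem hsum] with ω hω
    refine cauchySeq_tendsto_of_complete (cauchySeq_of_summable_dist
      (Summable.of_norm_bounded_eventually_nat summable_geometric_two ?_))
    filter_upwards [hω] with k hk
    rw [Real.norm_of_nonneg dist_nonneg, dist_comm, dist_eq_norm]
    exact (not_le.mp hk).le
  choose! Y hY using fun ω (h : ∃ y, Tendsto (fun k => X (ns k) ω) atTop (𝓝 y)) => h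
  exact ⟨ns, Y, hns, tendstoInMeasure_of_tendsto_ae (fun k => hX _) (hlim.mono hY)⟩

end CauchyInMeasure

section ConvexModular

lemma vpow_single_add_single {ι : Type*} [DecidableEq ι] {β : ℝ} {k l : ι} (hkl : k ≠ l) (z : ℂ) :
    vpow (Pi.single k 1 + Pi.single l z) β = Pi.single k 1 + Pi.single l (spow z β) := by
  ext j
  rw [vpow, Pi.add_apply, Pi.add_apply]
  rcases eq_or_ne j k with rfl | hjk
  · simp [hkl, spow]
  · rcases eq_or_ne j l with rfl | hjl
    · simp [hjk]
    · simp [hjk, hjl, spow_zero]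

variable {ι : Type*} [Fintype ι] {α : ℝ}

lemma form_single_add_single [DecidableEq ι] (F : Matrix ι ι ℂ) {k l : ι} (hkl : k ≠ l) (z : ℂ) :
    form α F (Pi.single k 1 + Pi.single l z) (Pi.single k 1 + Pi.single l z)
      = F k k + F k l * spow z (α - 1) + z * (F l k + F l l * spow z (α - 1)) := by
  rw [form, vpow_single_add_single hkl, Matrix.mulVec_add, add_dotProduct, single_dotProduct,
    single_dotProduct]
  simp only [Pi.add_apply, Matrix.mulVec_single, Pi.smul_apply, Matrix.col_apply,
    MulOpposite.op_one, one_smul, MulOpposite.smul_eq_mul_unop, MulOpposite.unop_op, one_mul]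

lemma modular_single_add_single [DecidableEq ι] (hα : 1 < α) (F : Matrix ι ι ℂ) {k l : ι}
    (hkl : k ≠ l) {c : ℂ} (hc : ‖c‖ = 1) {r : ℝ} (hr : 0 ≤ r) :
    modular α F (Pi.single k 1 + Pi.single l (r * c)) = (F k k).re
      + r ^ (α - 1) * ((starRingEnd ℂ) c * F k l).re + r * (c * F l k).re + r ^ α * (F l l).re := by
  have hspow : spow (r * c) (α - 1) = ((r ^ (α - 1) : ℝ) : ℂ) * (starRingEnd ℂ) c := by
    rw [spow_real_mul (by linarith) hr, spow, hc, Real.one_rpow, Complex.ofReal_one, one_mul]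
  have hself := mul_spow_self hα (r * c)
  rw [norm_mul, hc, mul_one, Complex.norm_real, Real.norm_of_nonneg hr] at hself
  rw [modular, form_single_add_single F hkl, mul_add, mul_left_comm _ (F l l), hself, hspow,
    mul_comm (F k l), mul_comm (F l l), mul_assoc, mul_assoc]
  simp only [Complex.add_re, Complex.re_ofReal_mul]
  ring

/- Along `e_k + r c e_l` the entry `F k l` contributes a multiple of `r ^ (α - 1)`, whereas
convexity only admits a multiple of `r`. -/
lemma norm_apply_le_of_convexOn_modular (hα : 1 < α) {F : Matrix ι ι ℂ}
    (hF : ConvexOn ℝ Set.univ (modular α F)) {k l : ι} (hkl : k ≠ l) {r : ℝ} (hr : 0 < r)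
    (hr1 : r < 1) : ‖F k l‖ ≤ r ^ (2 - α) * (‖F k l‖ + 2 * ‖F l l‖) := by
  classical
  obtain ⟨c', hc', hcF⟩ := RCLike.exists_norm_eq_mul_self (F k l)
  set c := (starRingEnd ℂ) c' with hc
  have hc1 : ‖c‖ = 1 := by rw [hc, RCLike.norm_conj, hc']
  have hcF' : ((starRingEnd ℂ) c * F k l).re = ‖F k l‖ := by
    rw [hc, Complex.conj_conj, ← hcF]
    exact Complex.ofReal_re _
  let v (r : ℝ) : ι → ℂ := Pi.single k 1 + Pi.single l (r * c)
  have hv : v r = (1 - r) • v 0 + r • v 1 := by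
    ext j
    simp only [v, Pi.add_apply, Pi.smul_apply, Complex.real_smul, ← smul_eq_mul, Pi.single_smul]
    push_cast
    simp only [smul_eq_mul]
    ring
  have hconv := hF.2 (Set.mem_univ (v 0)) (Set.mem_univ (v 1)) (sub_nonneg.mpr hr1.le) hr.le
    (sub_add_cancel 1 r)
  rw [← hv, smul_eq_mul, smul_eq_mul, modular_single_add_single hα F hkl hc1 hr.le,
    modular_single_add_single hα F hkl hc1 le_rfl,
    modular_single_add_single hα F hkl hc1 zero_le_one, hcF', Real.zero_rpow (by linarith),
    Real.zero_rpow (by linarith), Real.one_rpow, Real.one_rpow] at hconv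
  have hpow : r ^ (α - 1) * r ^ (2 - α) = r := by
    rw [← Real.rpow_add hr, sub_add_sub_cancel', sub_eq_add_neg]
    norm_num
  have hrα : r ^ α ≤ r := Real.rpow_le_self_of_le_one hr.le hr1.le hα.le
  have hrα0 : 0 ≤ r ^ α := by positivity
  have hre := abs_le.mp (Complex.abs_re_le_norm (F l l))
  refine le_of_mul_le_mul_left ?_ (Real.rpow_pos_of_pos hr (α - 1))
  rw [← mul_assoc, hpow]
  nlinarith

lemma apply_eq_zero_of_convexOn_modular (hα : 1 < α) (hα2 : α < 2) {F : Matrix ι ι ℂ}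
    (hF : ConvexOn ℝ Set.univ (modular α F)) {k l : ι} (hkl : k ≠ l) : F k l = 0 := by
  have hlim : Tendsto (fun r : ℝ => r ^ (2 - α) * (‖F k l‖ + 2 * ‖F l l‖)) (𝓝[>] 0) (𝓝 0) := by
    have hcont : Continuous fun r : ℝ => r ^ (2 - α) * (‖F k l‖ + 2 * ‖F l l‖) :=
      (Real.continuous_rpow_const (by linarith)).mul_const _
    refine (hcont.tendsto' 0 0 ?_).mono_left nhdsWithin_le_nhds
    rw [Real.zero_rpow (by linarith), zero_mul]
  refine norm_le_zero_iff.mp (ge_of_tendsto hlim ?_)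
  filter_upwards [Ioo_mem_nhdsGT (zero_lt_one' ℝ)] with r hr
  exact norm_apply_le_of_convexOn_modular hα hF hkl hr.1 hr.2

end ConvexModular

section StableFamily

variable {Ω : Type*} [MeasurableSpace Ω] {α : ℝ} {P : Measure Ω}

lemma CJointlySaS.exists_convexOn_hasScale {ι : Type*} [Fintype ι] {X : ι → Ω → ℂ} (hα : 1 < α)
    (h : CJointlySaS α P X) : ∃ N : (ι → ℂ) → ℝ, ConvexOn ℝ Set.univ N ∧
      ∀ u, HasScale α P (fun ω => ∑ k, u k * X k ω) (N u) := by
  obtain ⟨hX, Γ, hΓ⟩ := h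
  let d (x : EuclideanSpace ℝ (ι ⊕ ι)) (u : ι → ℂ) : ℂ :=
    ∑ k, (x k : ℂ) * Sum.elim u (Complex.I • u) k
  have hd (u : ι → ℂ) : Integrable (fun x => ‖d x u‖ ^ α) Γ :=
    hΓ.integrable (Continuous.rpow_const (by fun_prop) fun _ => Or.inr (by linarith))
  refine ⟨fun u => ∫ x, ‖d x u‖ ^ α ∂Γ, ⟨convex_univ, fun u _ v _ a b ha hb hab => ?_⟩, fun u => ?_⟩
  · have hlin (x : EuclideanSpace ℝ (ι ⊕ ι)) : d x (a • u + b • v) = a • d x u + b • d x v := by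
      simp only [d, Fintype.sum_sum_type, Sum.elim_inl, Sum.elim_inr, smul_add, Pi.add_apply,
        Pi.smul_apply, Finset.smul_sum, smul_eq_mul, Complex.real_smul, ← Finset.sum_add_distrib]
      exact Finset.sum_congr rfl fun k _ => by ring
    simp only [smul_eq_mul, ← integral_const_mul]
    rw [← integral_add ((hd u).const_mul a) ((hd v).const_mul b)]
    refine integral_mono (hd _) (((hd u).const_mul a).add ((hd v).const_mul b)) fun x => ?_
    simp only [hlin]
    exact (strictConvexOn_norm_rpow hα).convexOn.2 (Set.mem_univ _) (Set.mem_univ _) ha hb hab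
  · refine (hΓ.hasScale (by linarith) hX _).congr (Eventually.of_forall fun ω => ?_)
    simp only [Fintype.sum_sum_type, Sum.elim_inl, Sum.elim_inr, ← Finset.sum_add_distrib,
      Pi.smul_apply, smul_eq_mul]
    refine Finset.sum_congr rfl fun k _ => ?_
    nth_rewrite 3 [← Complex.re_add_im (X k ω)]
    ring

lemma IsSaSFamily.exists_convexOn_hasScale {I κ : Type*} [Fintype κ] {X : I → Ω → ℂ} (hα : 1 < α)
    (h : IsSaSFamily α P X) (g : κ → I) : ∃ N : (κ → ℂ) → ℝ, ConvexOn ℝ Set.univ N ∧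
      ∀ u, HasScale α P (fun ω => ∑ k, u k * X (g k) ω) (N u) := by
  classical
  obtain ⟨N, hN, hscale⟩ := (h (Finset.univ.image g)).exists_convexOn_hasScale hα
  let S : (κ → ℂ) →ₗ[ℝ] (Finset.univ.image g → ℂ) :=
    LinearMap.pi fun i => ∑ k with g k = i, LinearMap.proj k
  refine ⟨fun u => N (S u), hN.comp_linearMap S, fun u => (hscale (S u)).congr ?_⟩
  refine Eventually.of_forall fun ω => ?_
  calc ∑ i, S u i * X i ω
      = ∑ i ∈ Finset.univ.image g, ∑ k with g k = i, u k * X (g k) ω := by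
        rw [← Finset.sum_coe_sort (Finset.univ.image g)
          fun i => ∑ k with g k = i, u k * X (g k) ω]
        refine Finset.sum_congr rfl fun i _ => ?_
        simp only [S, LinearMap.pi_apply, LinearMap.coe_sum, Finset.sum_apply, LinearMap.proj_apply,
          Finset.sum_mul]
        exact Finset.sum_congr rfl fun k hk => by rw [(Finset.mem_filter.mp hk).2]
    _ = ∑ k, u k * X (g k) ω :=
        Finset.sum_fiberwise_of_maps_to (fun k _ => Finset.mem_image_of_mem g (Finset.mem_univ k)) _

end StableFamily

section SpectralMass

variable {Ω : Type*} [MeasurableSpace Ω] {α : ℝ} {P : Measure Ω} {T : ℕ}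
  {Z : ℝ → Ω → Fin T → ℂ} {f : ℝ → Matrix (Fin T) (Fin T) ℂ} {s t : ℝ}

/-- The spectral measure `∫_s^t f` of the interval `(s, t]`. -/
def specMass (f : ℝ → Matrix (Fin T) (Fin T) ℂ) (s t : ℝ) : Matrix (Fin T) (Fin T) ℂ :=
  Matrix.of fun k l => ∫ θ in Set.Ioc s t, f θ k l

lemma IsSaSFamily.exists_convexOn_hasScale_increment (hα : 1 < α)
    (h : IsSaSFamily α P fun (p : Set.Icc (-Real.pi) Real.pi × Fin T) ω => Z p.1 ω p.2)
    (s t : Set.Icc (-Real.pi) Real.pi) : ∃ N : (Fin T → ℂ) → ℝ, ConvexOn ℝ Set.univ N ∧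
      ∀ v, HasScale α P (fun ω => v ⬝ᵥ (Z t ω - Z s ω)) (N v) := by
  obtain ⟨N, hN, hscale⟩ := h.exists_convexOn_hasScale hα
    (Sum.elim (fun k => (t, k)) fun k => (s, k))
  let S : (Fin T → ℂ) →ₗ[ℝ] (Fin T ⊕ Fin T → ℂ) :=
    LinearMap.pi (Sum.elim (fun k => LinearMap.proj k) fun k => -LinearMap.proj k)
  refine ⟨fun v => N (S v), hN.comp_linearMap S, fun v => (hscale (S v)).congr ?_⟩
  refine Eventually.of_forall fun ω => ?_
  simp only [S, dotProduct, Fintype.sum_sum_type, LinearMap.pi_apply, Sum.elim_inl, Sum.elim_inr,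
    LinearMap.neg_apply, LinearMap.proj_apply, neg_mul, ← Finset.sum_add_distrib, Pi.sub_apply]
  exact Finset.sum_congr rfl fun k _ => by ring

namespace HasSpectralDensity

variable [IsProbabilityMeasure P]

lemma convexOn_and_hasScale (hα : 1 < α) (h : HasSpectralDensity α P Z f) (hs : -Real.pi ≤ s)
    (hst : s ≤ t) (ht : t ≤ Real.pi) : ConvexOn ℝ Set.univ (modular α (specMass f s t)) ∧
      ∀ v, HasScale α P (fun ω => v ⬝ᵥ (Z t ω - Z s ω)) (modular α (specMass f s t) v) := by
  obtain ⟨N, hN, hscale⟩ := h.stable.exists_convexOn_hasScale_increment hα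
    ⟨s, hs, hst.trans ht⟩ ⟨t, hs.trans hst, ht⟩
  have hmod : modular α (specMass f s t) = N := funext fun v => by
    have hcov := (h.spectral s t hs hst ht v v).symm.trans ((hscale v).covariation_self hα)
    rw [modular, form, specMass, hcov, Complex.ofReal_re]
  exact hmod ▸ ⟨hN, hscale⟩

lemma hasScale (hα : 1 < α) (h : HasSpectralDensity α P Z f) (hs : -Real.pi ≤ s) (hst : s ≤ t)
    (ht : t ≤ Real.pi) (v : Fin T → ℂ) :
    HasScale α P (fun ω => v ⬝ᵥ (Z t ω - Z s ω)) (modular α (specMass f s t) v) :=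
  (h.convexOn_and_hasScale hα hs hst ht).2 v

lemma specMass_eq_zero (hα : 1 < α) (hα2 : α < 2) (h : HasSpectralDensity α P Z f)
    (hs : -Real.pi ≤ s) (hst : s ≤ t) (ht : t ≤ Real.pi) {k l : Fin T} (hkl : k ≠ l) :
    specMass f s t k l = 0 :=
  apply_eq_zero_of_convexOn_modular hα hα2 (h.convexOn_and_hasScale hα hs hst ht).1 hkl

end HasSpectralDensity

lemma ae_eq_zero_of_integral_Ioc_eq_zero {E : Type*} [NormedAddCommGroup E] [NormedSpace ℝ E]
    [CompleteSpace E] {a b : ℝ} {g : ℝ → E} (hab : a ≤ b) (hg : IntegrableOn g (Set.Ioc a b))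
    (h : ∀ t, a ≤ t → t ≤ b → ∫ θ in Set.Ioc a t, g θ = 0) :
    ∀ᵐ θ ∂(volume.restrict (Set.Ioc a b)), g θ = 0 := by
  rw [ae_restrict_iff' measurableSet_Ioc]
  have hint : IntervalIntegrable g volume a b :=
    (intervalIntegrable_iff_integrableOn_Ioc_of_le hab).mpr hg
  filter_upwards [hint.ae_hasDerivAt_integral, Measure.ae_ne volume b] with x hx hxb hmem
  rw [Set.uIcc_of_le hab] at hx
  have hderiv := hx ⟨hmem.1.le, hmem.2⟩ a ⟨le_rfl, hab⟩
  have hzero : (fun y => ∫ t in a..y, g t) =ᶠ[𝓝 x] fun _ => 0 := by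
    filter_upwards [Ioo_mem_nhds hmem.1 (lt_of_le_of_ne hmem.2 hxb)] with y hy
    rw [intervalIntegral.integral_of_le hy.1.le]
    exact h y hy.1.le hy.2.le
  exact hderiv.unique ((hasDerivAt_const x 0).congr_of_eventuallyEq hzero)

lemma HasSpectralDensity.ae_isAlphaForm [IsProbabilityMeasure P] (hα : 1 < α) (hα2 : α ≤ 2)
    (h : HasSpectralDensity α P Z f)
    (hpos : ∀ᵐ θ ∂(volume.restrict (Set.Ioc (-Real.pi) Real.pi)), (f θ).PosDef) :
    ∀ᵐ θ ∂(volume.restrict (Set.Ioc (-Real.pi) Real.pi)), IsAlphaForm α (f θ) := by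
  rcases hα2.eq_or_lt with rfl | hα2
  · filter_upwards [hpos] with θ hθ using isAlphaForm_two hθ
  · have hdiag : ∀ᵐ θ ∂(volume.restrict (Set.Ioc (-Real.pi) Real.pi)),
        ∀ k l, k ≠ l → f θ k l = 0 := by
      refine ae_all_iff.mpr fun k => ae_all_iff.mpr fun l => ?_
      by_cases hkl : k = l
      · exact Eventually.of_forall fun θ h => absurd hkl h
      · filter_upwards [ae_eq_zero_of_integral_Ioc_eq_zero (neg_le_self Real.pi_pos.le)
          (h.integrable k l) fun t h1 h2 => h.specMass_eq_zero hα hα2 le_rfl h1 h2 hkl]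
          with θ hθ _ using hθ
    filter_upwards [hpos, hdiag] with θ hθ hd using isAlphaForm_of_diagonal hα hθ hd

end SpectralMass

section WeightedSpace

variable {T : ℕ} {α : ℝ} {f : ℝ → Matrix (Fin T) (Fin T) ℂ} {g h : ℝ → Fin T → ℂ}

/-- Lebesgue measure on the frequencies `(-π, π]`. -/
abbrev freq : Measure ℝ := volume.restrict (Set.Ioc (-Real.pi) Real.pi)

/-- The norm of `L^α(f)`. -/
def lnorm (α : ℝ) (f : ℝ → Matrix (Fin T) (Fin T) ℂ) (h : ℝ → Fin T → ℂ) : ℝ≥0∞ :=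
  lalpha α f h ^ (1 / α)

lemma lalpha_eq_lintegral_modular :
    lalpha α f h = ∫⁻ θ, ENNReal.ofReal (modular α (f θ) (h θ)) ∂freq := rfl

lemma lalpha_zero : lalpha α f 0 = 0 := by
  simp only [lalpha, Pi.zero_apply, zero_dotProduct, Complex.zero_re, ENNReal.ofReal_zero,
    lintegral_zero]

lemma lalpha_congr (hgh : g =ᵐ[freq] h) : lalpha α f g = lalpha α f h :=
  lintegral_congr_ae (by filter_upwards [hgh] with θ hθ using by rw [hθ])

lemma lnorm_rpow (hα : 0 < α) : lnorm α f h ^ α = lalpha α f h := by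
  rw [lnorm, ← ENNReal.rpow_mul, one_div_mul_cancel hα.ne', ENNReal.rpow_one]

lemma lnorm_lt_top_iff (hα : 0 < α) : lnorm α f h < ∞ ↔ lalpha α f h < ∞ :=
  ENNReal.rpow_lt_top_iff_of_pos (one_div_pos.mpr hα)

lemma tendsto_lnorm_zero_iff (hα : 0 < α) {κ : Type*} {l : Filter κ} {u : κ → ℝ → Fin T → ℂ} :
    Tendsto (fun i => lnorm α f (u i)) l (𝓝 0) ↔ Tendsto (fun i => lalpha α f (u i)) l (𝓝 0) := by
  constructor <;> intro h
  · simpa only [lnorm_rpow hα, ENNReal.zero_rpow_of_pos hα] using h.ennrpow_const α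
  · simpa only [lnorm, ENNReal.zero_rpow_of_pos (one_div_pos.mpr hα)] using
      h.ennrpow_const (1 / α)

/-- The properties of a spectral density on which the interpolation theory rests. -/
structure IsDensity (α : ℝ) (f : ℝ → Matrix (Fin T) (Fin T) ℂ) : Prop where
  one_lt : 1 < α
  posDef : ∀ᵐ θ ∂freq, (f θ).PosDef
  alphaForm : ∀ᵐ θ ∂freq, IsAlphaForm α (f θ)
  integrable : ∀ k l, Integrable (fun θ => f θ k l) freq
  integrable_trace : Integrable (fun θ => traceInv α (f θ)) freq

lemma HasSpectralDensity.isDensity {Ω : Type*} [MeasurableSpace Ω] (hα : 1 < α) (hα2 : α ≤ 2)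
    {P : Measure Ω} [IsProbabilityMeasure P] {Z : ℝ → Ω → Fin T → ℂ}
    (h : HasSpectralDensity α P Z f) (hf : Minimality α f) : IsDensity α f :=
  ⟨hα, hf.1, h.ae_isAlphaForm hα hα2 hf.1, h.integrable, hf.2.re⟩

namespace IsDensity

lemma pos (hf : IsDensity α f) : 0 < α := zero_lt_one.trans hf.one_lt

lemma modular_nonneg (hf : IsDensity α f) (h : ℝ → Fin T → ℂ) :
    0 ≤ᵐ[freq] fun θ => modular α (f θ) (h θ) := by
  filter_upwards [hf.alphaForm] with θ hθ using hθ.modular_nonneg hf.one_lt _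

lemma aestronglyMeasurable_form (hf : IsDensity α f) (hg : AEStronglyMeasurable g freq)
    (hh : AEStronglyMeasurable h freq) :
    AEStronglyMeasurable (fun θ => form α (f θ) (g θ) (h θ)) freq := by
  have hvpow : AEStronglyMeasurable (fun θ => vpow (h θ) (α - 1)) freq :=
    (continuous_vpow (sub_pos.mpr hf.one_lt)).comp_aestronglyMeasurable hh
  simp only [form, dotProduct, Matrix.mulVec]
  exact Finset.aestronglyMeasurable_fun_sum _ fun k _ =>
    ((continuous_apply k).comp_aestronglyMeasurable hg).mul <|
      Finset.aestronglyMeasurable_fun_sum _ fun l _ =>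
        (hf.integrable k l).1.mul ((continuous_apply l).comp_aestronglyMeasurable hvpow)

lemma aemeasurable_modular (hf : IsDensity α f) (hh : AEStronglyMeasurable h freq) :
    AEMeasurable (fun θ => modular α (f θ) (h θ)) freq :=
  Complex.measurable_re.comp_aemeasurable (hf.aestronglyMeasurable_form hh hh).aemeasurable

lemma integrable_modular (hf : IsDensity α f) (hh : MemLalpha α f h) :
    Integrable (fun θ => modular α (f θ) (h θ)) freq :=
  ⟨(hf.aemeasurable_modular hh.1).aestronglyMeasurable,
    (hasFiniteIntegral_iff_ofReal (hf.modular_nonneg h)).mpr hh.2⟩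

lemma toReal_lalpha (hf : IsDensity α f) (hh : AEStronglyMeasurable h freq) :
    (lalpha α f h).toReal = ∫ θ, modular α (f θ) (h θ) ∂freq :=
  (integral_eq_lintegral_of_nonneg_ae (hf.modular_nonneg h)
    (hf.aemeasurable_modular hh).aestronglyMeasurable).symm

lemma lalpha_smul (hf : IsDensity α f) (c : ℂ) (h : ℝ → Fin T → ℂ) :
    lalpha α f (c • h) = ENNReal.ofReal (‖c‖ ^ α) * lalpha α f h := by
  rw [lalpha_eq_lintegral_modular, lalpha_eq_lintegral_modular,
    ← lintegral_const_mul' _ _ ENNReal.ofReal_ne_top]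
  refine lintegral_congr_ae ?_
  filter_upwards [hf.alphaForm] with θ hθ
  rw [Pi.smul_apply, hθ.modular_smul hf.one_lt, ENNReal.ofReal_mul (by positivity)]

lemma lalpha_sub_comm (hf : IsDensity α f) (g h : ℝ → Fin T → ℂ) :
    lalpha α f (g - h) = lalpha α f (h - g) := by
  rw [← neg_sub h g, ← neg_one_smul ℂ, hf.lalpha_smul, norm_neg, norm_one, Real.one_rpow,
    ENNReal.ofReal_one, one_mul]

lemma lnorm_sub_comm (hf : IsDensity α f) (g h : ℝ → Fin T → ℂ) :
    lnorm α f (g - h) = lnorm α f (h - g) := by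
  rw [lnorm, hf.lalpha_sub_comm, lnorm]

lemma lnorm_eq_lintegral (hf : IsDensity α f) (h : ℝ → Fin T → ℂ) : lnorm α f h
    = (∫⁻ θ, ENNReal.ofReal (modular α (f θ) (h θ) ^ (1 / α)) ^ α ∂freq) ^ (1 / α) := by
  rw [lnorm, lalpha_eq_lintegral_modular]
  congr 1
  refine lintegral_congr_ae ?_
  filter_upwards [hf.modular_nonneg h] with θ hθ
  rw [ENNReal.ofReal_rpow_of_nonneg (Real.rpow_nonneg hθ _) hf.pos.le, ← Real.rpow_mul hθ,
    one_div_mul_cancel hf.pos.ne', Real.rpow_one]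

lemma lnorm_add_le (hf : IsDensity α f) (hg : AEStronglyMeasurable g freq)
    (hh : AEStronglyMeasurable h freq) : lnorm α f (g + h) ≤ lnorm α f g + lnorm α f h := by
  have hmeas {u : ℝ → Fin T → ℂ} (hu : AEStronglyMeasurable u freq) :
      AEMeasurable (fun θ => ENNReal.ofReal (modular α (f θ) (u θ) ^ (1 / α))) freq :=
    ((hf.aemeasurable_modular hu).pow_const _).ennreal_ofReal
  simp only [hf.lnorm_eq_lintegral]
  refine le_trans ?_ (ENNReal.lintegral_Lp_add_le (hmeas hg) (hmeas hh) hf.one_lt.le)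
  refine ENNReal.rpow_le_rpow (lintegral_mono_ae ?_) (one_div_nonneg.mpr hf.pos.le)
  filter_upwards [hf.alphaForm, hf.modular_nonneg g, hf.modular_nonneg h] with θ hθ hgθ hhθ
  refine ENNReal.rpow_le_rpow ?_ hf.pos.le
  rw [Pi.add_apply, Pi.add_apply,
    ← ENNReal.ofReal_add (Real.rpow_nonneg hgθ _) (Real.rpow_nonneg hhθ _)]
  exact ENNReal.ofReal_le_ofReal (hθ.modular_add_rpow_le hf.one_lt _ _)

lemma memLalpha_add (hf : IsDensity α f) (hg : MemLalpha α f g) (hh : MemLalpha α f h) :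
    MemLalpha α f (g + h) :=
  ⟨hg.1.add hh.1, (lnorm_lt_top_iff hf.pos).mp ((hf.lnorm_add_le hg.1 hh.1).trans_lt
    (ENNReal.add_lt_top.mpr ⟨(lnorm_lt_top_iff hf.pos).mpr hg.2,
      (lnorm_lt_top_iff hf.pos).mpr hh.2⟩))⟩

lemma memLalpha_smul (hf : IsDensity α f) (c : ℂ) (hh : MemLalpha α f h) :
    MemLalpha α f (c • h) := by
  refine ⟨hh.1.const_smul c, ?_⟩
  rw [hf.lalpha_smul]
  exact ENNReal.mul_lt_top ENNReal.ofReal_lt_top hh.2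

lemma memLalpha_sub (hf : IsDensity α f) (hg : MemLalpha α f g) (hh : MemLalpha α f h) :
    MemLalpha α f (g - h) := by
  rw [sub_eq_add_neg, ← neg_one_smul ℂ h]
  exact hf.memLalpha_add hg (hf.memLalpha_smul _ hh)

lemma memLalpha_of_bounded (hf : IsDensity α f) (hh : AEStronglyMeasurable h freq) {C : ℝ}
    (hC : ∀ θ, ‖h θ‖ ≤ C) : MemLalpha α f h := by
  have hC0 : 0 ≤ C := (norm_nonneg _).trans (hC 0)
  have hα : 0 < α - 1 := sub_pos.mpr hf.one_lt
  have hint : Integrable (fun θ => ∑ k, ∑ l, C * (‖f θ k l‖ * C ^ (α - 1))) freq :=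
    integrable_finsetSum _ fun k _ => integrable_finsetSum _ fun l _ =>
      (((hf.integrable k l).norm).mul_const _).const_mul _
  refine ⟨hh, (lintegral_mono fun θ => ENNReal.ofReal_le_ofReal ?_).trans_lt
    hint.lintegral_lt_top⟩
  refine (Complex.re_le_norm _).trans ?_
  rw [dotProduct]
  refine norm_sum_le_of_le _ fun k _ => ?_
  rw [norm_mul, ← Finset.mul_sum]
  refine mul_le_mul ((norm_le_pi_norm _ k).trans (hC θ)) ?_ (norm_nonneg _) hC0
  rw [Matrix.mulVec, dotProduct]
  refine norm_sum_le_of_le _ fun l _ => ?_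
  rw [norm_mul, vpow, norm_spow hα]
  gcongr
  exact (norm_le_pi_norm _ l).trans (hC θ)

section Limits

variable {κ : Type*} {i : Filter κ} {u v : κ → ℝ → Fin T → ℂ}

lemma tendsto_lalpha_add_zero (hf : IsDensity α f) (hu : ∀ n, AEStronglyMeasurable (u n) freq)
    (hv : ∀ n, AEStronglyMeasurable (v n) freq)
    (hu0 : Tendsto (fun n => lalpha α f (u n)) i (𝓝 0))
    (hv0 : Tendsto (fun n => lalpha α f (v n)) i (𝓝 0)) :
    Tendsto (fun n => lalpha α f (u n + v n)) i (𝓝 0) := by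
  rw [← tendsto_lnorm_zero_iff hf.pos] at hu0 hv0 ⊢
  have hsum := hu0.add hv0
  rw [add_zero] at hsum
  exact tendsto_of_tendsto_of_tendsto_of_le_of_le tendsto_const_nhds hsum (fun _ => zero_le)
    fun n => hf.lnorm_add_le (hu n) (hv n)

lemma tendsto_lalpha_smul_zero (hf : IsDensity α f) (c : ℂ)
    (hu0 : Tendsto (fun n => lalpha α f (u n)) i (𝓝 0)) :
    Tendsto (fun n => lalpha α f (c • u n)) i (𝓝 0) := by
  simp only [hf.lalpha_smul]
  simpa only [mul_zero] using
    ENNReal.Tendsto.const_mul (a := ENNReal.ofReal (‖c‖ ^ α)) hu0 (Or.inr ENNReal.ofReal_ne_top)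

lemma tendsto_lalpha (hf : IsDensity α f) (hu : ∀ n, AEStronglyMeasurable (u n) freq)
    (hh : MemLalpha α f h) (hlim : Tendsto (fun n => lalpha α f (h - u n)) i (𝓝 0)) :
    Tendsto (fun n => lalpha α f (u n)) i (𝓝 (lalpha α f h)) := by
  rw [← tendsto_lnorm_zero_iff hf.pos] at hlim
  have hlower : Tendsto (fun n => lnorm α f h - lnorm α f (h - u n)) i (𝓝 (lnorm α f h)) := by
    simpa only [tsub_zero] using ENNReal.Tendsto.sub tendsto_const_nhds hlim
      (Or.inl ((lnorm_lt_top_iff hf.pos).mpr hh.2).ne)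
  have hupper : Tendsto (fun n => lnorm α f h + lnorm α f (h - u n)) i (𝓝 (lnorm α f h)) := by
    simpa only [add_zero] using tendsto_const_nhds.add hlim
  have hnorm : Tendsto (fun n => lnorm α f (u n)) i (𝓝 (lnorm α f h)) := by
    refine tendsto_of_tendsto_of_tendsto_of_le_of_le hlower hupper (fun n => ?_) fun n => ?_
    · rw [tsub_le_iff_right]
      simpa only [add_sub_cancel] using hf.lnorm_add_le (hu n) (hh.1.sub (hu n))
    · rw [hf.lnorm_sub_comm h]
      simpa only [add_sub_cancel] using hf.lnorm_add_le hh.1 ((hu n).sub hh.1)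
  simpa only [lnorm_rpow hf.pos] using hnorm.ennrpow_const α

lemma lintegral_enorm_apply_le (hf : IsDensity α f) (hh : AEStronglyMeasurable h freq) {ε : ℝ}
    (hε : 0 < ε) (l : Fin T) : ∫⁻ θ, ‖h θ l‖ₑ ∂freq ≤
      ENNReal.ofReal (ε * ∫ θ, traceInv α (f θ) ∂freq)
        + ENNReal.ofReal (ε ^ (1 - α)) * lalpha α f h := by
  have htrace : 0 ≤ᵐ[freq] fun θ => ε * traceInv α (f θ) := by
    filter_upwards [hf.alphaForm] with θ hθ using mul_nonneg hε.le hθ.traceInv_nonneg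
  have hle : ∫⁻ θ, ‖h θ l‖ₑ ∂freq ≤ ∫⁻ θ, (ENNReal.ofReal (ε * traceInv α (f θ))
      + ENNReal.ofReal (ε ^ (1 - α)) * ENNReal.ofReal (modular α (f θ) (h θ))) ∂freq := by
    refine lintegral_mono_ae ?_
    filter_upwards [hf.alphaForm, htrace, hf.modular_nonneg h] with θ hθ htr hmod
    rw [← ENNReal.ofReal_mul (by positivity), ← ENNReal.ofReal_add htr
      (mul_nonneg (by positivity) hmod), ← ofReal_norm]
    exact ENNReal.ofReal_le_ofReal (hθ.norm_apply_le_of_pos hf.one_lt hε _ _)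
  refine hle.trans_eq ?_
  rw [lintegral_add_right' _ (((hf.aemeasurable_modular hh).ennreal_ofReal).const_mul _),
    lintegral_const_mul' _ _ ENNReal.ofReal_ne_top, ← lalpha_eq_lintegral_modular,
    ← ofReal_integral_eq_lintegral_ofReal (hf.integrable_trace.const_mul ε) htrace,
    integral_const_mul]

lemma integrable_apply (hf : IsDensity α f) (hh : MemLalpha α f h) (l : Fin T) :
    Integrable (fun θ => h θ l) freq :=
  ⟨(continuous_apply l).comp_aestronglyMeasurable hh.1,
    (hf.lintegral_enorm_apply_le hh.1 one_pos l).trans_lt (ENNReal.add_lt_top.mpr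
      ⟨ENNReal.ofReal_lt_top, ENNReal.mul_lt_top ENNReal.ofReal_lt_top hh.2⟩)⟩

lemma tendsto_lintegral_enorm_apply (hf : IsDensity α f)
    (hu : ∀ n, AEStronglyMeasurable (u n) freq)
    (hu0 : Tendsto (fun n => lalpha α f (u n)) i (𝓝 0)) (l : Fin T) :
    Tendsto (fun n => ∫⁻ θ, ‖u n θ l‖ₑ ∂freq) i (𝓝 0) := by
  set τ := ∫ θ, traceInv α (f θ) ∂freq
  have hτ : Tendsto (fun ε : ℝ => ENNReal.ofReal (ε * τ)) (𝓝[>] 0) (𝓝 0) := by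
    have hcont : Continuous fun ε : ℝ => ENNReal.ofReal (ε * τ) :=
      ENNReal.continuous_ofReal.comp (continuous_mul_const τ)
    exact (hcont.tendsto' 0 0 (by rw [zero_mul, ENNReal.ofReal_zero])).mono_left nhdsWithin_le_nhds
  refine ENNReal.tendsto_nhds_zero.mpr fun η hη => ?_
  obtain ⟨ε, hεη, hε⟩ := ((hτ.eventually_le_const (ENNReal.half_pos hη.ne')).and
    self_mem_nhdsWithin).exists
  have hmul := ENNReal.Tendsto.const_mul (a := ENNReal.ofReal (ε ^ (1 - α))) hu0
    (Or.inr ENNReal.ofReal_ne_top)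
  rw [mul_zero] at hmul
  filter_upwards [hmul.eventually_le_const (ENNReal.half_pos hη.ne')] with n hn
  exact (hf.lintegral_enorm_apply_le (hu n) hε l).trans
    ((add_le_add hεη hn).trans_eq (ENNReal.add_halves η))

end Limits

end IsDensity

end WeightedSpace

section Telescoping

variable {G : Type*} [AddCommGroup G] {n : ℕ}

lemma sum_succ_sub_castSucc (F : Fin (n + 1) → G) :
    ∑ i : Fin n, (F i.succ - F i.castSucc) = F (Fin.last n) - F 0 := by
  rw [Finset.sum_sub_distrib, sub_eq_sub_iff_add_eq_add, add_comm, ← Fin.sum_univ_succ,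
    Fin.sum_univ_castSucc, add_comm]

lemma sum_succ_sub_castSucc_of_mem_Ioc (F : Fin (n + 1) → G) {a b : Fin (n + 1)} (hab : a ≤ b) :
    ∑ i : Fin n, (if i.succ ∈ Set.Ioc a b then F i.succ - F i.castSucc else 0) = F b - F a := by
  have hclamp := sum_succ_sub_castSucc fun i => F (max a (min i b))
  rw [min_eq_right (Fin.le_last b), max_eq_right hab, min_eq_left (Fin.zero_le b),
    max_eq_left (Fin.zero_le a)] at hclamp
  rw [← hclamp]
  refine Finset.sum_congr rfl fun i _ => ?_
  have hi : i.castSucc ≤ i.succ := Fin.castSucc_le_succ i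
  split_ifs with hmem
  · rw [min_eq_left hmem.2, min_eq_left (hi.trans hmem.2), max_eq_right hmem.1.le,
      max_eq_right (Fin.le_castSucc_iff.mpr hmem.1)]
  · rcases le_or_gt i.succ a with hia | hai
    · rw [min_eq_left (hia.trans hab), min_eq_left ((hi.trans hia).trans hab), max_eq_left hia,
        max_eq_left (hi.trans hia), sub_self]
    · have hbi : b < i.succ := not_le.mp fun hib => hmem ⟨hai, hib⟩
      rw [min_eq_right hbi.le, min_eq_right (Fin.le_castSucc_iff.mpr hbi), sub_self]

end Telescoping

section IntegralForm

variable {S ι : Type*} [MeasurableSpace S] [Fintype ι] {μ : Measure S} {f : S → Matrix ι ι ℂ}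

lemma integrable_form (α : ℝ) (hf : ∀ k l, Integrable (fun θ => f θ k l) μ) (u v : ι → ℂ) :
    Integrable (fun θ => form α (f θ) u v) μ := by
  simp only [form, dotProduct, Matrix.mulVec]
  exact integrable_finsetSum _ fun k _ =>
    (integrable_finsetSum _ fun l _ => (hf k l).mul_const _).const_mul _

lemma integral_form (α : ℝ) (hf : ∀ k l, Integrable (fun θ => f θ k l) μ) (u v : ι → ℂ) :
    ∫ θ, form α (f θ) u v ∂μ = form α (Matrix.of fun k l => ∫ θ, f θ k l ∂μ) u v := by
  simp only [form, dotProduct, Matrix.mulVec, Matrix.of_apply]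
  rw [integral_finsetSum _ fun k _ =>
    (integrable_finsetSum _ fun l _ => (hf k l).mul_const _).const_mul _]
  refine Finset.sum_congr rfl fun k _ => ?_
  rw [integral_const_mul, integral_finsetSum _ fun l _ => (hf k l).mul_const _]
  simp only [integral_mul_const]

lemma integral_modular (α : ℝ) (hf : ∀ k l, Integrable (fun θ => f θ k l) μ) (v : ι → ℂ) :
    ∫ θ, modular α (f θ) v ∂μ = modular α (Matrix.of fun k l => ∫ θ, f θ k l ∂μ) v :=
  (integral_re (integrable_form α hf v v)).trans (congrArg Complex.re (integral_form α hf v v))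

end IntegralForm

namespace StepFun

section Pair

variable {Ω : Type*} {T : ℕ} {G H : Type*} [AddCommGroup G] [Module ℂ G] [AddCommGroup H]
  [Module ℂ H]

/-- The sum `∑ B(v_i, F(t_{i+1}) - F(t_i))` for a bilinear map `B`. Both the values of a step
function and its stochastic integral are of this form. -/
def pair (φ : StepFun T) (B : (Fin T → ℂ) →ₗ[ℂ] G →ₗ[ℂ] H) (F : ℝ → G) : H :=
  ∑ i : Fin φ.n, B (φ.v i) (F (φ.t i.succ) - F (φ.t i.castSucc))

lemma t_castSucc_le_succ (φ : StepFun T) (i : Fin φ.n) : φ.t i.castSucc ≤ φ.t i.succ :=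
  φ.mono (Fin.castSucc_le_succ i)

lemma toFun_eq_pair (φ : StepFun T) (θ : ℝ) : φ.toFun θ
    = φ.pair (LinearMap.lsmul ℂ (Fin T → ℂ)).flip (Set.indicator (Set.Ici θ) 1) := by
  refine Finset.sum_congr rfl fun i _ => ?_
  have hle := φ.t_castSucc_le_succ i
  simp only [LinearMap.flip_apply, LinearMap.lsmul_apply, Set.indicator_apply, Set.mem_Ioc,
    Set.mem_Ici, Pi.one_apply]
  by_cases h1 : θ ≤ φ.t i.castSucc
  · simp [h1, h1.trans hle]
  · by_cases h2 : θ ≤ φ.t i.succ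
    · simp [h1, h2, not_le.mp h1]
    · simp [h1, h2]

lemma integral_eq_pair (φ : StepFun T) (Z : ℝ → Ω → Fin T → ℂ) (ω : Ω) :
    φ.integral Z ω = φ.pair (dotProductBilin ℂ ℂ) (fun x => Z x ω) := rfl

lemma sum_refinement_eq_pair (φ : StepFun T) (B : (Fin T → ℂ) →ₗ[ℂ] G →ₗ[ℂ] H) (F : ℝ → G) {n : ℕ}
    {s : Fin (n + 1) → ℝ} (hs : StrictMono s) (hsub : ∀ i, φ.t i ∈ Set.range s) :
    ∑ i : Fin n, B (φ.toFun (s i.succ)) (F (s i.succ) - F (s i.castSucc)) = φ.pair B F := by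
  choose j hj using hsub
  have hvalue (i : Fin n) : B (φ.toFun (s i.succ)) (F (s i.succ) - F (s i.castSucc))
      = ∑ k : Fin φ.n, B (φ.v k) (if i.succ ∈ Set.Ioc (j k.castSucc) (j k.succ) then
          F (s i.succ) - F (s i.castSucc) else 0) := by
    rw [toFun, map_sum, LinearMap.sum_apply]
    refine Finset.sum_congr rfl fun k _ => ?_
    simp only [Set.indicator_apply, Set.mem_Ioc, ← hj, hs.lt_iff_lt, hs.le_iff_le]
    split_ifs <;> simp only [map_zero, LinearMap.zero_apply]
  rw [Finset.sum_congr rfl fun i _ => hvalue i, Finset.sum_comm, pair]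
  refine Finset.sum_congr rfl fun k _ => ?_
  rw [← map_sum, sum_succ_sub_castSucc_of_mem_Ioc (fun i => F (s i)), hj, hj]
  rw [← hs.le_iff_le, hj, hj]
  exact φ.t_castSucc_le_succ k

lemma exists_common_refinement (φ ψ : StepFun T) : ∃ (n : ℕ) (s : Fin (n + 1) → ℝ),
    StrictMono s ∧ (∀ i, s i ∈ Set.Icc (-Real.pi) Real.pi) ∧
      (∀ i, φ.t i ∈ Set.range s) ∧ ∀ i, ψ.t i ∈ Set.range s := by
  classical
  let S : Finset ℝ := Finset.univ.image φ.t ∪ Finset.univ.image ψ.t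
  have hφ (i : Fin (φ.n + 1)) : φ.t i ∈ S :=
    Finset.mem_union_left _ (Finset.mem_image_of_mem _ (Finset.mem_univ _))
  have hψ (i : Fin (ψ.n + 1)) : ψ.t i ∈ S :=
    Finset.mem_union_right _ (Finset.mem_image_of_mem _ (Finset.mem_univ _))
  obtain ⟨n, hn⟩ := Nat.exists_eq_succ_of_ne_zero (Finset.card_pos.mpr ⟨_, hφ 0⟩).ne'
  have hrange : Set.range (S.orderEmbOfFin hn) = S := Finset.range_orderEmbOfFin S hn
  refine ⟨n, S.orderEmbOfFin hn, (S.orderEmbOfFin hn).strictMono, fun i => ?_,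
    fun i => hrange ▸ hφ i, fun i => hrange ▸ hψ i⟩
  rcases Finset.mem_union.mp (S.orderEmbOfFin_mem hn i) with h | h
  · obtain ⟨k, -, hk⟩ := Finset.mem_image.mp h
    exact hk ▸ φ.mem k
  · obtain ⟨k, -, hk⟩ := Finset.mem_image.mp h
    exact hk ▸ ψ.mem k

lemma exists_linear_comb (φ ψ : StepFun T) (a b : ℂ) : ∃ χ : StepFun T,
    χ.toFun = a • φ.toFun + b • ψ.toFun ∧ ∀ Z : ℝ → Ω → Fin T → ℂ,
      χ.integral Z = a • φ.integral Z + b • ψ.integral Z := by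
  obtain ⟨n, s, hs, hmem, hφ, hψ⟩ := exists_common_refinement φ ψ
  let χ : StepFun T := ⟨n, s, hs.monotone, hmem,
    fun i => a • φ.toFun (s i.succ) + b • ψ.toFun (s i.succ)⟩
  have hpair {G H : Type} [AddCommGroup G] [Module ℂ G] [AddCommGroup H] [Module ℂ H]
      (B : (Fin T → ℂ) →ₗ[ℂ] G →ₗ[ℂ] H) (F : ℝ → G) :
      χ.pair B F = a • φ.pair B F + b • ψ.pair B F := by
    rw [← φ.sum_refinement_eq_pair B F hs hφ, ← ψ.sum_refinement_eq_pair B F hs hψ,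
      Finset.smul_sum, Finset.smul_sum, ← Finset.sum_add_distrib]
    refine Finset.sum_congr rfl fun i _ => ?_
    simp only [χ, map_add, map_smul, LinearMap.add_apply, LinearMap.smul_apply]
  refine ⟨χ, funext fun θ => ?_, fun Z => funext fun ω => ?_⟩
  · simp only [Pi.add_apply, Pi.smul_apply, toFun_eq_pair, hpair]
  · simp only [Pi.add_apply, Pi.smul_apply, integral_eq_pair, hpair]

end Pair

section Isometry

variable {Ω : Type*} [MeasurableSpace Ω] {T : ℕ} {α : ℝ} {P : Measure Ω}
  {Z : ℝ → Ω → Fin T → ℂ} {f : ℝ → Matrix (Fin T) (Fin T) ℂ}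

lemma aestronglyMeasurable_toFun (φ : StepFun T) : AEStronglyMeasurable φ.toFun freq := by
  unfold toFun
  exact (Finset.measurable_fun_sum _ fun i _ =>
    (measurable_const (a := φ.v i)).indicator measurableSet_Ioc).aestronglyMeasurable

lemma memLalpha_toFun (hf : IsDensity α f) (φ : StepFun T) : MemLalpha α f φ.toFun :=
  hf.memLalpha_of_bounded φ.aestronglyMeasurable_toFun fun _ =>
    norm_sum_le_of_le _ fun i _ => norm_indicator_le_norm_self (fun _ => φ.v i) _

lemma apply_toFun {E : Type*} [AddCommMonoid E] {F : (Fin T → ℂ) → E} (hF : F 0 = 0)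
    (φ : StepFun T) (θ : ℝ) : F (φ.toFun θ)
      = ∑ i, (Set.Ioc (φ.t i.castSucc) (φ.t i.succ)).indicator (fun _ => F (φ.v i)) θ := by
  by_cases hθ : ∃ i : Fin φ.n, θ ∈ Set.Ioc (φ.t i.castSucc) (φ.t i.succ)
  · obtain ⟨i, hi⟩ := hθ
    have hne {j : Fin φ.n} (hj : j ≠ i) : θ ∉ Set.Ioc (φ.t j.castSucc) (φ.t j.succ) := by
      intro hjmem
      rcases lt_or_gt_of_ne hj with hji | hij
      · exact (hjmem.2.trans (φ.mono (Fin.succ_le_castSucc_iff.mpr hji))).not_gt hi.1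
      · exact (hi.2.trans (φ.mono (Fin.succ_le_castSucc_iff.mpr hij))).not_gt hjmem.1
    rw [toFun, Fintype.sum_eq_single i fun j hj => Set.indicator_of_notMem (hne hj) _,
      Fintype.sum_eq_single i fun j hj => Set.indicator_of_notMem (hne hj) _,
      Set.indicator_of_mem hi, Set.indicator_of_mem hi]
  · push Not at hθ
    rw [toFun, Finset.sum_eq_zero fun j _ => Set.indicator_of_notMem (hθ j) _, hF,
      Finset.sum_eq_zero fun j _ => Set.indicator_of_notMem (hθ j) _]

lemma toReal_lalpha_toFun (hf : IsDensity α f) (φ : StepFun T) : (lalpha α f φ.toFun).toReal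
    = ∑ i : Fin φ.n, modular α (specMass f (φ.t i.castSucc) (φ.t i.succ)) (φ.v i) := by
  have hint (i : Fin φ.n) (k l : Fin T) :
      IntegrableOn (fun θ => f θ k l) (Set.Ioc (φ.t i.castSucc) (φ.t i.succ)) :=
    IntegrableOn.mono_set (hf.integrable k l) (Set.Ioc_subset_Ioc (φ.mem _).1 (φ.mem _).2)
  have hrestrict (i : Fin φ.n) : freq.restrict (Set.Ioc (φ.t i.castSucc) (φ.t i.succ))
      = volume.restrict (Set.Ioc (φ.t i.castSucc) (φ.t i.succ)) := by
    rw [Measure.restrict_restrict measurableSet_Ioc,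
      Set.inter_eq_left.mpr (Set.Ioc_subset_Ioc (φ.mem _).1 (φ.mem _).2)]
  rw [hf.toReal_lalpha φ.aestronglyMeasurable_toFun]
  calc ∫ θ, modular α (f θ) (φ.toFun θ) ∂freq
      = ∫ θ, ∑ i, (Set.Ioc (φ.t i.castSucc) (φ.t i.succ)).indicator
          (fun η => modular α (f η) (φ.v i)) θ ∂freq := by
        congr 1 with θ
        rw [apply_toFun (F := modular α (f θ))
          (by simp only [modular, form, zero_dotProduct, Complex.zero_re])]
        rfl
    _ = ∑ i, ∫ θ in Set.Ioc (φ.t i.castSucc) (φ.t i.succ), modular α (f θ) (φ.v i) := by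
        rw [integral_finsetSum]
        · simp only [integral_indicator measurableSet_Ioc, hrestrict]
        · intro i _
          rw [integrable_indicator_iff measurableSet_Ioc, IntegrableOn, hrestrict]
          exact (integrable_form α (hint i) _ _).re
    _ = _ := Finset.sum_congr rfl fun i _ => integral_modular α (hint i) _

lemma hasScale_integral [IsProbabilityMeasure P] (hf : IsDensity α f)
    (hZ : HasSpectralDensity α P Z f) (φ : StepFun T) :
    HasScale α P (φ.integral Z) (lalpha α f φ.toFun).toReal := by
  rw [φ.toReal_lalpha_toFun hf]
  refine HasScale.sum hf.pos (fun i => hZ.hasScale hf.one_lt (φ.mem _).1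
    (φ.t_castSucc_le_succ i) (φ.mem _).2 (φ.v i)) ?_
  refine (hZ.indep φ.n φ.t φ.mono φ.mem).comp (fun i w => φ.v i ⬝ᵥ w) fun i => ?_
  unfold dotProduct
  fun_prop

end Isometry

end StepFun

section StochasticIntegral

variable {Ω : Type*} [MeasurableSpace Ω] {T : ℕ} {α : ℝ} {P : Measure Ω}
  {Z : ℝ → Ω → Fin T → ℂ} {f : ℝ → Matrix (Fin T) (Fin T) ℂ} {g h : ℝ → Fin T → ℂ}
  {X Y : Ω → ℂ}

lemma tendstoInMeasure_add {E κ : Type*} [SeminormedAddCommGroup E] {l : Filter κ}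
    {X Y : κ → Ω → E} {X' Y' : Ω → E} (hX : TendstoInMeasure P X l X')
    (hY : TendstoInMeasure P Y l Y') :
    TendstoInMeasure P (fun n => X n + Y n) l (X' + Y') := by
  rw [tendstoInMeasure_iff_norm] at *
  intro ε hε
  have hsum := (hX (ε / 2) (half_pos hε)).add (hY (ε / 2) (half_pos hε))
  rw [add_zero] at hsum
  refine tendsto_of_tendsto_of_tendsto_of_le_of_le tendsto_const_nhds hsum (fun _ => zero_le)
    fun n => (measure_mono fun ω hω => ?_).trans (measure_union_le _ _)
  by_contra hsmall
  simp only [Set.mem_union, Set.mem_ofPred_eq, not_or, not_le, Pi.add_apply, add_sub_add_comm]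
    at hsmall hω
  linarith [hω.trans (norm_add_le _ _), hsmall.1, hsmall.2]

lemma tendstoInMeasure_const_smul {E κ 𝕜 : Type*} [NormedField 𝕜] [SeminormedAddCommGroup E]
    [NormedSpace 𝕜 E] {l : Filter κ} {X : κ → Ω → E} {X' : Ω → E} (hX : TendstoInMeasure P X l X')
    (a : 𝕜) : TendstoInMeasure P (fun n => a • X n) l (a • X') := by
  rw [tendstoInMeasure_iff_norm] at *
  intro ε hε
  refine tendsto_of_tendsto_of_tendsto_of_le_of_le tendsto_const_nhds
    (hX (ε / (‖a‖ + 1)) (by positivity)) (fun _ => zero_le) fun n => measure_mono fun ω hω => ?_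
  simp only [Set.mem_ofPred_eq, Pi.smul_apply, ← smul_sub, norm_smul] at hω ⊢
  rw [div_le_iff₀ (by positivity)]
  nlinarith [norm_nonneg (X n ω - X' ω)]

lemma StepFun.isStochIntegral (hf : IsDensity α f) (φ : StepFun T) :
    IsStochIntegral α P Z f φ.toFun (φ.integral Z) := by
  refine ⟨φ.memLalpha_toFun hf, fun _ => φ, ?_, ?_⟩
  · simp only [sub_self]
    exact lalpha_zero (f := f) ▸ tendsto_const_nhds
  · rw [tendstoInMeasure_iff_norm]
    intro ε hε
    simp only [sub_self, norm_zero, hε.not_ge, Set.ofPred_false, measure_empty, tendsto_const_nhds]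

lemma isStochIntegral_zero (hf : IsDensity α f) : IsStochIntegral α P Z f 0 0 :=
  StepFun.isStochIntegral hf ⟨0, fun _ => 0, monotone_const,
    fun _ => ⟨neg_nonpos.mpr Real.pi_pos.le, Real.pi_pos.le⟩, Fin.elim0⟩

namespace IsStochIntegral

lemma linear_comb (hX : IsStochIntegral α P Z f h X) (hY : IsStochIntegral α P Z f g Y)
    (hf : IsDensity α f) (a b : ℂ) :
    IsStochIntegral α P Z f (a • h + b • g) (a • X + b • Y) := by
  obtain ⟨hh, φ, hφ, hφX⟩ := hX
  obtain ⟨hg, ψ, hψ, hψY⟩ := hY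
  choose χ hχ hχZ using fun n => (φ n).exists_linear_comb (Ω := Ω) (ψ n) a b
  refine ⟨hf.memLalpha_add (hf.memLalpha_smul _ hh) (hf.memLalpha_smul _ hg), χ, ?_, ?_⟩
  · refine (hf.tendsto_lalpha_add_zero
      (fun n => (hh.1.sub (φ n).aestronglyMeasurable_toFun).const_smul a)
      (fun n => (hg.1.sub (ψ n).aestronglyMeasurable_toFun).const_smul b)
      (hf.tendsto_lalpha_smul_zero a hφ) (hf.tendsto_lalpha_smul_zero b hψ)).congr fun n => ?_
    congr 1
    ext θ k
    simp only [hχ, Pi.add_apply, Pi.sub_apply, Pi.smul_apply, smul_sub, add_sub_add_comm]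
  · exact (tendstoInMeasure_add (tendstoInMeasure_const_smul hφX a)
      (tendstoInMeasure_const_smul hψY b)).congr_left fun n => by
        rw [← hχZ]

lemma sub (hX : IsStochIntegral α P Z f h X) (hY : IsStochIntegral α P Z f g Y)
    (hf : IsDensity α f) : IsStochIntegral α P Z f (h - g) (X - Y) := by
  simpa only [one_smul, neg_smul, ← sub_eq_add_neg] using hX.linear_comb hY hf 1 (-1)

variable [IsProbabilityMeasure P]

lemma hasScale (hX : IsStochIntegral α P Z f h X) (hf : IsDensity α f)
    (hZ : HasSpectralDensity α P Z f) : HasScale α P X (lalpha α f h).toReal := by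
  obtain ⟨hh, φ, hφ, hφX⟩ := hX
  exact HasScale.of_tendstoInMeasure hf.pos (fun n => (φ n).hasScale_integral hf hZ)
    ((ENNReal.tendsto_toReal hh.2.ne).comp
      (hf.tendsto_lalpha (fun n => (φ n).aestronglyMeasurable_toFun) hh hφ)) hφX

lemma tendstoInMeasure_zero_iff {κ : Type*} {l : Filter κ} {p : κ → ℝ → Fin T → ℂ}
    {ζ : κ → Ω → ℂ} (hζ : ∀ n, IsStochIntegral α P Z f (p n) (ζ n)) (hf : IsDensity α f)
    (hZ : HasSpectralDensity α P Z f) : TendstoInMeasure P ζ l 0 ↔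
      Tendsto (fun n => lalpha α f (p n)) l (𝓝 0) := by
  rw [HasScale.tendstoInMeasure_zero_iff hf.pos fun n => (hζ n).hasScale hf hZ,
    ← ENNReal.toReal_zero,
    ENNReal.tendsto_toReal_iff (fun n => (hζ n).1.2.ne) ENNReal.zero_ne_top]

lemma of_tendsto {p : ℕ → ℝ → Fin T → ℂ} {ζ : ℕ → Ω → ℂ}
    (hζ : ∀ n, IsStochIntegral α P Z f (p n) (ζ n)) (hf : IsDensity α f)
    (hZ : HasSpectralDensity α P Z f) (hh : MemLalpha α f h)
    (hlim : Tendsto (fun n => lalpha α f (h - p n)) atTop (𝓝 0))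
    (hX : TendstoInMeasure P ζ atTop X) : IsStochIntegral α P Z f h X := by
  have hstep (n : ℕ) : ∃ φ : StepFun T, lalpha α f (p n - φ.toFun) ≤ (2⁻¹ : ℝ≥0∞) ^ n := by
    obtain ⟨-, φ, hφ, -⟩ := hζ n
    obtain ⟨m, hm⟩ := (hφ.eventually_le_const (ENNReal.pow_pos (a := 2⁻¹) (by simp) n)).exists
    exact ⟨φ m, hm⟩
  choose φ hφ using hstep
  have hpφ : Tendsto (fun n => lalpha α f (p n - (φ n).toFun)) atTop (𝓝 0) :=
    tendsto_of_tendsto_of_tendsto_of_le_of_le tendsto_const_nhds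
      (ENNReal.tendsto_pow_atTop_nhds_zero_of_lt_one (by norm_num)) (fun _ => zero_le) hφ
  have hφp : Tendsto (fun n => lalpha α f ((φ n).toFun - p n)) atTop (𝓝 0) := by
    simpa only [hf.lalpha_sub_comm] using hpφ
  refine ⟨hh, φ, ?_, ?_⟩
  · refine (hf.tendsto_lalpha_add_zero (fun n => hh.1.sub (hζ n).1.1)
      (fun n => (hζ n).1.1.sub (φ n).aestronglyMeasurable_toFun) hlim hpφ).congr fun n => ?_
    rw [sub_add_sub_cancel]
    rfl
  · have hdiff := (tendstoInMeasure_zero_iff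
      (fun n => (StepFun.isStochIntegral hf (φ n)).sub (hζ n) hf) hf hZ).mpr hφp
    simpa only [sub_add_cancel, zero_add] using tendstoInMeasure_add hdiff hX

end IsStochIntegral

end StochasticIntegral

section Exponentials

lemma ex_eq_exp_ofReal_mul_I (n : ℤ) (θ : ℝ) :
    ex n θ = Complex.exp (((n * θ : ℝ) : ℂ) * Complex.I) := by
  rw [ex, Complex.ofReal_mul, Complex.ofReal_intCast, mul_comm, mul_rotate, mul_assoc]

lemma norm_ex (n : ℤ) (θ : ℝ) : ‖ex n θ‖ = 1 := by
  rw [ex_eq_exp_ofReal_mul_I, Complex.norm_exp_ofReal_mul_I]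

lemma continuous_ex (n : ℤ) : Continuous (ex n) := by
  unfold ex
  fun_prop

lemma ex_add (m n : ℤ) (θ : ℝ) : ex (m + n) θ = ex m θ * ex n θ := by
  rw [ex, ex, ex, ← Complex.exp_add, Int.cast_add, mul_add, add_mul]

lemma ex_zero (θ : ℝ) : ex 0 θ = 1 := by
  simp only [ex, Int.cast_zero, mul_zero, zero_mul, Complex.exp_zero]

lemma integral_ex (n : ℤ) : ∫ θ, ex n θ ∂freq = if n = 0 then 2 * Real.pi else 0 := by
  rw [← intervalIntegral.integral_of_le (neg_le_self Real.pi_pos.le)]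
  split_ifs with hn
  · simp only [hn, ex_zero, intervalIntegral.integral_const, Complex.real_smul, mul_one]
    push_cast
    ring
  · have hcoeff : Complex.I * (n : ℂ) ≠ 0 :=
      mul_ne_zero Complex.I_ne_zero (Int.cast_ne_zero.mpr hn)
    unfold ex
    rw [integral_exp_mul_complex hcoeff, Complex.ofReal_zero, div_eq_zero_iff, sub_eq_zero,
      Complex.exp_eq_exp_iff_exists_int]
    exact Or.inl ⟨n, by push_cast; ring⟩

lemma integral_ex_mul_ex (m n : ℤ) :
    ∫ θ, ex m θ * ex n θ ∂freq = if m + n = 0 then 2 * Real.pi else 0 := by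
  simp only [← ex_add, integral_ex]

lemma integrable_ex_mul {g : ℝ → ℂ} (hg : Integrable g freq) (n : ℤ) :
    Integrable (fun θ => ex n θ * g θ) freq :=
  hg.bdd_mul (c := 1) (continuous_ex n).aestronglyMeasurable
    (Eventually.of_forall fun θ => (norm_ex n θ).le)

lemma integrable_ex (n : ℤ) : Integrable (ex n) freq := by
  simpa only [mul_one] using integrable_ex_mul (integrable_const (1 : ℂ)) n

lemma enorm_integral_ex_mul_le (n : ℤ) (g : ℝ → ℂ) :
    ‖∫ θ, ex n θ * g θ ∂freq‖ₑ ≤ ∫⁻ θ, ‖g θ‖ₑ ∂freq := by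
  refine (enorm_integral_le_lintegral_enorm _).trans_eq (lintegral_congr fun θ => ?_)
  rw [enorm_mul, ← ofReal_norm (ex n θ), norm_ex, ENNReal.ofReal_one, one_mul]

end Exponentials

section FourierUniqueness

lemma exists_clm_eq_integral_comp_mul {S X : Type*} [MeasurableSpace S] [TopologicalSpace X]
    [CompactSpace X] [MeasurableSpace X] [OpensMeasurableSpace X] {μ : Measure S} {φ : S → X}
    (hφ : Measurable φ) {g : S → ℂ} (hg : Integrable g μ) :
    ∃ L : C(X, ℂ) →L[ℂ] ℂ, ∀ F, L F = ∫ θ, F (φ θ) * g θ ∂μ := by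
  have hint (F : C(X, ℂ)) : Integrable (fun θ => F (φ θ) * g θ) μ :=
    hg.bdd_mul (c := ‖F‖) (F.continuous.measurable.comp hφ).aestronglyMeasurable
      (Eventually.of_forall fun θ => F.norm_coe_le_norm _)
  let L : C(X, ℂ) →ₗ[ℂ] ℂ :=
    { toFun F := ∫ θ, F (φ θ) * g θ ∂μ
      map_add' F G := by
        rw [← integral_add (hint F) (hint G)]
        simp only [ContinuousMap.add_apply, add_mul]
      map_smul' c F := by
        simp only [ContinuousMap.smul_apply, smul_eq_mul, RingHom.id_apply, mul_assoc,
          integral_const_mul] }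
  refine ⟨L.mkContinuous (∫ θ, ‖g θ‖ ∂μ) fun F => ?_, fun F => rfl⟩
  rw [mul_comm, ← integral_const_mul]
  refine norm_integral_le_of_norm_le (hg.norm.const_mul ‖F‖) (Eventually.of_forall fun θ => ?_)
  rw [norm_mul]
  exact mul_le_mul_of_nonneg_right (F.norm_coe_le_norm _) (norm_nonneg _)

variable {g : ℝ → ℂ}

lemma integral_continuousMap_mul_eq_zero (hg : Integrable g freq)
    (h : ∀ n : ℤ, ∫ θ, ex n θ * g θ ∂freq = 0) (F : C(AddCircle (2 * Real.pi), ℂ)) :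
    ∫ θ, F (θ : AddCircle (2 * Real.pi)) * g θ ∂freq = 0 := by
  have : Fact (0 < 2 * Real.pi) := ⟨Real.two_pi_pos⟩
  obtain ⟨L, hL⟩ := exists_clm_eq_integral_comp_mul
    (AddCircle.measurable_mk' (a := 2 * Real.pi)) hg
  have hfourier (n : ℤ) (θ : ℝ) : fourier n (θ : AddCircle (2 * Real.pi)) = ex n θ := by
    rw [fourier_coe_apply, ex]
    congr 1
    push_cast
    field_simp
  have hker : (Submodule.span ℂ (Set.range (@fourier (2 * Real.pi)))).topologicalClosure
      ≤ LinearMap.ker L.toLinearMap := by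
    refine Submodule.topologicalClosure_minimal _ (Submodule.span_le.mpr ?_) L.isClosed_ker
    rintro _ ⟨n, rfl⟩
    rw [SetLike.mem_coe, LinearMap.mem_ker, ContinuousLinearMap.coe_coe, hL]
    exact (integral_congr_ae (Eventually.of_forall fun θ => by
      simp only [← hfourier])).trans (h n)
  rw [span_fourier_closure_eq_top] at hker
  exact (hL F).symm.trans (hker (Submodule.mem_top (x := F)))

lemma ae_eq_zero_of_integral_ex_mul_eq_zero (hg : Integrable g freq)
    (h : ∀ n : ℤ, ∫ θ, ex n θ * g θ ∂freq = 0) : g =ᵐ[freq] 0 := by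
  have : Fact (0 < 2 * Real.pi) := ⟨Real.two_pi_pos⟩
  have hperiod : -Real.pi + 2 * Real.pi = Real.pi := by ring
  have hIoo : ∀ᵐ θ, θ ∈ Set.Ioo (-Real.pi) Real.pi → g θ = 0 := by
    refine isOpen_Ioo.ae_eq_zero_of_integral_contDiff_smul_eq_zero
      (IntegrableOn.mono_set hg Set.Ioo_subset_Ioc_self).locallyIntegrableOn
      fun φ hφ _ hsupp => ?_
    have hout {θ : ℝ} (hθ : θ ∉ Set.Ioo (-Real.pi) Real.pi) : φ θ = 0 :=
      image_eq_zero_of_notMem_tsupport fun hmem => hθ (hsupp hmem)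
    have hends : (φ (-Real.pi) : ℂ) = φ (-Real.pi + 2 * Real.pi) := by
      rw [hperiod, hout (Set.left_notMem_Ioo), hout (Set.right_notMem_Ioo)]
    let F : C(AddCircle (2 * Real.pi), ℂ) :=
      ⟨AddCircle.liftIoc (2 * Real.pi) (-Real.pi) (fun θ => (φ θ : ℂ)),
        AddCircle.liftIoc_continuous hends
          (Complex.continuous_ofReal.comp hφ.continuous).continuousOn⟩
    rw [← setIntegral_eq_integral_of_forall_compl_eq_zero (s := Set.Ioc (-Real.pi) Real.pi)
      fun θ hθ => by rw [hout fun hmem => hθ (Set.Ioo_subset_Ioc_self hmem), zero_smul],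
      ← integral_continuousMap_mul_eq_zero hg h F]
    refine setIntegral_congr_fun measurableSet_Ioc fun θ hθ => ?_
    have hθ' : θ ∈ Set.Ioc (-Real.pi) (-Real.pi + 2 * Real.pi) := hperiod.symm ▸ hθ
    simp only [F, ContinuousMap.coe_mk, AddCircle.liftIoc_coe_apply hθ', Complex.real_smul]
  rw [Filter.EventuallyEq, ae_restrict_iff' measurableSet_Ioc]
  filter_upwards [hIoo, Measure.ae_ne volume Real.pi] with θ hθ hne hmem
  exact hθ ⟨hmem.1, hmem.2.lt_of_ne hne⟩

end FourierUniqueness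

section TrigonometricPolynomials

lemma two_pi_ne_zero : 2 * (Real.pi : ℂ) ≠ 0 :=
  mul_ne_zero two_ne_zero (Complex.ofReal_ne_zero.mpr Real.pi_ne_zero)

variable {T N : ℕ} {α : ℝ} {f : ℝ → Matrix (Fin T) (Fin T) ℂ} {p h : ℝ → Fin T → ℂ}
  (c : Fin (N + 1) → Fin T → ℂ)

/-- The span of the functions `e^{ijθ} δ_k`, `j ∉ {0, …, N}`, whose closure in `L^α(f)` is
`MemLN`. -/
def expSpan (T N : ℕ) : Submodule ℂ (ℝ → Fin T → ℂ) :=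
  Submodule.span ℂ {q : ℝ → Fin T → ℂ | ∃ j : ℤ, ∃ k : Fin T,
    j ∉ Set.Ico 0 ((N : ℤ) + 1) ∧ q = fun θ => Pi.single k (ex j θ)}

lemma continuous_and_bounded_of_mem_expSpan (hp : p ∈ expSpan T N) :
    Continuous p ∧ ∃ C, ∀ θ, ‖p θ‖ ≤ C := by
  induction hp using Submodule.span_induction with
  | mem p hp =>
    obtain ⟨j, k, -, rfl⟩ := hp
    refine ⟨(continuous_single k).comp (continuous_ex j), 1, fun θ => ?_⟩
    rw [Pi.norm_single, norm_ex]
  | zero => exact ⟨continuous_const, 0, fun _ => norm_zero.le⟩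
  | add p q _ _ hp hq =>
    obtain ⟨hp, C, hC⟩ := hp
    obtain ⟨hq, D, hD⟩ := hq
    exact ⟨hp.add hq, C + D, fun θ => norm_add_le_of_le (hC θ) (hD θ)⟩
  | smul a p _ hp =>
    obtain ⟨hp, C, hC⟩ := hp
    refine ⟨hp.const_smul a, ‖a‖ * C, fun θ => ?_⟩
    rw [Pi.smul_apply, norm_smul]
    exact mul_le_mul_of_nonneg_left (hC θ) (norm_nonneg _)

lemma IsDensity.memLalpha_of_mem_expSpan (hf : IsDensity α f) (hp : p ∈ expSpan T N) :
    MemLalpha α f p := by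
  obtain ⟨hcont, C, hC⟩ := continuous_and_bounded_of_mem_expSpan hp
  exact hf.memLalpha_of_bounded hcont.aestronglyMeasurable hC

lemma integrable_of_mem_expSpan (hp : p ∈ expSpan T N) (l : Fin T) :
    Integrable (fun θ => p θ l) freq := by
  obtain ⟨hcont, C, hC⟩ := continuous_and_bounded_of_mem_expSpan hp
  exact Integrable.of_bound ((continuous_apply l).comp hcont).aestronglyMeasurable C
    (Eventually.of_forall fun θ => (norm_le_pi_norm _ l).trans (hC θ))

lemma integral_ex_neg_mul_of_mem_expSpan (hp : p ∈ expSpan T N) (k : Fin (N + 1)) (l : Fin T) :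
    ∫ θ, ex (-((k : ℕ) : ℤ)) θ * p θ l ∂freq = 0 := by
  induction hp using Submodule.span_induction with
  | mem p hp =>
    obtain ⟨j, m, hj, rfl⟩ := hp
    obtain rfl | hlm := eq_or_ne l m
    · have hne : -((k : ℕ) : ℤ) + j ≠ 0 := fun h0 => hj ⟨by omega, by have := k.2; omega⟩
      simp only [Pi.single_eq_same, integral_ex_mul_ex, if_neg hne, Complex.ofReal_zero]
    · simp only [Pi.single_eq_of_ne hlm, mul_zero, integral_zero]
  | zero => simp only [Pi.zero_apply, mul_zero, integral_zero]
  | add p q hp hq hp0 hq0 =>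
    simp only [Pi.add_apply, mul_add]
    rw [integral_add (integrable_ex_mul (integrable_of_mem_expSpan hp l) _)
      (integrable_ex_mul (integrable_of_mem_expSpan hq l) _), hp0, hq0, add_zero]
  | smul a p _ hp0 =>
    simp only [Pi.smul_apply, smul_eq_mul, mul_left_comm _ a]
    rw [integral_const_mul, hp0, mul_zero]

lemma memLN_of_tendsto (hh : MemLalpha α f h) {q : ℕ → ℝ → Fin T → ℂ}
    (hq : ∀ n, q n ∈ expSpan T N) (hlim : Tendsto (fun n => lalpha α f (h - q n)) atTop (𝓝 0)) :
    MemLN α N f h := by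
  refine ⟨hh, fun ε hε => ?_⟩
  obtain ⟨n, hn⟩ := (hlim.eventually_lt_const hε).exists
  exact ⟨q n, hq n, hn⟩

lemma MemLN.exists_seq_tendsto (hh : MemLN α N f h) : ∃ q : ℕ → ℝ → Fin T → ℂ,
    (∀ n, q n ∈ expSpan T N) ∧ Tendsto (fun n => lalpha α f (h - q n)) atTop (𝓝 0) := by
  choose q hq hqh using fun n : ℕ => hh.2 ((2 : ℝ≥0∞)⁻¹ ^ n) (ENNReal.pow_pos (by simp) n)
  exact ⟨q, hq, tendsto_of_tendsto_of_tendsto_of_le_of_le tendsto_const_nhds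
    (ENNReal.tendsto_pow_atTop_nhds_zero_of_lt_one (by norm_num)) (fun _ => zero_le)
    fun n => (hqh n).le⟩

lemma MemLN.integral_ex_neg_mul (hh : MemLN α N f h) (hf : IsDensity α f) (k : Fin (N + 1))
    (l : Fin T) : ∫ θ, ex (-((k : ℕ) : ℤ)) θ * h θ l ∂freq = 0 := by
  obtain ⟨p, hp, hlim⟩ := hh.exists_seq_tendsto
  have hL1 := hf.tendsto_lintegral_enorm_apply
    (fun n => hh.1.1.sub (hf.memLalpha_of_mem_expSpan (hp n)).1) hlim l
  rw [← enorm_eq_zero, ← nonpos_iff_eq_zero]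
  refine ge_of_tendsto hL1 (Eventually.of_forall fun n => ?_)
  refine le_trans (le_of_eq ?_) (enorm_integral_ex_mul_le (-((k : ℕ) : ℤ)) fun θ => (h - p n) θ l)
  simp only [Pi.sub_apply, mul_sub]
  rw [integral_sub (integrable_ex_mul (hf.integrable_apply hh.1 l) _)
    (integrable_ex_mul (integrable_of_mem_expSpan (hp n) l) _),
    integral_ex_neg_mul_of_mem_expSpan (hp n), sub_zero]

lemma polyC_apply (θ : ℝ) (l : Fin T) :
    polyC c θ l = ∑ j : Fin (N + 1), ex (-((j : ℕ) : ℤ)) θ * c j l := by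
  simp only [polyC, Finset.sum_apply, Pi.smul_apply, smul_eq_mul]

lemma integrable_polyC_apply (l : Fin T) : Integrable (fun θ => polyC c θ l) freq := by
  simp only [polyC_apply]
  exact integrable_finsetSum _ fun j _ => (integrable_ex _).mul_const _

lemma integral_ex_mul_polyC (m : ℤ) (l : Fin T) : ∫ θ, ex m θ * polyC c θ l ∂freq
    = ∑ j : Fin (N + 1), (if m = ((j : ℕ) : ℤ) then 2 * Real.pi else 0) * c j l := by
  simp only [polyC_apply, Finset.mul_sum, ← mul_assoc]
  rw [integral_finsetSum _ fun j _ => (integrable_ex_mul (integrable_ex _) _).mul_const _]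
  simp only [integral_mul_const, integral_ex_mul_ex, add_neg_eq_zero]

lemma integral_ex_mul_polyC_self (k : Fin (N + 1)) (l : Fin T) :
    ∫ θ, ex ((k : ℕ) : ℤ) θ * polyC c θ l ∂freq = 2 * Real.pi * c k l := by
  rw [integral_ex_mul_polyC, Fintype.sum_eq_single k]
  · rw [if_pos rfl, Complex.ofReal_mul, Complex.ofReal_ofNat]
  · intro j hj
    rw [if_neg fun h => hj (Fin.ext (Int.ofNat_inj.mp h).symm), Complex.ofReal_zero, zero_mul]

lemma integral_ex_mul_polyC_of_notMem {m : ℤ} (hm : m ∉ Set.Ico 0 ((N : ℤ) + 1)) (l : Fin T) :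
    ∫ θ, ex m θ * polyC c θ l ∂freq = 0 := by
  rw [integral_ex_mul_polyC]
  refine Finset.sum_eq_zero fun j _ => ?_
  rw [if_neg fun h => hm ⟨by omega, by have := j.2; omega⟩, Complex.ofReal_zero, zero_mul]

lemma polyC_injective {c d : Fin (N + 1) → Fin T → ℂ} (h : polyC c =ᵐ[freq] polyC d) : c = d := by
  ext k l
  have hcoeff : 2 * (Real.pi : ℂ) * c k l = 2 * Real.pi * d k l := by
    rw [← integral_ex_mul_polyC_self, ← integral_ex_mul_polyC_self]
    refine integral_congr_ae ?_
    filter_upwards [h] with θ hθ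
    rw [hθ]
  exact mul_left_cancel₀ two_pi_ne_zero hcoeff

lemma exists_ae_eq_polyC {G : ℝ → Fin T → ℂ} (hG : ∀ l, Integrable (fun θ => G θ l) freq)
    (h : ∀ m : ℤ, m ∉ Set.Ico 0 ((N : ℤ) + 1) → ∀ l, ∫ θ, ex m θ * G θ l ∂freq = 0) :
    ∃ c : Fin (N + 1) → Fin T → ℂ, G =ᵐ[freq] polyC c := by
  let c : Fin (N + 1) → Fin T → ℂ := fun j l =>
    (2 * Real.pi : ℂ)⁻¹ * ∫ θ, ex ((j : ℕ) : ℤ) θ * G θ l ∂freq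
  have hcoeff (m : ℤ) (l : Fin T) :
      ∫ θ, ex m θ * G θ l ∂freq = ∫ θ, ex m θ * polyC c θ l ∂freq := by
    by_cases hm : m ∈ Set.Ico 0 ((N : ℤ) + 1)
    · lift m to ℕ using hm.1
      have hmN : m < N + 1 := by exact_mod_cast hm.2
      rw [integral_ex_mul_polyC_self c ⟨m, hmN⟩,
        mul_inv_cancel_left₀ two_pi_ne_zero]
    · rw [h m hm l, integral_ex_mul_polyC_of_notMem c hm]
  have hzero (l : Fin T) : (fun θ => G θ l - polyC c θ l) =ᵐ[freq] 0 := by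
    refine ae_eq_zero_of_integral_ex_mul_eq_zero ((hG l).sub (integrable_polyC_apply c l))
      fun m => ?_
    simp only [mul_sub]
    rw [integral_sub (integrable_ex_mul (hG l) m)
      (integrable_ex_mul (integrable_polyC_apply c l) m), hcoeff, sub_self]
  refine ⟨c, ?_⟩
  filter_upwards [ae_all_iff.mpr hzero] with θ hθ
  exact funext fun l => sub_eq_zero.mp (hθ l)

end TrigonometricPolynomials

section Completeness

variable {T : ℕ} {α : ℝ} {f : ℝ → Matrix (Fin T) (Fin T) ℂ}

namespace IsDensity

lemma tendstoInMeasure_of_tendsto_lalpha (hf : IsDensity α f) {κ : Type*} {i : Filter κ}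
    {u : κ → ℝ → Fin T → ℂ} (hu : ∀ n, AEStronglyMeasurable (u n) freq)
    (hu0 : Tendsto (fun n => lalpha α f (u n)) i (𝓝 0)) : TendstoInMeasure freq u i 0 := by
  refine tendstoInMeasure_of_tendsto_eLpNorm one_ne_zero hu aestronglyMeasurable_zero ?_
  have hsum : Tendsto (fun n => ∑ l, ∫⁻ θ, ‖u n θ l‖ₑ ∂freq) i (𝓝 0) := by
    simpa only [Finset.sum_const_zero] using
      tendsto_finsetSum Finset.univ fun l _ => hf.tendsto_lintegral_enorm_apply hu hu0 l
  refine tendsto_of_tendsto_of_tendsto_of_le_of_le tendsto_const_nhds hsum (fun _ => zero_le)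
    fun n => ?_
  simp only [sub_zero]
  rw [eLpNorm_one_eq_lintegral_enorm, ← lintegral_finsetSum' _ fun l _ =>
    ((continuous_apply l).comp_aestronglyMeasurable (hu n)).enorm]
  refine lintegral_mono fun θ => ?_
  simp only [← ofReal_norm, ← ENNReal.ofReal_sum_of_nonneg fun l _ => norm_nonneg (u n θ l)]
  exact ENNReal.ofReal_le_ofReal ((pi_norm_le_iff_of_nonneg
    (Finset.sum_nonneg fun l _ => norm_nonneg _)).mpr fun l =>
      Finset.single_le_sum (f := fun l => ‖u n θ l‖) (fun l _ => norm_nonneg _) (Finset.mem_univ l))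

variable {p : ℕ → ℝ → Fin T → ℂ}

lemma exists_subseq_ae_tendsto (hf : IsDensity α f) (hp : ∀ n, AEStronglyMeasurable (p n) freq)
    (hC : Tendsto (fun i : ℕ × ℕ => lalpha α f (p i.1 - p i.2)) atTop (𝓝 0)) :
    ∃ (ns : ℕ → ℕ) (h : ℝ → Fin T → ℂ), StrictMono ns ∧ AEStronglyMeasurable h freq ∧
      ∀ᵐ θ ∂freq, Tendsto (fun k => p (ns k) θ) atTop (𝓝 (h θ)) := by
  obtain ⟨ns, h, hns, hlim⟩ := exists_subseq_tendstoInMeasure hp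
    (hf.tendstoInMeasure_of_tendsto_lalpha (fun i => (hp i.1).sub (hp i.2)) hC)
  obtain ⟨ms, hms, hae⟩ := hlim.exists_seq_tendsto_ae
  exact ⟨ns ∘ ms, h, hns.comp hms,
    aestronglyMeasurable_of_tendsto_ae atTop (fun k => hp (ns (ms k))) hae, hae⟩

lemma exists_tendsto_lalpha_of_cauchy (hf : IsDensity α f) (hp : ∀ n, MemLalpha α f (p n))
    (hC : Tendsto (fun i : ℕ × ℕ => lalpha α f (p i.1 - p i.2)) atTop (𝓝 0)) :
    ∃ h, MemLalpha α f h ∧ Tendsto (fun n => lalpha α f (h - p n)) atTop (𝓝 0) := by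
  obtain ⟨ns, h, hns, hh, hae⟩ := hf.exists_subseq_ae_tendsto (fun n => (hp n).1) hC
  have hfatou (n : ℕ) : lalpha α f (h - p n)
      ≤ liminf (fun k => lalpha α f (p (ns k) - p n)) atTop := by
    refine le_trans (lintegral_mono_ae ?_) (lintegral_liminf_le' fun k =>
      (hf.aemeasurable_modular ((hp (ns k)).1.sub (hp n).1)).ennreal_ofReal)
    filter_upwards [hae] with θ hθ
    have hcont := ENNReal.continuous_ofReal.comp (continuous_modular hf.one_lt (f θ))
    exact ((hcont.tendsto _).comp (hθ.sub tendsto_const_nhds)).liminf_eq.ge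
  have hlim : Tendsto (fun n => lalpha α f (h - p n)) atTop (𝓝 0) := by
    refine ENNReal.tendsto_nhds_zero.mpr fun ε hε => ?_
    obtain ⟨n₀, hn₀⟩ := eventually_atTop_prod_self'.mp (ENNReal.tendsto_nhds_zero.mp hC ε hε)
    filter_upwards [eventually_ge_atTop n₀] with n hn
    refine (hfatou n).trans (liminf_le_of_frequently_le' (Eventually.frequently ?_))
    filter_upwards [eventually_ge_atTop n₀] with k hk
    exact hn₀ _ (hk.trans (hns.id_le k)) _ hn
  refine ⟨h, ?_, hlim⟩
  obtain ⟨n, hn⟩ := (hlim.eventually_lt_const ENNReal.zero_lt_top).exists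
  simpa only [sub_add_cancel] using hf.memLalpha_add ⟨hh.sub (hp n).1, hn⟩ (hp n)

end IsDensity

end Completeness

section BestApproximation

variable {T N : ℕ} {α : ℝ} {f : ℝ → Matrix (Fin T) (Fin T) ℂ}
  {K : Set (ℝ → Fin T → ℂ)} {A g h u v : ℝ → Fin T → ℂ}

namespace IsDensity

lemma tendsto_lalpha_sub_zero (hf : IsDensity α f) {κ : Type*} {i : Filter κ} {d : ℝ}
    {u v : κ → ℝ → Fin T → ℂ} (hu : ∀ n, MemLalpha α f (u n)) (hv : ∀ n, MemLalpha α f (v n))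
    (hud : Tendsto (fun n => (lalpha α f (u n)).toReal) i (𝓝 d))
    (hvd : Tendsto (fun n => (lalpha α f (v n)).toReal) i (𝓝 d))
    (hmid : ∀ n, d ≤ (lalpha α f ((1 / 2 : ℂ) • (u n + v n))).toReal) :
    Tendsto (fun n => lalpha α f (u n - v n)) i (𝓝 0) := by
  have hsub n := hf.memLalpha_sub (hu n) (hv n)
  have hbound {δ : ℝ} (hδ : 0 < δ) : ∃ C : ℝ, ∀ n, (lalpha α f (u n - v n)).toReal ≤
      (C / 2 + δ) * ((lalpha α f (u n)).toReal + (lalpha α f (v n)).toReal) - C * d := by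
    obtain ⟨C, hC, hmod⟩ := exists_modular_sub_le (ι := Fin T) hf.one_lt hδ
    refine ⟨C, fun n => le_sub_iff_add_le.mpr
      ((add_le_add_right (mul_le_mul_of_nonneg_left (hmid n) hC) _).trans ?_)⟩
    have hmidint := (hf.integrable_modular (hf.memLalpha_smul (1 / 2)
      (hf.memLalpha_add (hu n) (hv n)))).const_mul C
    have huint := hf.integrable_modular (hu n)
    have hvint := hf.integrable_modular (hv n)
    have hsubint := hf.integrable_modular (hsub n)
    rw [hf.toReal_lalpha (hu n).1, hf.toReal_lalpha (hv n).1, hf.toReal_lalpha (hsub n).1,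
      hf.toReal_lalpha (((hu n).1.add (hv n).1).const_smul _), ← integral_const_mul,
      ← integral_add hsubint hmidint, ← integral_add huint hvint, ← integral_const_mul]
    refine integral_mono_ae (hsubint.add hmidint) ((huint.add hvint).const_mul _) ?_
    filter_upwards [hf.alphaForm] with θ hθ using hmod _ hθ _ _
  rw [← ENNReal.tendsto_toReal_iff (fun n => (hsub n).2.ne) ENNReal.zero_ne_top,
    ENNReal.toReal_zero]
  refine tendsto_order.mpr ⟨fun a ha => Eventually.of_forall fun n =>
    ha.trans_le ENNReal.toReal_nonneg, fun ε hε => ?_⟩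
  obtain ⟨δ, hδ, hδε⟩ := exists_pos_mul_lt hε (2 * d)
  obtain ⟨C, hC⟩ := hbound hδ
  have hlim := ((hud.add hvd).const_mul (C / 2 + δ)).sub_const (C * d)
  have hlt : (C / 2 + δ) * (d + d) - C * d < ε := by linear_combination hδε
  filter_upwards [hlim.eventually_lt_const hlt] with n hn
  exact (hC n).trans_lt hn

lemma exists_isMinOn_lalpha (hf : IsDensity α f) (hK : ∀ u ∈ K, MemLalpha α f u)
    (hne : K.Nonempty) (hmid : ∀ u ∈ K, ∀ v ∈ K, (1 / 2 : ℂ) • (u + v) ∈ K)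
    (hclosed : ∀ (p : ℕ → ℝ → Fin T → ℂ) (h : ℝ → Fin T → ℂ), (∀ n, p n ∈ K) →
      MemLalpha α f h → Tendsto (fun n => lalpha α f (h - p n)) atTop (𝓝 0) → h ∈ K) :
    ∃ h ∈ K, IsMinOn (lalpha α f) K h := by
  let S : Set ℝ := (fun u => (lalpha α f u).toReal) '' K
  have hbdd : BddBelow S := ⟨0, by rintro _ ⟨u, -, rfl⟩; exact ENNReal.toReal_nonneg⟩
  have hle {u : ℝ → Fin T → ℂ} (hu : u ∈ K) : sInf S ≤ (lalpha α f u).toReal :=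
    csInf_le hbdd ⟨u, hu, rfl⟩
  obtain ⟨s, -, hs, hsS⟩ := exists_seq_tendsto_sInf (hne.image _) hbdd
  choose p hp hps using hsS
  have hpd : Tendsto (fun n => (lalpha α f (p n)).toReal) atTop (𝓝 (sInf S)) := by
    simpa only [hps] using hs
  have hfst : Tendsto Prod.fst (atTop : Filter (ℕ × ℕ)) atTop :=
    prod_atTop_atTop_eq (α := ℕ) (β := ℕ) ▸ tendsto_fst
  have hsnd : Tendsto Prod.snd (atTop : Filter (ℕ × ℕ)) atTop :=
    prod_atTop_atTop_eq (α := ℕ) (β := ℕ) ▸ tendsto_snd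
  obtain ⟨h, hh, hlim⟩ := hf.exists_tendsto_lalpha_of_cauchy (fun n => hK _ (hp n))
    (hf.tendsto_lalpha_sub_zero (fun i : ℕ × ℕ => hK _ (hp i.1)) (fun i => hK _ (hp i.2))
      (hpd.comp hfst) (hpd.comp hsnd) fun i => hle (hmid _ (hp i.1) _ (hp i.2)))
  have hhd : (lalpha α f h).toReal = sInf S := tendsto_nhds_unique
    ((ENNReal.tendsto_toReal hh.2.ne).comp
      (hf.tendsto_lalpha (fun n => (hK _ (hp n)).1) hh hlim)) hpd
  exact ⟨h, hclosed p h hp hh hlim, fun u hu =>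
    (ENNReal.toReal_le_toReal hh.2.ne (hK u hu).2.ne).mp (hhd.trans_le (hle hu))⟩

lemma lalpha_sub_eq_zero_of_isMinOn (hf : IsDensity α f) (hK : ∀ u ∈ K, MemLalpha α f u)
    (hmid : ∀ u ∈ K, ∀ v ∈ K, (1 / 2 : ℂ) • (u + v) ∈ K) (hu : u ∈ K) (hv : v ∈ K)
    (hmin : IsMinOn (lalpha α f) K u) (hvu : lalpha α f v ≤ lalpha α f u) :
    lalpha α f (u - v) = 0 := by
  have heq : lalpha α f v = lalpha α f u := hvu.antisymm (hmin hv)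
  have hw := hmid u hu v hv
  refine tendsto_const_nhds_iff.mp (hf.tendsto_lalpha_sub_zero (i := (atTop : Filter ℕ))
    (fun _ => hK u hu) (fun _ => hK v hv) tendsto_const_nhds (heq ▸ tendsto_const_nhds)
    fun _ => ENNReal.toReal_mono (hK _ hw).2.ne (hmin hw))

lemma memLN_of_mem_expSpan (hf : IsDensity α f) (hp : h ∈ expSpan T N) : MemLN α N f h :=
  memLN_of_tendsto (hf.memLalpha_of_mem_expSpan hp) (fun _ => hp) (by
    simp only [sub_self, lalpha_zero, tendsto_const_nhds_iff])

lemma memLN_linear_comb (hf : IsDensity α f) (hg : MemLN α N f g) (hh : MemLN α N f h) (a b : ℂ) :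
    MemLN α N f (a • g + b • h) := by
  obtain ⟨p, hp, hpg⟩ := hg.exists_seq_tendsto
  obtain ⟨q, hq, hqh⟩ := hh.exists_seq_tendsto
  refine memLN_of_tendsto (hf.memLalpha_add (hf.memLalpha_smul _ hg.1) (hf.memLalpha_smul _ hh.1))
    (fun n => Submodule.add_mem _ (Submodule.smul_mem _ a (hp n)) (Submodule.smul_mem _ b (hq n)))
    ((hf.tendsto_lalpha_add_zero
      (fun n => (hg.1.1.sub (hf.memLalpha_of_mem_expSpan (hp n)).1).const_smul a)
      (fun n => (hh.1.1.sub (hf.memLalpha_of_mem_expSpan (hq n)).1).const_smul b)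
      (hf.tendsto_lalpha_smul_zero a hpg) (hf.tendsto_lalpha_smul_zero b hqh)).congr fun n => ?_)
  rw [smul_sub, smul_sub, add_sub_add_comm]

lemma memLN_of_tendsto_memLN (hf : IsDensity α f) {q : ℕ → ℝ → Fin T → ℂ}
    (hq : ∀ n, MemLN α N f (q n)) (hh : MemLalpha α f h)
    (hlim : Tendsto (fun n => lalpha α f (h - q n)) atTop (𝓝 0)) : MemLN α N f h := by
  choose p hp hpq using fun n : ℕ => (hq n).2 ((2 : ℝ≥0∞)⁻¹ ^ n) (ENNReal.pow_pos (by simp) n)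
  have hqp : Tendsto (fun n => lalpha α f (q n - p n)) atTop (𝓝 0) :=
    tendsto_of_tendsto_of_tendsto_of_le_of_le tendsto_const_nhds
      (ENNReal.tendsto_pow_atTop_nhds_zero_of_lt_one (by norm_num)) (fun _ => zero_le)
      fun n => (hpq n).le
  refine memLN_of_tendsto hh hp ((hf.tendsto_lalpha_add_zero (fun n => hh.1.sub (hq n).1.1)
    (fun n => (hq n).1.1.sub (hf.memLalpha_of_mem_expSpan (hp n)).1) hlim hqp).congr fun n => ?_)
  rw [sub_add_sub_cancel]

lemma memLN_sub_half_smul_add (hf : IsDensity α f) (hu : MemLN α N f (A - u))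
    (hv : MemLN α N f (A - v)) :
    MemLN α N f (A - (1 / 2 : ℂ) • (u + v)) := by
  convert hf.memLN_linear_comb hu hv (1 / 2) (1 / 2) using 1
  module

lemma exists_best_approx (hf : IsDensity α f) (N : ℕ) (hA : MemLalpha α f A) :
    ∃ h, MemLN α N f h ∧ ∀ g, MemLN α N f g → lalpha α f (A - h) ≤ lalpha α f (A - g) := by
  obtain ⟨e, he, hmin⟩ := hf.exists_isMinOn_lalpha (K := {u | MemLN α N f (A - u)})
    (fun u hu => by simpa only [sub_sub_cancel] using hf.memLalpha_sub hA hu.1)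
    ⟨A, by simpa only [Set.mem_ofPred_eq, sub_self] using
      hf.memLN_of_mem_expSpan (Submodule.zero_mem _)⟩
    (fun u hu v hv => hf.memLN_sub_half_smul_add hu hv)
    fun p h hp hh hlim => hf.memLN_of_tendsto_memLN hp (hf.memLalpha_sub hA hh) (by
      simpa only [sub_sub_sub_cancel_left, hf.lalpha_sub_comm _ h] using hlim)
  refine ⟨A - e, he, fun g hg => ?_⟩
  rw [sub_sub_cancel]
  exact hmin (show MemLN α N f (A - (A - g)) by rwa [sub_sub_cancel])

lemma lalpha_sub_eq_zero_of_best_approx (hf : IsDensity α f) (hA : MemLalpha α f A)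
    (hh : MemLN α N f h) (hmin : ∀ g, MemLN α N f g → lalpha α f (A - h) ≤ lalpha α f (A - g))
    (hg : MemLN α N f g) (hgh : lalpha α f (A - g) ≤ lalpha α f (A - h)) :
    lalpha α f (g - h) = 0 := by
  rw [← sub_sub_sub_cancel_left h g A]
  refine hf.lalpha_sub_eq_zero_of_isMinOn (K := {u | MemLN α N f (A - u)})
    (fun u hu => by simpa only [sub_sub_cancel] using hf.memLalpha_sub hA hu.1)
    (fun u hu v hv => hf.memLN_sub_half_smul_add hu hv) ?_ ?_ (fun u hu => ?_) hgh
  · rwa [Set.mem_ofPred_eq, sub_sub_cancel]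
  · rwa [Set.mem_ofPred_eq, sub_sub_cancel]
  · exact show lalpha α f (A - h) ≤ lalpha α f u by simpa only [sub_sub_cancel] using hmin _ hu

end IsDensity

lemma MemLN.congr (hh : MemLN α N f h) (hhg : h =ᵐ[freq] g) : MemLN α N f g := by
  refine ⟨⟨hh.1.1.congr hhg, lalpha_congr hhg ▸ hh.1.2⟩, fun ε hε => ?_⟩
  obtain ⟨p, hp, hpε⟩ := hh.2 ε hε
  exact ⟨p, hp, lalpha_congr (hhg.sub (EventuallyEq.refl _ p)) ▸ hpε⟩

end BestApproximation

section FirstOrderCondition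

namespace IsAlphaForm

variable {ι : Type*} [Fintype ι] [DecidableEq ι] {α : ℝ} {F : Matrix ι ι ℂ}

lemma modular_sub_modular_le (hF : IsAlphaForm α F) (hα : 1 < α) (u v : ι → ℂ) :
    modular α F v - modular α F u ≤ α * (form α F (v - u) v).re := by
  have hsplit : modular α F v = (form α F u v).re + (form α F (v - u) v).re := by
    rw [← Complex.add_re, ← form_add_left, add_sub_cancel, modular]
  linear_combination hF.mul_re_form_le hα u v + α * hsplit

lemma convexOn_modular (hF : IsAlphaForm α F) (hα : 1 < α) :
    ConvexOn ℝ Set.univ (modular α F) := by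
  refine ⟨convex_univ, fun u _ v _ a b ha hb hab => ?_⟩
  set w := a • u + b • v
  have hw : modular α F w = a * (form α F u w).re + b * (form α F v w).re := by
    rw [modular, ← Complex.re_ofReal_mul, ← Complex.re_ofReal_mul, ← form_smul_left,
      ← form_smul_left, ← Complex.add_re, ← form_add_left, Complex.coe_smul, Complex.coe_smul]
  simp only [smul_eq_mul]
  linear_combination a * hF.mul_re_form_le hα u w + b * hF.mul_re_form_le hα v w + α * hw
    + (α - 1) * modular α F w * hab

lemma re_form_sub_sub_nonneg (hF : IsAlphaForm α F) (hα : 1 < α) (u v : ι → ℂ) :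
    0 ≤ (form α F (u - v) u - form α F (u - v) v).re := by
  rw [re_form_sub_sub]
  nlinarith [hF.mul_re_form_le hα u v, hF.mul_re_form_le hα v u]

lemma eq_of_re_form_sub_sub_eq_zero (hF : IsAlphaForm α F) (hα : 1 < α) {u v : ι → ℂ}
    (huv : (form α F (u - v) u - form α F (u - v) v).re = 0) : u = v := by
  rw [re_form_sub_sub] at huv
  refine hF.eq_of_mul_re_form_eq hα ((hF.mul_re_form_le hα u v).antisymm ?_)
  linear_combination hF.mul_re_form_le hα v u + α * huv

end IsAlphaForm

variable {T N : ℕ} {α : ℝ} {f : ℝ → Matrix (Fin T) (Fin T) ℂ} {e g h p : ℝ → Fin T → ℂ}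

namespace IsDensity

lemma integrable_form (hf : IsDensity α f) (hg : MemLalpha α f g) (hh : MemLalpha α f h) :
    Integrable (fun θ => form α (f θ) (g θ) (h θ)) freq := by
  refine ((hf.integrable_modular hg).add (hf.integrable_modular hh)).mono'
    (hf.aestronglyMeasurable_form hg.1 hh.1) ?_
  filter_upwards [hf.alphaForm] with θ hθ using hθ.norm_form_le hf.one_lt _ _

lemma integral_re_form_sub_nonneg (hf : IsDensity α f) (hg : MemLalpha α f g)
    (hh : MemLalpha α f h) (hgh : lalpha α f g ≤ lalpha α f h) :
    0 ≤ ∫ θ, (form α (f θ) ((h - g) θ) (h θ)).re ∂freq := by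
  have hle := ENNReal.toReal_mono hh.2.ne hgh
  rw [hf.toReal_lalpha hg.1, hf.toReal_lalpha hh.1, ← sub_nonneg,
    ← integral_sub (hf.integrable_modular hh) (hf.integrable_modular hg)] at hle
  refine nonneg_of_mul_nonneg_right (hle.trans ?_) hf.pos
  rw [← integral_const_mul]
  refine integral_mono_ae ((hf.integrable_modular hh).sub (hf.integrable_modular hg))
    ((hf.integrable_form (hf.memLalpha_sub hh hg) hh).re.const_mul α) ?_
  filter_upwards [hf.alphaForm] with θ hθ using hθ.modular_sub_modular_le hf.one_lt _ _

lemma tendsto_integral_re_form (hf : IsDensity α f) (he : MemLalpha α f e)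
    (hp : MemLalpha α f p) :
    Tendsto (fun s : ℝ => ∫ θ, (form α (f θ) (p θ) ((e + (s : ℂ) • p) θ)).re ∂freq) (𝓝[>] 0)
      (𝓝 (∫ θ, (form α (f θ) (p θ) (e θ)).re ∂freq)) := by
  refine tendsto_integral_filter_of_dominated_convergence (fun θ => modular α (f θ) (p θ) +
      (modular α (f θ) (e θ) + modular α (f θ) ((e + p) θ)))
    (Eventually.of_forall fun s => (hf.integrable_form hp
      (hf.memLalpha_add he (hf.memLalpha_smul s hp))).re.aestronglyMeasurable) ?_
    ((hf.integrable_modular hp).add ((hf.integrable_modular he).add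
      (hf.integrable_modular (hf.memLalpha_add he hp)))) (Eventually.of_forall fun θ => ?_)
  · filter_upwards [Ioo_mem_nhdsGT zero_lt_one] with s hs
    filter_upwards [hf.alphaForm] with θ hθ
    have hconv := (hθ.convexOn_modular hf.one_lt).2 (Set.mem_univ (e θ))
      (Set.mem_univ ((e + p) θ)) (sub_nonneg.mpr hs.2.le) hs.1.le (sub_add_cancel 1 s)
    have hsegment : (1 - s) • e θ + s • (e + p) θ = (e + (s : ℂ) • p) θ := by
      rw [Pi.add_apply, Pi.add_apply, Pi.smul_apply, Complex.coe_smul]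
      module
    rw [hsegment, smul_eq_mul, smul_eq_mul] at hconv
    refine (Complex.abs_re_le_norm _).trans ((hθ.norm_form_le hf.one_lt _ _).trans ?_)
    have h0 := hθ.modular_nonneg hf.one_lt
    nlinarith [hs.1, hs.2, h0 (e θ), h0 ((e + p) θ)]
  · have hcont : Continuous fun s : ℝ => (form α (f θ) (p θ) ((e + (s : ℂ) • p) θ)).re :=
      Complex.continuous_re.comp ((continuous_form hf.one_lt _ _).comp
        (continuous_const.add (Complex.continuous_ofReal.smul continuous_const)))
    simpa only [Complex.ofReal_zero, zero_smul, add_zero] using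
      (hcont.tendsto 0).mono_left nhdsWithin_le_nhds

lemma integral_re_form_nonneg (hf : IsDensity α f) (he : MemLalpha α f e)
    (hp : MemLalpha α f p) (h : ∀ s : ℝ, lalpha α f e ≤ lalpha α f (e + (s : ℂ) • p)) :
    0 ≤ ∫ θ, (form α (f θ) (p θ) (e θ)).re ∂freq := by
  refine ge_of_tendsto (hf.tendsto_integral_re_form he hp) ?_
  filter_upwards [self_mem_nhdsWithin] with s (hs : 0 < s)
  have hnonneg := hf.integral_re_form_sub_nonneg he
    (hf.memLalpha_add he (hf.memLalpha_smul s hp)) (h s)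
  simp only [add_sub_cancel_left, Pi.smul_apply, form_smul_left, Complex.re_ofReal_mul,
    integral_const_mul] at hnonneg
  exact nonneg_of_mul_nonneg_right hnonneg hs

lemma integral_form_eq_zero (hf : IsDensity α f) {S : Submodule ℂ (ℝ → Fin T → ℂ)}
    (hS : ∀ p ∈ S, MemLalpha α f p) (he : MemLalpha α f e)
    (hmin : ∀ p ∈ S, lalpha α f e ≤ lalpha α f (e + p)) (hp : p ∈ S) :
    ∫ θ, form α (f θ) (p θ) (e θ) ∂freq = 0 := by
  have hre (c : ℂ) : 0 ≤ (c * ∫ θ, form α (f θ) (p θ) (e θ) ∂freq).re := by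
    have hcp := S.smul_mem c hp
    have hnonneg := hf.integral_re_form_nonneg he (hS _ hcp)
      fun s => hmin _ (S.smul_mem (s : ℂ) hcp)
    rw [← integral_const_mul]
    simp only [Pi.smul_apply, form_smul_left] at hnonneg
    exact hnonneg.trans_eq (integral_re ((hf.integrable_form (hS _ hp) he).const_mul c))
  have hone := hre 1
  have hneg := hre (-1)
  have hI := hre Complex.I
  have hnegI := hre (-Complex.I)
  simp only [one_mul, neg_mul, Complex.neg_re, Complex.I_mul_re, neg_neg, Left.nonneg_neg_iff]
    at hone hneg hI hnegI
  exact Complex.ext (hneg.antisymm hone) (hI.antisymm hnegI)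

lemma errChar_ae_eq (hf : IsDensity α f) {c : Fin (N + 1) → Fin T → ℂ}
    (h : (fun θ => f θ *ᵥ vpow (e θ) (α - 1)) =ᵐ[freq] polyC c) : errChar α f c =ᵐ[freq] e := by
  have hα : 0 < α - 1 := sub_pos.mpr hf.one_lt
  filter_upwards [h, hf.posDef] with θ hθ hpos
  rw [errChar, ← hθ, Matrix.mulVec_mulVec, Matrix.nonsing_inv_mul _
    ((Matrix.isUnit_iff_isUnit_det _).mp hpos.isUnit), Matrix.one_mulVec,
    vpow_vpow hα (mul_one_div_cancel hα.ne')]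

lemma mulVec_vpow_errChar (hf : IsDensity α f) (c : Fin (N + 1) → Fin T → ℂ) :
    (fun θ => f θ *ᵥ vpow (errChar α f c θ) (α - 1)) =ᵐ[freq] polyC c := by
  have hα : 0 < α - 1 := sub_pos.mpr hf.one_lt
  filter_upwards [hf.posDef] with θ hpos
  rw [errChar, vpow_vpow (by positivity) (one_div_mul_cancel hα.ne'), Matrix.mulVec_mulVec,
    Matrix.mul_nonsing_inv _ ((Matrix.isUnit_iff_isUnit_det _).mp hpos.isUnit), Matrix.one_mulVec]

/- Testing the orthogonality relation with `e^{imθ} δ_l` shows that the Fourier coefficients of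
`f e^{<α-1>}` vanish off `{0, …, N}`. -/
lemma exists_errChar_ae_eq (hf : IsDensity α f) (he : MemLalpha α f e)
    (hmin : ∀ p ∈ expSpan T N, lalpha α f e ≤ lalpha α f (e + p)) :
    ∃ c : Fin (N + 1) → Fin T → ℂ, errChar α f c =ᵐ[freq] e := by
  have hform (m : ℤ) (l : Fin T) (θ : ℝ) : form α (f θ) (Pi.single l (ex m θ)) (e θ)
      = ex m θ * (f θ *ᵥ vpow (e θ) (α - 1)) l := single_dotProduct _ _ _
  have hmem (l : Fin T) : MemLalpha α f fun θ => Pi.single l (ex 0 θ) :=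
    hf.memLalpha_of_bounded
      ((continuous_single l).comp (continuous_ex 0)).aestronglyMeasurable
      fun θ => (by rw [Pi.norm_single, norm_ex] : _ = (1 : ℝ)).le
  obtain ⟨c, hc⟩ := exists_ae_eq_polyC (N := N) (G := fun θ => f θ *ᵥ vpow (e θ) (α - 1))
    (fun l => (hf.integrable_form (hmem l) he).congr (Eventually.of_forall fun θ =>
      (hform 0 l θ).trans (by rw [ex_zero, one_mul])))
    fun m hm l => by
      simpa only [hform] using hf.integral_form_eq_zero
        (fun _ hp => hf.memLalpha_of_mem_expSpan hp) he hmin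
        (Submodule.subset_span ⟨m, l, hm, rfl⟩ : (fun θ => Pi.single l (ex m θ)) ∈ expSpan T N)
  exact ⟨c, hf.errChar_ae_eq hc⟩

end IsDensity

end FirstOrderCondition

section System

variable {T N : ℕ} {α : ℝ} {f : ℝ → Matrix (Fin T) (Fin T) ℂ} {a c c' : Fin (N + 1) → Fin T → ℂ}

lemma polyA_sub_specChar (α : ℝ) (f : ℝ → Matrix (Fin T) (Fin T) ℂ)
    (a c : Fin (N + 1) → Fin T → ℂ) : polyA a - specChar α f a c = errChar α f c :=
  sub_sub_cancel (polyA a) (errChar α f c)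

lemma polyC_sub (θ : ℝ) : polyC (c - c') θ = polyC c θ - polyC c' θ := by
  simp only [polyC, Pi.sub_apply, smul_sub, Finset.sum_sub_distrib]

lemma IsDensity.memLalpha_polyA (hf : IsDensity α f) (a : Fin (N + 1) → Fin T → ℂ) :
    MemLalpha α f (polyA a) := by
  refine hf.memLalpha_of_bounded (C := ∑ j, ‖a j‖) ?_ fun θ => norm_sum_le_of_le _ fun j _ => ?_
  · exact (continuous_finsetSum _ fun j _ =>
      (continuous_ex _).smul continuous_const).aestronglyMeasurable
  · rw [norm_smul, norm_ex, one_mul]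

lemma MemLN.solvesSystem (hf : IsDensity α f) (h : MemLN α N f (specChar α f a c)) :
    SolvesSystem α f a c :=
  fun k l => ⟨integrable_ex_mul (hf.integrable_apply h.1 l) _, h.integral_ex_neg_mul hf k l⟩

lemma IsDensity.exists_memLN_specChar (hf : IsDensity α f) (a : Fin (N + 1) → Fin T → ℂ) :
    ∃ c, MemLN α N f (specChar α f a c) ∧
      ∀ g, MemLN α N f g → lalpha α f (polyA a - specChar α f a c) ≤ lalpha α f (polyA a - g) := by
  obtain ⟨h, hh, hmin⟩ := hf.exists_best_approx N (hf.memLalpha_polyA a)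
  obtain ⟨c, hc⟩ := hf.exists_errChar_ae_eq (N := N)
    (hf.memLalpha_sub (hf.memLalpha_polyA a) hh.1) fun p hp => by
      have hle := hmin _ (hf.memLN_linear_comb hh (hf.memLN_of_mem_expSpan hp) 1 (-1))
      rwa [one_smul, neg_one_smul, ← sub_eq_add_neg, ← sub_add] at hle
  refine ⟨c, hh.congr ?_, fun g hg => ?_⟩
  · filter_upwards [hc] with θ hθ
    rw [specChar, hθ, Pi.sub_apply, sub_sub_cancel]
  · rw [polyA_sub_specChar, lalpha_congr hc]
    exact hmin g hg

lemma SolvesSystem.integrable_dotProduct_polyC (hc : SolvesSystem α f a c)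
    (d : Fin (N + 1) → Fin T → ℂ) :
    Integrable (fun θ => specChar α f a c θ ⬝ᵥ polyC d θ) freq ∧
      ∫ θ, specChar α f a c θ ⬝ᵥ polyC d θ ∂freq = 0 := by
  have hexpand (θ : ℝ) : specChar α f a c θ ⬝ᵥ polyC d θ = ∑ l, ∑ j : Fin (N + 1),
      ex (-((j : ℕ) : ℤ)) θ * specChar α f a c θ l * d j l := by
    simp only [dotProduct, polyC_apply, Finset.mul_sum, mul_left_comm, mul_assoc]
  have hint (l : Fin T) (j : Fin (N + 1)) := (hc j l).1.mul_const (d j l)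
  simp only [hexpand]
  refine ⟨integrable_finsetSum _ fun l _ => integrable_finsetSum _ fun j _ => hint l j, ?_⟩
  rw [integral_finsetSum _ fun l _ => integrable_finsetSum _ fun j _ => hint l j]
  refine Finset.sum_eq_zero fun l _ => ?_
  rw [integral_finsetSum _ fun j _ => hint l j]
  exact Finset.sum_eq_zero fun j _ => by rw [integral_mul_const, (hc j l).2, zero_mul]

lemma SolvesSystem.unique (hf : IsDensity α f) (hc : SolvesSystem α f a c)
    (hc' : SolvesSystem α f a c') : c = c' := by
  set e := errChar α f c with he
  set e' := errChar α f c' with he'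
  let D (θ : ℝ) : ℝ := ((e θ - e' θ) ⬝ᵥ polyC (c - c') θ).re
  have hsub (θ : ℝ) : (e θ - e' θ) ⬝ᵥ polyC (c - c') θ = specChar α f a c' θ ⬝ᵥ polyC (c - c') θ
      - specChar α f a c θ ⬝ᵥ polyC (c - c') θ := by
    rw [← sub_dotProduct, specChar, specChar, sub_sub_sub_cancel_left]
  obtain ⟨hint, hzero⟩ := hc.integrable_dotProduct_polyC (c - c')
  obtain ⟨hint', hzero'⟩ := hc'.integrable_dotProduct_polyC (c - c')
  have hDint : Integrable D freq := by
    simp only [D, hsub]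
    exact (hint'.sub hint).re
  have hDzero : ∫ θ, D θ ∂freq = 0 := by
    simp only [D, hsub]
    refine (integral_re (hint'.sub hint)).trans ?_
    rw [integral_sub' hint' hint, hzero, hzero', sub_zero, map_zero]
  have hD : ∀ᵐ θ ∂freq, D θ =
      (form α (f θ) (e θ - e' θ) (e θ) - form α (f θ) (e θ - e' θ) (e' θ)).re := by
    filter_upwards [hf.mulVec_vpow_errChar c, hf.mulVec_vpow_errChar c'] with θ hθ hθ'
    rw [form, form, hθ, hθ', ← dotProduct_sub, ← polyC_sub]
  have hDnonneg : 0 ≤ᵐ[freq] D := by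
    filter_upwards [hf.alphaForm, hD] with θ hθ hDθ
      using (hθ.re_form_sub_sub_nonneg hf.one_lt _ _).trans_eq hDθ.symm
  refine polyC_injective ?_
  filter_upwards [hf.alphaForm, hD, (integral_eq_zero_iff_of_nonneg_ae hDnonneg hDint).mp hDzero,
    hf.mulVec_vpow_errChar c, hf.mulVec_vpow_errChar c'] with θ hform hDθ hDθ0 hθ hθ'
  have hee' : e θ = e' θ := hform.eq_of_re_form_sub_sub_eq_zero hf.one_lt (hDθ.symm.trans hDθ0)
  rw [← hθ, ← hθ', ← he, ← he', hee']

end System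

section Blocks

variable {Ω : Type*} {T N : ℕ} {ξ : ℤ → Ω → ℂ}

/-- The linear span of the observed values `ξ(m)`, `m ∉ {0, …, T(N+1) - 1}`, whose closure in
`‖·‖_α` is `observed`. -/
def observedSpan (T N : ℕ) (ξ : ℤ → Ω → ℂ) : Submodule ℂ (Ω → ℂ) :=
  Submodule.span ℂ (ξ '' (Set.Ico 0 ((T : ℤ) * (N + 1)))ᶜ)

lemma mul_add_val_mem_Ico_iff (j : ℤ) (k : Fin T) :
    j * T + (k : ℕ) ∈ Set.Ico 0 ((T : ℤ) * (N + 1)) ↔ j ∈ Set.Ico 0 ((N : ℤ) + 1) := by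
  have hk : ((k : ℕ) : ℤ) < T := Int.ofNat_lt.mpr k.2
  have hk0 : 0 ≤ ((k : ℕ) : ℤ) := Int.natCast_nonneg _
  have hT : (0 : ℤ) < T := hk0.trans_lt hk
  have hdiv : (j * T + (k : ℕ)) / T = j := by
    rw [add_comm, Int.add_mul_ediv_right _ _ hT.ne', Int.ediv_eq_zero_of_lt hk0 hk, zero_add]
  rw [Set.mem_Ico, Set.mem_Ico, mul_comm (T : ℤ), ← Int.ediv_lt_iff_lt_mul hT,
    ← Int.ediv_nonneg_iff_of_pos hT, hdiv]

lemma exists_mul_add_val_eq (hT : 1 ≤ T) (m : ℤ) : ∃ (j : ℤ) (k : Fin T), j * T + (k : ℕ) = m := by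
  have hT0 : (0 : ℤ) < T := Int.natCast_pos.mpr hT
  have hmod := Int.emod_nonneg m hT0.ne'
  refine ⟨m / T, ⟨(m % T).toNat, (Int.toNat_lt hmod).mpr (Int.emod_lt_of_pos m hT0)⟩, ?_⟩
  rw [Int.toNat_of_nonneg hmod, Int.ediv_mul_add_emod]

/-- The span of the pairs `(e^{ijθ} δ_k, ξ(jT + k))`, `j ∉ {0, …, N}`: the correspondence between
`expSpan` and `observedSpan`. -/
def pairSpan (T N : ℕ) (ξ : ℤ → Ω → ℂ) : Submodule ℂ ((ℝ → Fin T → ℂ) × (Ω → ℂ)) :=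
  Submodule.span ℂ {x | ∃ j : ℤ, ∃ k : Fin T,
    j ∉ Set.Ico 0 ((N : ℤ) + 1) ∧ x = (fun θ => Pi.single k (ex j θ), block T ξ j k)}

lemma map_fst_pairSpan : (pairSpan T N ξ).map (LinearMap.fst ℂ _ _) = expSpan T N := by
  rw [pairSpan, Submodule.map_span, expSpan]
  congr 1
  ext q
  constructor
  · rintro ⟨_, ⟨j, k, hj, rfl⟩, rfl⟩
    exact ⟨j, k, hj, rfl⟩
  · rintro ⟨j, k, hj, rfl⟩
    exact ⟨_, ⟨j, k, hj, rfl⟩, rfl⟩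

lemma map_snd_pairSpan (hT : 1 ≤ T) :
    (pairSpan T N ξ).map (LinearMap.snd ℂ _ _) = observedSpan T N ξ := by
  rw [pairSpan, Submodule.map_span, observedSpan]
  congr 1
  ext ζ
  constructor
  · rintro ⟨_, ⟨j, k, hj, rfl⟩, rfl⟩
    exact ⟨j * T + (k : ℕ), (mul_add_val_mem_Ico_iff j k).not.mpr hj, rfl⟩
  · rintro ⟨m, hm, rfl⟩
    obtain ⟨j, k, rfl⟩ := exists_mul_add_val_eq hT m
    exact ⟨_, ⟨j, k, (mul_add_val_mem_Ico_iff j k).not.mp hm, rfl⟩, rfl⟩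

end Blocks

section Observations

variable {Ω : Type*} [MeasurableSpace Ω] {T N : ℕ} {α : ℝ} {P : Measure Ω}
  {Z : ℝ → Ω → Fin T → ℂ} {f : ℝ → Matrix (Fin T) (Fin T) ℂ} {ξ : ℤ → Ω → ℂ}
  {p h : ℝ → Fin T → ℂ} {ζ η : Ω → ℂ}

/-- The graph `{(h, X) | X = ∫ hᵀ dZ}` of the stochastic integral, a linear relation. -/
def integralGraph (P : Measure Ω) (Z : ℝ → Ω → Fin T → ℂ) (hf : IsDensity α f) :
    Submodule ℂ ((ℝ → Fin T → ℂ) × (Ω → ℂ)) where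
  carrier := {x | IsStochIntegral α P Z f x.1 x.2}
  zero_mem' := isStochIntegral_zero hf
  add_mem' {x y} hx hy := by
    simpa only [one_smul, Set.mem_ofPred_eq, Prod.fst_add, Prod.snd_add] using
      IsStochIntegral.linear_comb hx hy hf 1 1
  smul_mem' c x hx := by
    simpa only [zero_smul, add_zero, Set.mem_ofPred_eq, Prod.smul_fst, Prod.smul_snd] using
      IsStochIntegral.linear_comb hx hx hf c 0

namespace IsHarmonizable

lemma isStochIntegral_functional (hξ : IsHarmonizable α P (block T ξ) Z f) (hf : IsDensity α f)
    (a : Fin (N + 1) → Fin T → ℂ) : IsStochIntegral α P Z f (polyA a) (functional a ξ) := by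
  have hsum : ∑ j, ∑ k, a j k • (((fun θ => Pi.single k (ex ((j : ℕ) : ℤ) θ)) : ℝ → Fin T → ℂ),
      block T ξ ((j : ℕ) : ℤ) k) ∈ integralGraph P Z hf :=
    Submodule.sum_mem _ fun j _ => Submodule.sum_mem _ fun k _ =>
      Submodule.smul_mem _ _ (hξ.repr _ k)
  convert (show IsStochIntegral α P Z f _ _ from hsum) using 1
  · ext θ l
    simp only [polyA, Prod.fst_sum, Prod.smul_fst, Finset.sum_apply, Pi.smul_apply, smul_eq_mul,
      Pi.single_apply, mul_ite, mul_zero, Finset.sum_ite_eq, Finset.mem_univ, if_true, mul_comm]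
  · ext ω
    simp only [functional, block, Prod.snd_sum, Prod.smul_snd, Finset.sum_apply, Pi.smul_apply,
      smul_eq_mul]

lemma pairSpan_le (hξ : IsHarmonizable α P (block T ξ) Z f) (hf : IsDensity α f) :
    pairSpan T N ξ ≤ integralGraph P Z hf :=
  Submodule.span_le.mpr fun _ ⟨j, k, _, hx⟩ => hx ▸ hξ.repr j k

lemma exists_mem_expSpan (hξ : IsHarmonizable α P (block T ξ) Z f) (hf : IsDensity α f)
    (hT : 1 ≤ T) (hζ : ζ ∈ observedSpan T N ξ) :
    ∃ p ∈ expSpan T N, IsStochIntegral α P Z f p ζ := by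
  rw [← map_snd_pairSpan hT] at hζ
  obtain ⟨x, hx, rfl⟩ := hζ
  exact ⟨x.1, map_fst_pairSpan ▸ Submodule.mem_map_of_mem hx, hξ.pairSpan_le hf hx⟩

lemma exists_mem_observedSpan (hξ : IsHarmonizable α P (block T ξ) Z f) (hf : IsDensity α f)
    (hT : 1 ≤ T) (hp : p ∈ expSpan T N) :
    ∃ ζ ∈ observedSpan T N ξ, IsStochIntegral α P Z f p ζ := by
  rw [← map_fst_pairSpan (ξ := ξ)] at hp
  obtain ⟨x, hx, rfl⟩ := hp
  exact ⟨x.2, map_snd_pairSpan hT ▸ Submodule.mem_map_of_mem hx, hξ.pairSpan_le hf hx⟩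

end IsHarmonizable

lemma IsDensity.tendsto_lalpha_sub_of_tendsto (hf : IsDensity α f) {q : ℕ → ℝ → Fin T → ℂ}
    (hh : MemLalpha α f h) (hq : ∀ n, MemLalpha α f (q n))
    (hlim : Tendsto (fun n => lalpha α f (h - q n)) atTop (𝓝 0)) :
    Tendsto (fun i : ℕ × ℕ => lalpha α f (q i.1 - q i.2)) atTop (𝓝 0) := by
  rw [← prod_atTop_atTop_eq]
  have hlim' : Tendsto (fun n => lalpha α f (q n - h)) atTop (𝓝 0) := by
    simpa only [hf.lalpha_sub_comm] using hlim
  refine (hf.tendsto_lalpha_add_zero (fun i : ℕ × ℕ => (hq i.1).1.sub hh.1)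
    (fun i => hh.1.sub (hq i.2).1) (hlim'.comp tendsto_fst) (hlim.comp tendsto_snd)).congr
    fun i => ?_
  rw [sub_add_sub_cancel]

lemma tendstoInMeasure_sub_of_tendstoInMeasure {E : Type*} [SeminormedAddCommGroup E]
    {X : ℕ → Ω → E} {Y : Ω → E} (hX : TendstoInMeasure P X atTop Y) :
    TendstoInMeasure P (fun i : ℕ × ℕ => X i.1 - X i.2) atTop 0 := by
  rw [← prod_atTop_atTop_eq]
  have hneg : TendstoInMeasure P (fun n => -X n) atTop (-Y) := by
    rw [tendstoInMeasure_iff_norm] at hX ⊢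
    simpa only [Pi.neg_apply, neg_sub_neg, norm_sub_rev] using hX
  have hfst : TendstoInMeasure P (fun i : ℕ × ℕ => X i.1) (atTop ×ˢ atTop) Y :=
    fun ε hε => (hX ε hε).comp tendsto_fst
  have hsnd : TendstoInMeasure P (fun i : ℕ × ℕ => -X i.2) (atTop ×ˢ atTop) (-Y) :=
    fun ε hε => (hneg ε hε).comp tendsto_snd
  simpa only [← sub_eq_add_neg, sub_self] using tendstoInMeasure_add hfst hsnd

variable [IsProbabilityMeasure P]

namespace IsStochIntegral

lemma saNorm_rpow (hη : IsStochIntegral α P Z f h η) (hf : IsDensity α f)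
    (hZ : HasSpectralDensity α P Z f) : saNorm α P η ^ α = (lalpha α f h).toReal :=
  (hη.hasScale hf hZ).saNorm_rpow hf.one_lt

lemma saNorm_le_iff {g : ℝ → Fin T → ℂ} (hη : IsStochIntegral α P Z f h η)
    (hζ : IsStochIntegral α P Z f g ζ) (hf : IsDensity α f) (hZ : HasSpectralDensity α P Z f) :
    saNorm α P η ≤ saNorm α P ζ ↔ lalpha α f h ≤ lalpha α f g := by
  rw [(hη.hasScale hf hZ).saNorm_eq hf.one_lt, (hζ.hasScale hf hZ).saNorm_eq hf.one_lt,
    Real.rpow_le_rpow_iff ENNReal.toReal_nonneg ENNReal.toReal_nonneg (one_div_pos.mpr hf.pos),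
    ENNReal.toReal_le_toReal hη.1.2.ne hζ.1.2.ne]

lemma tendsto_saNorm_zero {q : ℕ → ℝ → Fin T → ℂ} {X : ℕ → Ω → ℂ}
    (hX : ∀ n, IsStochIntegral α P Z f (q n) (X n)) (hf : IsDensity α f)
    (hZ : HasSpectralDensity α P Z f) (hq : Tendsto (fun n => lalpha α f (q n)) atTop (𝓝 0)) :
    Tendsto (fun n => saNorm α P (X n)) atTop (𝓝 0) := by
  have hscale n : saNorm α P (X n) = (lalpha α f (q n)).toReal ^ (1 / α) :=
    ((hX n).hasScale hf hZ).saNorm_eq hf.one_lt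
  simpa only [hscale, ENNReal.toReal_zero, Real.zero_rpow (one_div_pos.mpr hf.pos).ne',
    Function.comp_apply] using ((ENNReal.tendsto_toReal ENNReal.zero_ne_top).comp hq).rpow_const
      (Or.inr (one_div_pos.mpr hf.pos).le)

lemma ae_eq {g : ℝ → Fin T → ℂ} (hη : IsStochIntegral α P Z f h η)
    (hζ : IsStochIntegral α P Z f g ζ) (hf : IsDensity α f) (hZ : HasSpectralDensity α P Z f)
    (hhg : lalpha α f (h - g) = 0) : η =ᵐ[P] ζ := by
  have hscale := (hη.sub hζ hf).hasScale hf hZ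
  rw [hhg, ENNReal.toReal_zero] at hscale
  filter_upwards [hscale.ae_eq_zero hf.pos] with ω hω using sub_eq_zero.mp hω

end IsStochIntegral

lemma IsHarmonizable.exists_mem_observed (hξ : IsHarmonizable α P (block T ξ) Z f)
    (hf : IsDensity α f) (hT : 1 ≤ T) (hh : MemLN α N f h) :
    ∃ Y ∈ observed α T N P ξ, IsStochIntegral α P Z f h Y := by
  have hZ := hξ.process
  obtain ⟨q, hq, hlim⟩ := hh.exists_seq_tendsto
  choose ζ hζ hqζ using fun n => hξ.exists_mem_observedSpan hf hT (hq n)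
  have hdiff (i : ℕ × ℕ) : IsStochIntegral α P Z f (q i.1 - q i.2) (ζ i.1 - ζ i.2) :=
    (hqζ i.1).sub (hqζ i.2) hf
  obtain ⟨ns, Y, hns, hY⟩ := exists_subseq_tendstoInMeasure
    (fun n => ((hqζ n).hasScale hf hZ).aemeasurable.aestronglyMeasurable)
    ((IsStochIntegral.tendstoInMeasure_zero_iff hdiff hf hZ).mpr
      (hf.tendsto_lalpha_sub_of_tendsto hh.1 (fun n => (hqζ n).1) hlim))
  have hYint : IsStochIntegral α P Z f h Y :=
    IsStochIntegral.of_tendsto (fun k => hqζ (ns k)) hf hZ hh.1 (hlim.comp hns.tendsto_atTop) hY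
  refine ⟨Y, fun ε hε => ?_, hYint⟩
  obtain ⟨n, hn⟩ := ((IsStochIntegral.tendsto_saNorm_zero (fun n => hYint.sub (hqζ n) hf) hf hZ
    hlim).eventually_lt_const hε).exists
  exact ⟨ζ n, hζ n, ((hYint.sub (hqζ n) hf).hasScale hf hZ).isSaS hf.pos, hn⟩

lemma exists_seq_tendstoInMeasure_of_mem_observed (hα : 1 < α) (hη : η ∈ observed α T N P ξ) :
    ∃ ζ : ℕ → Ω → ℂ, (∀ n, ζ n ∈ observedSpan T N ξ) ∧ TendstoInMeasure P ζ atTop η := by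
  have hα0 : 0 < α := zero_lt_one.trans hα
  choose ζ hζ hS hlt using fun n : ℕ => hη (1 / ((n : ℝ) + 1)) (by positivity)
  choose M hM using fun n => (hS n).exists_hasScale hα0
  have hnorm_nonneg n : 0 ≤ saNorm α P (η - ζ n) := by
    rw [(hM n).saNorm_eq hα]
    exact Real.rpow_nonneg (hM n).nonneg _
  have hnorm : Tendsto (fun n => saNorm α P (η - ζ n)) atTop (𝓝 0) :=
    squeeze_zero hnorm_nonneg (fun n => (hlt n).le) tendsto_one_div_add_atTop_nhds_zero_nat
  have hMlim : Tendsto M atTop (𝓝 0) := by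
    simpa only [(hM _).saNorm_rpow hα, Real.zero_rpow hα0.ne'] using
      hnorm.rpow_const (p := α) (Or.inr hα0.le)
  have hdiff := (HasScale.tendstoInMeasure_zero_iff hα0 hM).mpr hMlim
  refine ⟨ζ, hζ, ?_⟩
  rw [tendstoInMeasure_iff_norm] at hdiff ⊢
  simpa only [Pi.sub_apply, Pi.zero_apply, sub_zero, norm_sub_rev] using hdiff

lemma IsHarmonizable.exists_memLN (hξ : IsHarmonizable α P (block T ξ) Z f)
    (hf : IsDensity α f) (hT : 1 ≤ T) (hη : η ∈ observed α T N P ξ) :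
    ∃ h, MemLN α N f h ∧ IsStochIntegral α P Z f h η := by
  have hZ := hξ.process
  obtain ⟨ζ, hζ, hlim⟩ := exists_seq_tendstoInMeasure_of_mem_observed hf.one_lt hη
  choose p hp hpζ using fun n => hξ.exists_mem_expSpan hf hT (hζ n)
  have hdiff (i : ℕ × ℕ) : IsStochIntegral α P Z f (p i.1 - p i.2) (ζ i.1 - ζ i.2) :=
    (hpζ i.1).sub (hpζ i.2) hf
  obtain ⟨h, hh, hph⟩ := hf.exists_tendsto_lalpha_of_cauchy (fun n => (hpζ n).1)
    ((IsStochIntegral.tendstoInMeasure_zero_iff hdiff hf hZ).mp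
      (tendstoInMeasure_sub_of_tendstoInMeasure hlim))
  exact ⟨h, memLN_of_tendsto hh hp hph, IsStochIntegral.of_tendsto hpζ hf hZ hh hph hlim⟩

end Observations

section OptimalEstimate

variable {Ω : Type*} [MeasurableSpace Ω] {T N : ℕ} {α : ℝ} {P : Measure Ω}
  [IsProbabilityMeasure P] {Z : ℝ → Ω → Fin T → ℂ} {f : ℝ → Matrix (Fin T) (Fin T) ℂ}
  {ξ : ℤ → Ω → ℂ} {g h : ℝ → Fin T → ℂ} {A Y Y' : Ω → ℂ} {c : Fin (N + 1) → Fin T → ℂ}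

lemma IsHarmonizable.isOptimal_of_best_approx (hξ : IsHarmonizable α P (block T ξ) Z f)
    (hf : IsDensity α f) (hT : 1 ≤ T) (hA : IsStochIntegral α P Z f g A)
    (hYint : IsStochIntegral α P Z f h Y) (hY : Y ∈ observed α T N P ξ)
    (hmin : ∀ q, MemLN α N f q → lalpha α f (g - h) ≤ lalpha α f (g - q)) :
    IsOptimal α T N P ξ A Y := by
  refine ⟨hY, fun η hη => ?_⟩
  obtain ⟨q, hq, hqη⟩ := hξ.exists_memLN hf hT hη
  exact ((hA.sub hYint hf).saNorm_le_iff (hA.sub hqη hf) hf hξ.process).mpr (hmin q hq)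

lemma IsHarmonizable.ae_eq_of_isOptimal (hξ : IsHarmonizable α P (block T ξ) Z f)
    (hf : IsDensity α f) (hT : 1 ≤ T) (hA : IsStochIntegral α P Z f g A)
    (hYint : IsStochIntegral α P Z f h Y) (hY : Y ∈ observed α T N P ξ) (hh : MemLN α N f h)
    (hmin : ∀ q, MemLN α N f q → lalpha α f (g - h) ≤ lalpha α f (g - q))
    (hY' : IsOptimal α T N P ξ A Y') : Y' =ᵐ[P] Y := by
  obtain ⟨q, hq, hqY'⟩ := hξ.exists_memLN hf hT hY'.1
  have hle := ((hA.sub hqY' hf).saNorm_le_iff (hA.sub hYint hf) hf hξ.process).mp (hY'.2 Y hY)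
  exact hqY'.ae_eq hYint hf hξ.process
    (hf.lalpha_sub_eq_zero_of_best_approx hA.1 hh hmin hq hle)

lemma IsDensity.toReal_lalpha_eq_integral_form (hf : IsDensity α f) (hh : MemLalpha α f h) :
    ((lalpha α f h).toReal : ℂ) = ∫ θ, form α (f θ) (h θ) (h θ) ∂freq := by
  rw [hf.toReal_lalpha hh.1, ← integral_complex_ofReal]
  refine integral_congr_ae ?_
  filter_upwards [hf.alphaForm] with θ hθ using (hθ.form_self hf.one_lt _).symm

lemma IsDensity.toReal_lalpha_of_subsingleton [Subsingleton (Fin T)] (hf : IsDensity α f)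
    (hh : MemLalpha α f h) (k : Fin T) :
    (lalpha α f h).toReal = ∫ θ, ‖h θ k‖ ^ α * (f θ k k).re ∂freq := by
  simp only [hf.toReal_lalpha hh.1, modular_eq_of_subsingleton hf.one_lt _ _ k]

end OptimalEstimate

end StableInterp

end

open StableInterp

theorem mainTheorem4 {Ω : Type*} [MeasurableSpace Ω] (P : Measure Ω) [IsProbabilityMeasure P]
    (α : ℝ) (hα1 : 1 < α) (hα2 : α ≤ 2) (T N : ℕ) (hT : 1 ≤ T)
    (ξ : ℤ → Ω → ℂ) (Z : ℝ → Ω → Fin T → ℂ) (f : ℝ → Matrix (Fin T) (Fin T) ℂ)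
    (hξ : StableInterp.IsPeriodicallyHarmonizable α T P ξ Z f)
    (hf : StableInterp.Minimality α f)
    (a : Fin (N + 1) → Fin T → ℂ) :
    (∃! c : Fin (N + 1) → Fin T → ℂ, StableInterp.SolvesSystem α f a c) ∧
    ∀ c : Fin (N + 1) → Fin T → ℂ, StableInterp.SolvesSystem α f a c →
      StableInterp.MemLN α N f (StableInterp.specChar α f a c) ∧
      ∃ Y : Ω → ℂ,
        StableInterp.IsStochIntegral α P Z f (StableInterp.specChar α f a c) Y ∧
        StableInterp.IsOptimal α T N P ξ (StableInterp.functional a ξ) Y ∧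
        (∀ Y' : Ω → ℂ, StableInterp.IsOptimal α T N P ξ (StableInterp.functional a ξ) Y' →
          Y' =ᵐ[P] Y) ∧
        IntegrableOn (fun θ => StableInterp.errChar α f c θ ⬝ᵥ
          (f θ *ᵥ StableInterp.vpow (StableInterp.errChar α f c θ) (α - 1)))
          (Set.Ioc (-Real.pi) Real.pi) ∧
        ((StableInterp.saNorm α P (StableInterp.functional a ξ - Y) ^ α : ℝ) : ℂ)
          = ∫ θ in Set.Ioc (-Real.pi) Real.pi, StableInterp.errChar α f c θ ⬝ᵥ
              (f θ *ᵥ StableInterp.vpow (StableInterp.errChar α f c θ) (α - 1)) ∧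
        (T = 1 → ∀ k : Fin T,
          StableInterp.saNorm α P (StableInterp.functional a ξ - Y) ^ α
            = ∫ θ in Set.Ioc (-Real.pi) Real.pi,
                ‖StableInterp.errChar α f c θ k‖ ^ α * (f θ k k).re) := by
  have hH := hξ.2
  have hd := hH.process.isDensity hα1 hα2 hf
  obtain ⟨c₀, hLN, hmin⟩ := hd.exists_memLN_specChar (N := N) a
  have hc₀ := hLN.solvesSystem hd
  refine ⟨⟨c₀, hc₀, fun c hc => hc.unique hd hc₀⟩, fun c hc => ?_⟩
  obtain rfl := hc₀.unique hd hc
  have hA := hH.isStochIntegral_functional hd a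
  obtain ⟨Y, hY, hYint⟩ := hH.exists_mem_observed hd hT hLN
  have herrInt : IsStochIntegral α P Z f (errChar α f c₀) (functional a ξ - Y) :=
    polyA_sub_specChar α f a c₀ ▸ hA.sub hYint hd
  have herr := herrInt.saNorm_rpow hd hH.process
  refine ⟨hLN, Y, hYint, hH.isOptimal_of_best_approx hd hT hA hYint hY hmin,
    fun _ hY' => hH.ae_eq_of_isOptimal hd hT hA hYint hY hLN hmin hY',
    hd.integrable_form herrInt.1 herrInt.1, ?_, fun hT1 k => ?_⟩
  · rw [herr]
    exact hd.toReal_lalpha_eq_integral_form herrInt.1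
  · have : Subsingleton (Fin T) := Fin.subsingleton_iff_le_one.mpr hT1.le
    rw [herr]
    exact hd.toReal_lalpha_of_subsingleton herrInt.1 k
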